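/- Let $\Sigma=\{1,\dots,\sigma\}$, $\sigma\ge 1$, and let $w$ be a word of length $n$ over $\Sigma$ in which every letter of $\Sigma$ occurs. A word $v\in\Sigma^*$ is an absent subsequence of $w$ if it is not a (scattered) subsequence of $w$, and a shortest absent subsequence (SAS) of $w$ if, in addition, no absent subsequence of $w$ over $\Sigma$ is shorter. Let $w=\mathrm{ar}_w(1)\cdots \mathrm{ar}_w(k)\,r(w)$ be the arch factorisation of $w$: every arch $\mathrm{ar}_w(\ell)$ contains all letters of $\Sigma$, its last letter occurs exactly once in it, and some letter of $\Sigma$ does not occur in $r(w)$. Positions of $w$ are counted from $1$. For $\ell\in[1:k]$ and $a\in\Sigma$ define: - $\mathrm{firstPosArch}[\ell][a]$ and $\mathrm{lastPosArch}[\ell][a]$: the leftmost and the rightmost position of $a$ inside $\mathrm{ar}_w(\ell)$; - $\mathrm{dist}[i]$, $i\in[1:n]$: the least length of a word over $\Sigma$ that starts with $w[i]$ and is not a subsequence of $w[i:n]$; - $L'_\ell=\{\mathrm{lastPosArch}[\ell][a]\mid a\in\Sigma\}\setminus\{\mathrm{lastPosArch}[\ell][a]\mid \mathrm{dist}[\mathrm{firstPosArch}[\ell+1][a]]>k-\ell+1\}$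 for $\ell<k$, and $L'_k=\{\mathrm{lastPosArch}[k][a]\mid a\in\Sigma\}\setminus\{\mathrm{lastPosArch}[k][a]\mid a \text{ occurs in } r(w)\}$; - $\mathrm{sortedLast}[\ell][\cdot]$: the elements of $L'_\ell$ in ascending order, indexed from $1$; - $\mathrm{Leq}[\ell][i]=\max(\{t\mid \mathrm{sortedLast}[\ell][t]\le i\}\cup\{-\infty\})$ for every position $i$ of $\mathrm{ar}_w(\ell)$; - $\mathrm{Lex}[\ell][t]$, $1\le t\le |L'_\ell|$: the position among $\mathrm{sortedLast}[\ell][1],\dots,\mathrm{sortedLast}[\ell][t]$ that carries the smallest letter; - $\mathrm{startSAS}$: the list of the positions $\mathrm{firstPosArch}[1][a]$, $a\in\Sigma$, with $\mathrm{dist}[\mathrm{firstPosArch}[1][a]]=k+1$; and $\mathrm{init}$: the element of $\mathrm{startSAS}$ that carries the smallest letter. The computational model is the unit-cost RAM with logarithmic word size: each operation takes one step and all values, including addresses, are $O(n)$. There are fixed programs (independent of $w$), with constants independent of $w$, such that the following hold. 0. Given $w$, $n$ and $\sigma$, the number of arches, their end positions, the arrays $\mathrm{firstPosArch}$, $\mathrm{lastPosArch}$,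 $\mathrm{sortedLast}$ (with the lengths of its rows), $\mathrm{Leq}$, $\mathrm{Lex}$, the list $\mathrm{startSAS}$ (with its length) and the position $\mathrm{init}$ are computed in $O(n)$ time. Given these data (and $w$, $n$, $\sigma$), and leaving them intact: 1. for every word $u\in\Sigma^*$ of length $k+1$, it is decided in $O(k)$ time whether $u$ is an SAS of $w$; 2. the lexicographically smallest SAS of $w$ is computed in $O(k)$ time; 3. all SAS of $w$ are output, each exactly once, with polynomial delay: the numbers of steps before the first output word is completed, between the completions of two consecutive output words, and after the last one until the program halts are bounded by a fixed polynomial in $n$. -/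

import Mathlib

/-! ### Words, absent subsequences, arch factorisation

Letters are natural numbers; a word is a `List ℕ`; positions are counted from `1`. -/

/-- `w` is a word over `{1, …, σ}` in which every letter of that alphabet occurs. -/
def IsWordOver (σ : ℕ) (w : List ℕ) : Prop :=
  ∀ a, a ∈ w ↔ 1 ≤ a ∧ a ≤ σ

/-- The letter `w[i]`, for `1 ≤ i ≤ |w|`. -/
def letterAt (w : List ℕ) (i : ℕ) : ℕ := w.getD (i - 1) 0

/-- `v` is a word over `alph(w)` that is not a subsequence of `w`. -/
def IsAbsent (w v : List ℕ) : Prop :=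
  (∀ a ∈ v, a ∈ w) ∧ ¬ v.Sublist w

/-- `v` is a shortest absent subsequence of `w`. -/
def IsSAS (w v : List ℕ) : Prop :=
  IsAbsent w v ∧ ∀ v', IsAbsent w v' → v.length ≤ v'.length

/-- The arch factorisation `w = ar(1) ⋯ ar(k) r`: every arch contains all letters of `w`, its last
letter occurs only once in it, and some letter of `w` does not occur in the rest `r`. -/
structure ArchFactorization (w : List ℕ) where
  arches : List (List ℕ)
  rest : List ℕ
  eq_append : arches.flatten ++ rest = w
  arch_universal : ∀ x ∈ arches, ∀ a ∈ w, a ∈ x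
  arch_last : ∀ x ∈ arches, ∃ (y : List ℕ) (a : ℕ), x = y ++ [a] ∧ a ∉ y
  rest_missing : ∃ a ∈ w, a ∉ rest

/-- Every nonempty word has an arch factorisation. -/
theorem ArchFactorization.nonempty_of_ne_nil (w : List ℕ) (hw : w ≠ []) :
    Nonempty (ArchFactorization w) := by
  have key : ∀ (m : ℕ) (v : List ℕ), v.length = m →
      ∃ (L : List (List ℕ)) (r : List ℕ), L.flatten ++ r = v ∧
        (∀ x ∈ L, ∀ a ∈ w, a ∈ x) ∧
        (∀ x ∈ L, ∃ (y : List ℕ) (a : ℕ), x = y ++ [a] ∧ a ∉ y) ∧ ∃ a ∈ w, a ∉ r := by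
    intro m
    induction m using Nat.strong_induction_on with
    | _ m ih =>
      intro v hv
      by_cases h : ∃ a ∈ w, a ∉ v
      · exact ⟨[], v, by simp, by simp, by simp, h⟩
      · push Not at h
        have hex : ∃ g, ∀ a ∈ w, a ∈ v.take g := ⟨v.length, by simpa using h⟩
        classical
        have hg := Nat.find_spec hex
        set g := Nat.find hex with hgdef
        obtain ⟨b, hb⟩ := List.exists_mem_of_ne_nil w hw
        have hg0 : 0 < g := by
          rcases Nat.eq_zero_or_pos g with h0 | h0
          · have := hg b hb
            simp [h0] at this
          · exact h0
        obtain ⟨a, haw, hna⟩ : ∃ a ∈ w, a ∉ v.take (g - 1) := by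
          have := Nat.find_min hex (m := g - 1) (by omega)
          push Not at this
          exact this
        have hlt : g - 1 < v.length := by
          by_contra hcon
          exact hna (by rw [List.take_of_length_le (by omega)]; exact h a haw)
        have htake : v.take g = v.take (g - 1) ++ [v[g - 1]] := by
          rw [List.take_append_getElem hlt, Nat.sub_add_cancel hg0]
        have hav : a = v[g - 1] := by
          have h1 := hg a haw
          rw [htake, List.mem_append] at h1
          rcases h1 with h1 | h1
          · exact absurd h1 hna
          · simpa using h1
        obtain ⟨L, r, h1, h2, h3, h4⟩ := ih (v.drop g).length
          (by rw [List.length_drop]; omega) (v.drop g) rfl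
        refine ⟨v.take g :: L, r, ?_, ?_, ?_, h4⟩
        · rw [List.flatten_cons, List.append_assoc, h1, List.take_append_drop]
        · intro x hx
          rcases List.mem_cons.1 hx with rfl | hx
          · exact hg
          · exact h2 x hx
        · intro x hx
          rcases List.mem_cons.1 hx with rfl | hx
          · exact ⟨v.take (g - 1), a, by rw [htake, hav], hna⟩
          · exact h3 x hx
  obtain ⟨L, r, h1, h2, h3, h4⟩ := key w.length w rfl
  exact ⟨⟨L, r, h1, h2, h3, h4⟩⟩

/-- The least length of a word over `alph(w)` that starts with `w[i]` and is not a subsequence of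
the suffix `w[i:n]`. -/
noncomputable def distArr (w : List ℕ) (i : ℕ) : ℕ :=
  sInf {m | ∃ u : List ℕ, u.length = m ∧ u.head? = some (letterAt w i) ∧
    (∀ a ∈ u, a ∈ w) ∧ ¬ u.Sublist (w.drop (i - 1))}

namespace ArchFactorization

variable {w : List ℕ} (F : ArchFactorization w)

/-- The number of arches. -/
def k : ℕ := F.arches.length

/-- `|ar(1) ⋯ ar(ℓ)|`, the last position of the `ℓ`-th arch. -/
def archEnd (ℓ : ℕ) : ℕ := (F.arches.take ℓ).flatten.length

/-- Position `i` lies in the `ℓ`-th arch (`1 ≤ ℓ ≤ k`). -/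
def InArch (ℓ i : ℕ) : Prop := F.archEnd (ℓ - 1) < i ∧ i ≤ F.archEnd ℓ

/-- The leftmost position of the letter `a` in the `ℓ`-th arch. -/
noncomputable def firstPosArch (ℓ a : ℕ) : ℕ := sInf {i | F.InArch ℓ i ∧ letterAt w i = a}

/-- The rightmost position of the letter `a` in the `ℓ`-th arch. -/
noncomputable def lastPosArch (ℓ a : ℕ) : ℕ := sSup {i | F.InArch ℓ i ∧ letterAt w i = a}

/-- The letters `a` whose last position in the `ℓ`-th arch is filtered out: for `ℓ < k` those with
`dist[firstPosArch[ℓ+1][a]] > k - ℓ + 1`, for `ℓ = k` those that occur in the rest. -/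
noncomputable def filteredLetters (ℓ : ℕ) : Finset ℕ :=
  if ℓ < F.k then w.toFinset.filter (fun a => F.k - ℓ + 1 < distArr w (F.firstPosArch (ℓ + 1) a))
  else F.rest.toFinset

/-- The set `L'_ℓ`. -/
noncomputable def lastSet (ℓ : ℕ) : Finset ℕ :=
  w.toFinset.image (F.lastPosArch ℓ) \ (F.filteredLetters ℓ).image (F.lastPosArch ℓ)

/-- The array `sortedLast[ℓ][·]`: the elements of `L'_ℓ` in ascending order. Its `t`-th element,
`t ≥ 1`, is `letterAt (F.sortedLast ℓ) t`. -/
noncomputable def sortedLast (ℓ : ℕ) : List ℕ := (F.lastSet ℓ).sort (· ≤ ·)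

/-- `Leq[ℓ][i] = max ({t | sortedLast[ℓ][t] ≤ i} ∪ {-∞})`, with `⊥` for `-∞`. -/
noncomputable def leqArr (ℓ i : ℕ) : WithBot ℕ :=
  ((Finset.Icc 1 (F.sortedLast ℓ).length).filter
    (fun t => letterAt (F.sortedLast ℓ) t ≤ i)).max

/-- `Lex[ℓ][t]`, for `1 ≤ t ≤ |L'_ℓ|`: the position among the first `t` elements of
`sortedLast[ℓ][·]` that carries the smallest letter. -/
noncomputable def lexArr (ℓ t : ℕ) : ℕ :=
  (((F.sortedLast ℓ).take t).argmin (letterAt w)).getD 0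

/-- The list of the positions `firstPosArch[1][a]`, `a ∈ Σ`, whose `dist` value is `k + 1`. -/
noncomputable def startSAS : List ℕ :=
  ((w.toFinset.sort (· ≤ ·)).map (F.firstPosArch 1)).filter (fun i => distArr w i = F.k + 1)

/-- The element of `startSAS` that carries the smallest letter. -/
noncomputable def init : ℕ := (F.startSAS.argmin (letterAt w)).getD 0

end ArchFactorization

/-! ### The machine model

A unit-cost random access machine with bounded machine words. Programs are structured and have
finitely many registers and finitely many one-dimensional arrays with indirect addressing (as usual,
these arrays can be interleaved into one memory). Every operation (arithmetic, comparison, access to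
a register or an array cell, test of a branch or a loop, output) costs one step. No value that
occurs, in particular no address, may exceed the word bound `B`. -/

/-- Register names. -/
inductive RegName where
  | n | sigma | k | init | startLen | ans
  | tmp (i : ℕ)
deriving DecidableEq

/-- Array names. -/
inductive ArrName where
  | word | query | archEnd | firstPosArch | lastPosArch | sortedLast | sortedLen | leq | lex
  | startSAS
  | tmp (i : ℕ)
deriving DecidableEq

/-- A machine state: registers, arrays, the number of steps made, the word that is being written on
the output tape, and the finished output words, each with the time at which it was finished. -/
structure RamState where
  reg : RegName → ℕ
  arr : ArrName → ℕ → ℕ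
  time : ℕ
  cur : List ℕ
  out : List (List ℕ × ℕ)

/-- The clock is at `0` and the output tape is empty; the memory is arbitrary. -/
def RamState.Fresh (s : RamState) : Prop :=
  s.time = 0 ∧ s.cur = [] ∧ s.out = []

/-- Binary operations; `sub` is truncated at `0`, comparisons return `1` or `0`. -/
inductive BinOp where
  | add | sub | mul | lt | eq

def BinOp.eval : BinOp → ℕ → ℕ → ℕ
  | .add, a, b => a + b
  | .sub, a, b => a - b
  | .mul, a, b => a * b
  | .lt, a, b => if a < b then 1 else 0
  | .eq, a, b => if a = b then 1 else 0

inductive RamExpr where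
  | const (c : ℕ)
  | reg (x : RegName)
  | get (A : ArrName) (idx : RamExpr)
  | bin (op : BinOp) (e₁ e₂ : RamExpr)

namespace RamExpr

def eval (s : RamState) : RamExpr → ℕ
  | const c => c
  | reg x => s.reg x
  | get A idx => s.arr A (idx.eval s)
  | bin op e₁ e₂ => op.eval (e₁.eval s) (e₂.eval s)

/-- The number of operations that the evaluation takes. -/
def cost : RamExpr → ℕ
  | const _ => 1
  | reg _ => 1
  | get _ idx => idx.cost + 1
  | bin _ e₁ e₂ => e₁.cost + e₂.cost + 1

/-- All values that occur during the evaluation are at most `B`. -/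
def Fits (B : ℕ) (s : RamState) : RamExpr → Prop
  | const c => c ≤ B
  | reg x => s.reg x ≤ B
  | get A idx => idx.Fits B s ∧ s.arr A (idx.eval s) ≤ B
  | bin op e₁ e₂ => e₁.Fits B s ∧ e₂.Fits B s ∧ op.eval (e₁.eval s) (e₂.eval s) ≤ B

end RamExpr

inductive RamProg where
  | skip
  | assign (x : RegName) (e : RamExpr)
  | store (A : ArrName) (idx e : RamExpr)
  | emit (e : RamExpr)
  | endWord
  | seq (p q : RamProg)
  | ite (e : RamExpr) (p q : RamProg)
  | while (e : RamExpr) (p : RamProg)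

/-- `Exec B p s s'`: started in `s`, the program `p` halts in `s'`, and no value exceeds `B`. In each
state at most one rule applies, so `s'` is determined by `p` and `s`. -/
inductive Exec (B : ℕ) : RamProg → RamState → RamState → Prop where
  | skip (s : RamState) : Exec B .skip s { s with time := s.time + 1 }
  | assign (x : RegName) (e : RamExpr) (s : RamState) (h : e.Fits B s) :
      Exec B (.assign x e) s
        { s with reg := Function.update s.reg x (e.eval s), time := s.time + e.cost + 1 }
  | store (A : ArrName) (idx e : RamExpr) (s : RamState) (hi : idx.Fits B s) (h : e.Fits B s) :
      Exec B (.store A idx e) s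
        { s with
          arr := Function.update s.arr A (Function.update (s.arr A) (idx.eval s) (e.eval s))
          time := s.time + idx.cost + e.cost + 1 }
  | emit (e : RamExpr) (s : RamState) (h : e.Fits B s) :
      Exec B (.emit e) s
        { s with cur := s.cur ++ [e.eval s], time := s.time + e.cost + 1 }
  | endWord (s : RamState) :
      Exec B .endWord s
        { s with cur := [], out := s.out ++ [(s.cur, s.time + 1)], time := s.time + 1 }
  | seq (p q : RamProg) (s s₁ s₂ : RamState) (hp : Exec B p s s₁) (hq : Exec B q s₁ s₂) :
      Exec B (.seq p q) s s₂
  | ite_true (e : RamExpr) (p q : RamProg) (s s' : RamState) (h : e.Fits B s)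
      (he : e.eval s ≠ 0) (hp : Exec B p { s with time := s.time + e.cost + 1 } s') :
      Exec B (.ite e p q) s s'
  | ite_false (e : RamExpr) (p q : RamProg) (s s' : RamState) (h : e.Fits B s)
      (he : e.eval s = 0) (hq : Exec B q { s with time := s.time + e.cost + 1 } s') :
      Exec B (.ite e p q) s s'
  | while_true (e : RamExpr) (p : RamProg) (s s₁ s₂ : RamState) (h : e.Fits B s)
      (he : e.eval s ≠ 0) (hp : Exec B p { s with time := s.time + e.cost + 1 } s₁)
      (hw : Exec B (.while e p) s₁ s₂) :
      Exec B (.while e p) s s₂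
  | while_false (e : RamExpr) (p : RamProg) (s : RamState) (h : e.Fits B s)
      (he : e.eval s = 0) :
      Exec B (.while e p) s { s with time := s.time + e.cost + 1 }

/-! ### Representation in memory -/

/-- The memory holds `w`, its length and the size `σ` of the alphabet. -/
structure HoldsInput (σ : ℕ) (w : List ℕ) (s : RamState) : Prop where
  n : s.reg .n = w.length
  sigma : s.reg .sigma = σ
  word : ∀ i, 1 ≤ i → i ≤ w.length → s.arr .word i = letterAt w i

/-- Row-major address of entry `[ℓ][t]`, `1 ≤ ℓ`, `1 ≤ t ≤ σ`, of an array with rows of length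
`σ`. -/
def cell (σ ℓ t : ℕ) : ℕ := (ℓ - 1) * σ + t

/-- The memory holds `w`, the number of arches, the ends of the arches, the arrays `firstPosArch`,
`lastPosArch`, `sortedLast` (with the lengths of its rows), `Leq`, `Lex`, the list `startSAS` and the
position `init`. Every position `i` in an arch lies in exactly one arch `ℓ`, and the value
`Leq[ℓ][i]` is stored at address `i`, with `-∞` encoded as `0`. -/
structure HoldsData (σ : ℕ) (w : List ℕ) (F : ArchFactorization w) (s : RamState) : Prop
    extends HoldsInput σ w s where
  k : s.reg .k = F.k
  archEnd : ∀ ℓ, ℓ ≤ F.k → s.arr .archEnd ℓ = F.archEnd ℓ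
  firstPosArch : ∀ ℓ a, 1 ≤ ℓ → ℓ ≤ F.k → 1 ≤ a → a ≤ σ →
    s.arr .firstPosArch (cell σ ℓ a) = F.firstPosArch ℓ a
  lastPosArch : ∀ ℓ a, 1 ≤ ℓ → ℓ ≤ F.k → 1 ≤ a → a ≤ σ →
    s.arr .lastPosArch (cell σ ℓ a) = F.lastPosArch ℓ a
  sortedLen : ∀ ℓ, 1 ≤ ℓ → ℓ ≤ F.k → s.arr .sortedLen ℓ = (F.sortedLast ℓ).length
  sortedLast : ∀ ℓ t, 1 ≤ ℓ → ℓ ≤ F.k → 1 ≤ t → t ≤ (F.sortedLast ℓ).length →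
    s.arr .sortedLast (cell σ ℓ t) = letterAt (F.sortedLast ℓ) t
  leq : ∀ ℓ i, 1 ≤ ℓ → ℓ ≤ F.k → F.InArch ℓ i → s.arr .leq i = (F.leqArr ℓ i).unbotD 0
  lex : ∀ ℓ t, 1 ≤ ℓ → ℓ ≤ F.k → 1 ≤ t → t ≤ (F.sortedLast ℓ).length →
    s.arr .lex (cell σ ℓ t) = F.lexArr ℓ t
  startLen : s.reg .startLen = F.startSAS.length
  startSAS : ∀ j, 1 ≤ j → j ≤ F.startSAS.length →
    s.arr .startSAS j = letterAt F.startSAS j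
  init : s.reg .init = F.init

/-- The array `query` holds the word `u`. -/
def HoldsQuery (u : List ℕ) (s : RamState) : Prop :=
  ∀ i, 1 ≤ i → i ≤ u.length → s.arr .query i = letterAt u i

/-- In a run from time `0` to the final state `s`, at most `D` steps pass before the first output
word is finished, between two consecutive ones, and after the last one. -/
def DelayAtMost (D : ℕ) (s : RamState) : Prop :=
  List.IsChain (fun t t' => t' ≤ t + D) (0 :: s.out.map Prod.snd ++ [s.time])

/-! Every word of length at most `k` embeds in `w` by spending one arch per letter, while the last
letters of the arches, followed by a letter missing from the rest, form an absent word of length `k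
+ 1`. Hence the SAS are exactly the absent words of length `k + 1` (`isSAS_iff`).

For such a word the greedy embedding is rigid. Suppose that its first `ℓ` letters have been matched,
the last of them at a position `p` of arch `ℓ`. If the next letter `a` occurred again in arch `ℓ`
after `p`, the remaining `k - ℓ` letters would find room in the later arches. So absence forces
`lastPosArch[ℓ][a] ≤ p`, and the next match is at `firstPosArch[ℓ+1][a]` (`absentAfter_cons_iff`).
The filter in `L'_ℓ` removes exactly the letters with no absent completion. Therefore the possible
next letters at `p` are those carried by the elements of `L'_ℓ` up to `p`, and each of them can be
completed (`absentAfter_iff_exists`, `hasAbsentAfter_iff`, `lastSet_next_spec`). The SAS are thus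
the root-to-leaf paths of a tree with all leaves at depth `k + 1` and no dead ends. The children of
a node at `p` are a prefix of `sortedLast[ℓ]`, of length `Leq[ℓ][p]` when `-∞` is read as `0`
(`leqArr_unbotD`).

The algorithms follow this tree. The check traces one path. For the smallest SAS the smallest next
letter is always a safe choice, and `Lex` supplies it (`lexAfter_spec`). The enumeration is a
depth-first search with an explicit stack: siblings carry distinct letters, so no word is repeated,
and between consecutive leaves the search climbs and descends at most `k` levels each
(`enumLevel_zero`). The preprocessing never computes `dist`: a letter is filtered out of row `ℓ < k`
exactly when `Leq[ℓ+1]` is `-∞` at its first position in arch `ℓ + 1`, so the rows are filled from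
the last arch to the first, each by one scan of its arch (`rowTest_runs`).

The programs are verified by weakest-precondition rules for `Runs`. Row-major addresses fit into a
word because each arch has at least `σ` positions, whence `k * σ ≤ n` (`mul_le_length`). -/

/-! ### Positions, and subsequences of suffixes -/

theorem letterAt_eq_getElem {w : List ℕ} {i : ℕ} (h : i < w.length) :
    letterAt w (i + 1) = w[i] := by
  simp [letterAt, h]

theorem mem_iff_exists_letterAt {w : List ℕ} {a : ℕ} :
    a ∈ w ↔ ∃ i, 1 ≤ i ∧ i ≤ w.length ∧ letterAt w i = a := by
  rw [List.mem_iff_getElem]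
  constructor
  · rintro ⟨i, hi, rfl⟩
    exact ⟨i + 1, by omega, by omega, letterAt_eq_getElem hi⟩
  · rintro ⟨i, h1, h2, rfl⟩
    obtain ⟨i, rfl⟩ : ∃ j, i = j + 1 := ⟨i - 1, by omega⟩
    exact ⟨i, by omega, (letterAt_eq_getElem (by omega)).symm⟩

theorem letterAt_mem {w : List ℕ} {i : ℕ} (h1 : 1 ≤ i) (h2 : i ≤ w.length) :
    letterAt w i ∈ w :=
  mem_iff_exists_letterAt.2 ⟨i, h1, h2, rfl⟩

/-- The existential ranges over all matches of the first letter, not only the leftmost. The greedy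
choice is made by its users, which replace `i` by the smallest possible position. -/
theorem cons_sublist_drop_iff {w v : List ℕ} {a p : ℕ} :
    (a :: v).Sublist (w.drop p) ↔
      ∃ i, p < i ∧ i ≤ w.length ∧ letterAt w i = a ∧ v.Sublist (w.drop i) := by
  induction hm : w.length - p generalizing p with
  | zero =>
    rw [List.drop_eq_nil_of_le (by omega)]
    simp only [List.sublist_nil, reduceCtorEq, false_iff]
    rintro ⟨i, h1, h2, -⟩
    omega
  | succ m ih =>
    have hp : p < w.length := by omega
    rw [List.drop_eq_getElem_cons hp, List.sublist_cons_iff, ih (by omega)]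
    constructor
    · rintro (⟨i, h1, h2, h3, h4⟩ | ⟨r, hr, hs⟩)
      · exact ⟨i, by omega, h2, h3, h4⟩
      · obtain ⟨rfl, rfl⟩ := List.cons.inj hr
        exact ⟨p + 1, by omega, by omega, letterAt_eq_getElem hp, hs⟩
    · rintro ⟨i, h1, h2, h3, h4⟩
      rcases Nat.eq_or_lt_of_le h1 with h | h
      · obtain rfl : i = p + 1 := h.symm
        exact Or.inr ⟨v, by rw [← h3, letterAt_eq_getElem hp], h4⟩
      · exact Or.inl ⟨i, h, h2, h3, h4⟩

theorem mem_drop_iff {w : List ℕ} {a p : ℕ} :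
    a ∈ w.drop p ↔ ∃ i, p < i ∧ i ≤ w.length ∧ letterAt w i = a := by
  rw [← List.singleton_sublist, cons_sublist_drop_iff]
  simp

/-- `v` is a word over `alph(w)` that is not a subsequence of the part of `w` after position `p`. -/
def AbsentAfter (w : List ℕ) (p : ℕ) (v : List ℕ) : Prop :=
  (∀ a ∈ v, a ∈ w) ∧ ¬ v.Sublist (w.drop p)

theorem absentAfter_zero {w v : List ℕ} : AbsentAfter w 0 v ↔ IsAbsent w v := by
  simp [AbsentAfter, IsAbsent]

/-! ### Positions in arches, and embedding one letter per arch -/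

namespace ArchFactorization

variable {w : List ℕ} (F : ArchFactorization w)

theorem archEnd_zero : F.archEnd 0 = 0 := by simp [archEnd]

theorem archEnd_succ {ℓ : ℕ} (h : ℓ < F.arches.length) :
    F.archEnd (ℓ + 1) = F.archEnd ℓ + F.arches[ℓ].length := by
  rw [archEnd, archEnd, List.take_succ_eq_append_getElem h, List.flatten_append,
    List.length_append, List.flatten_singleton]

theorem append_eq_word {ℓ : ℕ} (h : ℓ < F.arches.length) :
    w = (F.arches.take ℓ).flatten ++ (F.arches[ℓ] ++
      ((F.arches.drop (ℓ + 1)).flatten ++ F.rest)) := by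
  have := F.eq_append
  rw [← List.take_append_drop ℓ F.arches, List.drop_eq_getElem_cons h, List.flatten_append,
    List.flatten_cons] at this
  simpa using this.symm

theorem archEnd_le_length (ℓ : ℕ) : F.archEnd ℓ ≤ w.length := by
  have := congrArg List.length F.eq_append
  rw [← List.take_append_drop ℓ F.arches, List.flatten_append, List.length_append,
    List.length_append] at this
  unfold archEnd
  omega

theorem letterAt_archEnd_add {ℓ j : ℕ} (h : ℓ < F.arches.length)
    (hj : j < F.arches[ℓ].length) :
    letterAt w (F.archEnd ℓ + j + 1) = F.arches[ℓ][j] := by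
  have hl := F.archEnd_le_length (ℓ + 1)
  rw [F.archEnd_succ h] at hl
  rw [letterAt_eq_getElem (by omega)]
  have := F.append_eq_word h
  have h2 : w[F.archEnd ℓ + j]? = some F.arches[ℓ][j] := by
    have h3 : (F.arches.take ℓ).flatten.length = F.archEnd ℓ := rfl
    generalize F.archEnd ℓ = e at *
    rw [congrArg (·[e + j]?) this]
    rw [List.getElem?_append_right (by omega), h3, Nat.add_sub_cancel_left, List.getElem?_append_left hj, List.getElem?_eq_getElem hj]
  rw [List.getElem?_eq_getElem (by omega)] at h2
  exact Option.some.inj h2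

theorem exists_inArch {ℓ a : ℕ} (h : ℓ < F.k) (ha : a ∈ w) :
    ∃ j, F.archEnd ℓ < j ∧ j ≤ F.archEnd (ℓ + 1) ∧ letterAt w j = a := by
  have h' : ℓ < F.arches.length := h
  have := F.arch_universal _ (List.getElem_mem h') a ha
  obtain ⟨j, hj, rfl⟩ := List.mem_iff_getElem.1 this
  refine ⟨F.archEnd ℓ + j + 1, by omega, ?_, F.letterAt_archEnd_add h' hj⟩
  rw [F.archEnd_succ h']
  omega

theorem archEnd_lt_succ {ℓ : ℕ} (h : ℓ < F.k) : F.archEnd ℓ < F.archEnd (ℓ + 1) := by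
  obtain ⟨a, ha, -⟩ := F.rest_missing
  obtain ⟨j, h1, h2, -⟩ := F.exists_inArch h ha
  omega

theorem archEnd_mono {ℓ m : ℕ} (h : ℓ ≤ m) : F.archEnd ℓ ≤ F.archEnd m := by
  obtain ⟨d, rfl⟩ := Nat.exists_eq_add_of_le h
  simp [archEnd, List.take_add]

/-- This is the minimality of an arch: searching for its last letter from the start of the arch uses
up the whole arch. -/
theorem letterAt_ne_letterAt_archEnd {ℓ j : ℕ} (h : ℓ < F.k) (h1 : F.archEnd ℓ < j)
    (h2 : j < F.archEnd (ℓ + 1)) : letterAt w j ≠ letterAt w (F.archEnd (ℓ + 1)) := by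
  have h' : ℓ < F.arches.length := h
  obtain ⟨y, a, hx, hy⟩ := F.arch_last _ (List.getElem_mem h')
  have hl : F.arches[ℓ].length = y.length + 1 := by simp [hx]
  have he := F.archEnd_succ h'
  have e1 := F.letterAt_archEnd_add (j := y.length) h' (by omega)
  have e2 := F.letterAt_archEnd_add (j := j - F.archEnd ℓ - 1) h' (by omega)
  rw [show F.archEnd ℓ + (j - F.archEnd ℓ - 1) + 1 = j by omega] at e2
  rw [show F.archEnd ℓ + y.length + 1 = F.archEnd (ℓ + 1) by omega] at e1
  rw [e1, e2]
  simp only [hx, List.getElem_append_right (le_refl _), Nat.sub_self, List.getElem_singleton]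
  rw [List.getElem_append_left (by omega)]
  intro hc
  exact hy (hc ▸ List.getElem_mem _)

theorem drop_archEnd_k : w.drop (F.archEnd F.k) = F.rest := by
  have : F.archEnd F.k = F.arches.flatten.length := by simp [archEnd, k]
  rw [this, ← congrArg (List.drop F.arches.flatten.length) F.eq_append, List.drop_left]

theorem mem_rest_iff {a : ℕ} :
    a ∈ F.rest ↔ ∃ i, F.archEnd F.k < i ∧ i ≤ w.length ∧ letterAt w i = a := by
  rw [← F.drop_archEnd_k, mem_drop_iff]

theorem rest_subset {a : ℕ} (h : a ∈ F.rest) : a ∈ w := by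
  obtain ⟨i, h1, h2, rfl⟩ := F.mem_rest_iff.1 h
  exact letterAt_mem (by omega) h2

/-- Without arches the rest would be `w` itself, which misses none of its letters. -/
theorem k_pos : 1 ≤ F.k := by
  obtain ⟨a, ha, hr⟩ := F.rest_missing
  by_contra h
  have : F.k = 0 := by omega
  have h2 := F.drop_archEnd_k
  rw [this, archEnd_zero, List.drop_zero] at h2
  exact hr (h2 ▸ ha)

/-- The reason why a left-to-right scan finds the arches: an arch ends at the moment when all
letters have been seen since the previous end. After the last arch this never happens, by
`rest_missing`. -/
theorem forall_letter_iff {ℓ i : ℕ} (hℓ : ℓ ≤ F.k) (hi : i ≤ w.length) :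
    (∀ a ∈ w, ∃ j, F.archEnd ℓ < j ∧ j ≤ i ∧ letterAt w j = a) ↔
      ℓ < F.k ∧ F.archEnd (ℓ + 1) ≤ i := by
  constructor
  · intro h
    have hk : ℓ < F.k := by
      by_contra hc
      obtain rfl : ℓ = F.k := by omega
      obtain ⟨a, ha, hr⟩ := F.rest_missing
      obtain ⟨j, h1, h2, h3⟩ := h a ha
      exact hr (F.mem_rest_iff.2 ⟨j, h1, by omega, h3⟩)
    refine ⟨hk, ?_⟩
    have hlt := F.archEnd_lt_succ hk
    obtain ⟨j, h1, h2, h3⟩ := h (letterAt w (F.archEnd (ℓ + 1)))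
      (letterAt_mem (by omega) (F.archEnd_le_length _))
    by_contra hc
    exact F.letterAt_ne_letterAt_archEnd hk h1 (by omega) h3
  · rintro ⟨hk, h⟩ a ha
    obtain ⟨j, h1, h2, h3⟩ := F.exists_inArch hk ha
    exact ⟨j, h1, by omega, h3⟩

theorem InArch.pos {ℓ i : ℕ} {F : ArchFactorization w} (h : F.InArch ℓ i) : 1 ≤ i := by
  have := h.1
  omega

theorem InArch.le_length {ℓ i : ℕ} {F : ArchFactorization w} (h : F.InArch ℓ i) :
    i ≤ w.length :=
  h.2.trans (F.archEnd_le_length ℓ)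

section positions

variable {F} {ℓ a : ℕ}

theorem isLeast_firstPosArch (h1 : 1 ≤ ℓ) (hk : ℓ ≤ F.k) (ha : a ∈ w) :
    IsLeast {i | F.InArch ℓ i ∧ letterAt w i = a} (F.firstPosArch ℓ a) := by
  have hne : {i | F.InArch ℓ i ∧ letterAt w i = a}.Nonempty := by
    obtain ⟨m, rfl⟩ : ∃ m, ℓ = m + 1 := ⟨ℓ - 1, by omega⟩
    obtain ⟨j, h1, h2, h3⟩ := F.exists_inArch (ℓ := m) (by omega) ha
    exact ⟨j, ⟨h1, h2⟩, h3⟩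
  exact ⟨Nat.sInf_mem hne, fun i hi => Nat.sInf_le hi⟩

theorem isGreatest_lastPosArch (h1 : 1 ≤ ℓ) (hk : ℓ ≤ F.k) (ha : a ∈ w) :
    IsGreatest {i | F.InArch ℓ i ∧ letterAt w i = a} (F.lastPosArch ℓ a) := by
  have hne := (isLeast_firstPosArch h1 hk ha).nonempty
  have hb : BddAbove {i | F.InArch ℓ i ∧ letterAt w i = a} := ⟨_, fun i hi => hi.1.2⟩
  exact ⟨Nat.sSup_mem hne hb, fun i hi => le_csSup hb hi⟩

theorem inArch_firstPosArch (h1 : 1 ≤ ℓ) (hk : ℓ ≤ F.k) (ha : a ∈ w) :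
    F.InArch ℓ (F.firstPosArch ℓ a) := (isLeast_firstPosArch h1 hk ha).1.1

theorem letterAt_firstPosArch (h1 : 1 ≤ ℓ) (hk : ℓ ≤ F.k) (ha : a ∈ w) :
    letterAt w (F.firstPosArch ℓ a) = a := (isLeast_firstPosArch h1 hk ha).1.2

theorem inArch_lastPosArch (h1 : 1 ≤ ℓ) (hk : ℓ ≤ F.k) (ha : a ∈ w) :
    F.InArch ℓ (F.lastPosArch ℓ a) := (isGreatest_lastPosArch h1 hk ha).1.1

theorem letterAt_lastPosArch (h1 : 1 ≤ ℓ) (hk : ℓ ≤ F.k) (ha : a ∈ w) :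
    letterAt w (F.lastPosArch ℓ a) = a := (isGreatest_lastPosArch h1 hk ha).1.2

theorem firstPosArch_le_length (h1 : 1 ≤ ℓ) (hk : ℓ ≤ F.k) (ha : a ∈ w) :
    F.firstPosArch ℓ a ≤ w.length := (inArch_firstPosArch h1 hk ha).le_length

theorem lastPosArch_le_length (h1 : 1 ≤ ℓ) (hk : ℓ ≤ F.k) (ha : a ∈ w) :
    F.lastPosArch ℓ a ≤ w.length := (inArch_lastPosArch h1 hk ha).le_length

end positions

/-- Each letter is matched inside an arch of its own, and `v` has at most as many letters as there
are arches left. -/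
theorem sublist_drop_archEnd {ℓ : ℕ} {v : List ℕ} (hℓ : ℓ ≤ F.k) (hv : ∀ a ∈ v, a ∈ w)
    (hl : v.length + ℓ ≤ F.k) : v.Sublist (w.drop (F.archEnd ℓ)) := by
  induction v generalizing ℓ with
  | nil => exact List.nil_sublist _
  | cons a v ih =>
    simp only [List.length_cons] at hl
    obtain ⟨j, h1, h2, h3⟩ := F.exists_inArch (ℓ := ℓ) (by omega) (hv a (by simp))
    refine cons_sublist_drop_iff.2 ⟨j, h1, h2.trans (F.archEnd_le_length _), h3, ?_⟩
    exact (ih (ℓ := ℓ + 1) (by omega) (fun b hb => hv b (by simp [hb])) (by omega)).trans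
      (List.drop_sublist_drop_left w h2)

theorem sublist_drop_of_inArch {ℓ p : ℕ} {v : List ℕ} (hℓ : ℓ ≤ F.k) (hp : p ≤ F.archEnd ℓ)
    (hv : ∀ a ∈ v, a ∈ w) (hl : v.length + ℓ ≤ F.k) : v.Sublist (w.drop p) :=
  (F.sublist_drop_archEnd hℓ hv hl).trans (List.drop_sublist_drop_left w hp)

/-! ### Absent words of critical length: the greedy recursion -/

variable {F}

/-- An occurrence of `a` in arch `ℓ` after `p` would leave the `k - ℓ` arches behind it for the `k -
ℓ` letters of `v`, which then embed. This is where the exact length of `v` is needed. Once such an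
occurrence is excluded, the earliest match of `a` is its first position in the next arch, and an
earliest match is the best one. -/
theorem absentAfter_cons_iff {ℓ p a : ℕ} {v : List ℕ} (h1 : 1 ≤ ℓ) (hk : ℓ < F.k)
    (hp : F.InArch ℓ p) (hv : v.length + ℓ = F.k) :
    AbsentAfter w p (a :: v) ↔
      a ∈ w ∧ F.lastPosArch ℓ a ≤ p ∧ AbsentAfter w (F.firstPosArch (ℓ + 1) a) v := by
  by_cases ha : a ∈ w
  swap
  · simp [AbsentAfter, ha]
  by_cases hvw : ∀ b ∈ v, b ∈ w
  swap
  · constructor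
    · exact fun h => absurd (fun b hb => h.1 b (by simp [hb])) hvw
    · exact fun h => absurd h.2.2.1 hvw
  have hL := isGreatest_lastPosArch h1 hk.le ha
  have hF := isLeast_firstPosArch (F := F) (ℓ := ℓ + 1) (by omega) (by omega) ha
  have hc : ∀ b ∈ a :: v, b ∈ w := by simpa [ha] using hvw
  rw [AbsentAfter, and_iff_right hc, AbsentAfter, and_iff_right hvw, and_iff_right ha,
    cons_sublist_drop_iff]
  constructor
  · intro h
    constructor
    · by_contra hlt
      exact h ⟨_, not_le.1 hlt, hL.1.1.le_length, hL.1.2,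
        F.sublist_drop_of_inArch hk.le hL.1.1.2 hvw (by omega)⟩
    · intro hs
      have h3 : F.archEnd ℓ < F.firstPosArch (ℓ + 1) a := hF.1.1.1
      have h4 := hp.2
      exact h ⟨_, by omega, hF.1.1.le_length, hF.1.2, hs⟩
  -- Conversely, every match of `a` after `p` lies beyond arch `ℓ`, hence not before its first
  -- position in arch `ℓ + 1`.
  · rintro ⟨hl, hs⟩ ⟨i, hi, hin, hia, hsi⟩
    have h1 : F.archEnd ℓ < i := by
      by_contra hc
      have := hL.2 ⟨⟨by have := hp.1; omega, by omega⟩, hia⟩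
      omega
    have h2 : F.firstPosArch (ℓ + 1) a ≤ i := by
      by_contra hc
      have h5 := hF.1.1.2
      have := hF.2 ⟨⟨h1, by omega⟩, hia⟩
      omega
    exact hs (hsi.trans (List.drop_sublist_drop_left w h2))

/-- The end of the recursion: behind the last arch there is only the rest, so one letter is absent
after `p` when both the remainder of the arch and the rest avoid it. -/
theorem absentAfter_singleton_iff {p a : ℕ} (hp : F.InArch F.k p) :
    AbsentAfter w p [a] ↔ a ∈ w ∧ F.lastPosArch F.k a ≤ p ∧ a ∉ F.rest := by
  by_cases ha : a ∈ w
  swap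
  · simp [AbsentAfter, ha]
  have hL := isGreatest_lastPosArch F.k_pos le_rfl ha
  simp only [AbsentAfter, ha, true_and, List.mem_singleton, forall_eq, List.singleton_sublist,
    mem_drop_iff, mem_rest_iff]
  constructor
  · intro h
    constructor
    · by_contra hc
      exact h ⟨_, not_le.1 hc, hL.1.1.le_length, hL.1.2⟩
    · rintro ⟨i, h1, h2⟩
      exact h ⟨i, hp.2.trans_lt h1, h2⟩
  · rintro ⟨h1, h2⟩ ⟨i, h3, h4, h5⟩
    refine h2 ⟨i, ?_, h4, h5⟩
    by_contra hc
    have := hL.2 ⟨⟨by have := hp.1; omega, by omega⟩, h5⟩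
    omega

/-- The leftmost occurrence of `a` lies in the first arch, and matching there leaves the longest
suffix for `v`. -/
theorem isAbsent_cons_iff {a : ℕ} {v : List ℕ} :
    IsAbsent w (a :: v) ↔ a ∈ w ∧ AbsentAfter w (F.firstPosArch 1 a) v := by
  by_cases ha : a ∈ w
  swap
  · simp [IsAbsent, ha]
  have hF := isLeast_firstPosArch le_rfl F.k_pos ha
  rw [← absentAfter_zero]
  simp only [AbsentAfter, cons_sublist_drop_iff, List.forall_mem_cons, ha, true_and]
  refine and_congr_right fun hv => not_congr ?_
  constructor
  · rintro ⟨i, h1, h2, h3, h4⟩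
    refine h4.trans (List.drop_sublist_drop_left w ?_)
    by_contra hc
    have := hF.2 ⟨⟨by simpa [archEnd_zero] using h1, by have := hF.1.1.2; omega⟩, h3⟩
    omega
  · intro h
    exact ⟨_, hF.1.1.pos, hF.1.1.le_length, hF.1.2, h⟩

/-- The word consists of the last letters of the remaining arches and a letter missing from the
rest: each last letter pushes an embedding to the end of its arch. -/
theorem exists_absentAfter_archEnd {ℓ : ℕ} (hℓ : ℓ ≤ F.k) :
    ∃ v, v.length + ℓ = F.k + 1 ∧ AbsentAfter w (F.archEnd ℓ) v := by
  induction hd : F.k - ℓ generalizing ℓ with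
  | zero =>
    obtain rfl : ℓ = F.k := by omega
    obtain ⟨a, ha, hr⟩ := F.rest_missing
    exact ⟨[a], by simp; omega, by simpa [AbsentAfter, F.drop_archEnd_k, ha] using hr⟩
  | succ d ih =>
    have hk : ℓ < F.k := by omega
    obtain ⟨v, hv, hvw, hvs⟩ := ih (ℓ := ℓ + 1) (by omega) (by omega)
    have hlt := F.archEnd_lt_succ hk
    refine ⟨letterAt w (F.archEnd (ℓ + 1)) :: v, by simp; omega, ?_, ?_⟩
    · simpa using ⟨letterAt_mem (by omega) (F.archEnd_le_length _), hvw⟩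
    · rw [cons_sublist_drop_iff]
      rintro ⟨i, h1, h2, h3, h4⟩
      refine hvs (h4.trans (List.drop_sublist_drop_left w ?_))
      by_contra hc
      exact F.letterAt_ne_letterAt_archEnd hk h1 (by omega) h3

theorem isSAS_iff {u : List ℕ} : IsSAS w u ↔ u.length = F.k + 1 ∧ IsAbsent w u := by
  have hmin : ∀ v, IsAbsent w v → F.k + 1 ≤ v.length := by
    intro v hv
    by_contra hc
    have := F.sublist_drop_archEnd (Nat.zero_le _) hv.1 (by omega)
    rw [archEnd_zero, List.drop_zero] at this
    exact hv.2 this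
  obtain ⟨v, hl, hv⟩ := exists_absentAfter_archEnd (F := F) (Nat.zero_le _)
  rw [archEnd_zero, absentAfter_zero] at hv
  constructor
  · rintro ⟨h1, h2⟩
    have := h2 v hv
    have := hmin u h1
    exact ⟨by omega, h1⟩
  · rintro ⟨h1, h2⟩
    exact ⟨h2, fun v' hv' => h1 ▸ hmin v' hv'⟩

/-! ### `dist`, the filter and the sets `L'_ℓ` -/

/-- Some word of length `m` over `alph(w)` is absent after position `p`. -/
def _root_.HasAbsentAfter (w : List ℕ) (p m : ℕ) : Prop :=
  ∃ v : List ℕ, v.length = m ∧ AbsentAfter w p v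

/-- Since `dist` counts the letter `w[p]` itself, it is one more than the least length of a word
absent after `p`, and that length is at least `k - ℓ + 1` by embedding one letter per arch. Only
whether this minimum is attained matters later. -/
theorem distArr_eq_iff {ℓ p : ℕ} (hk : ℓ ≤ F.k) (hp : F.InArch ℓ p) :
    F.k - ℓ + 2 ≤ distArr w p ∧
      (distArr w p = F.k - ℓ + 2 ↔ HasAbsentAfter w p (F.k - ℓ + 1)) := by
  have hp1 := hp.pos
  have hpn := hp.le_length
  have hd : w.drop (p - 1) = letterAt w p :: w.drop p := by
    obtain ⟨q, rfl⟩ : ∃ q, p = q + 1 := ⟨p - 1, by omega⟩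
    rw [letterAt_eq_getElem (by omega), Nat.add_sub_cancel, List.drop_eq_getElem_cons (by omega)]
  have hmem := letterAt_mem hp1 hpn
  have hset : {m | ∃ u : List ℕ, u.length = m ∧ u.head? = some (letterAt w p) ∧
      (∀ a ∈ u, a ∈ w) ∧ ¬ u.Sublist (w.drop (p - 1))} =
      {m | ∃ v, v.length + 1 = m ∧ AbsentAfter w p v} := by
    ext m
    constructor
    · rintro ⟨u, rfl, h2, h3, h4⟩
      cases u with
      | nil => simp at h2
      | cons b v =>
        obtain rfl : b = letterAt w p := by simpa using h2
        rw [hd, List.cons_sublist_cons] at h4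
        exact ⟨v, by simp, fun a ha => h3 a (by simp [ha]), h4⟩
    · rintro ⟨v, rfl, h1, h2⟩
      refine ⟨letterAt w p :: v, by simp, by simp, by simpa [hmem] using h1, ?_⟩
      rwa [hd, List.cons_sublist_cons]
  have hne : {m | ∃ v, v.length + 1 = m ∧ AbsentAfter w p v}.Nonempty := by
    -- Nonemptiness is needed because `sInf ∅ = 0`; any word longer than `w` is a witness.
    refine ⟨_, List.replicate (w.length + 1) (letterAt w p), rfl, ?_, ?_⟩
    · intro a ha
      rw [List.eq_of_mem_replicate ha]
      exact hmem
    · intro h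
      have := h.length_le
      simp at this
      omega
  have hge : ∀ m ∈ {m | ∃ v, v.length + 1 = m ∧ AbsentAfter w p v}, F.k - ℓ + 2 ≤ m := by
    rintro m ⟨v, rfl, h1, h2⟩
    by_contra hc
    exact h2 (F.sublist_drop_of_inArch hk hp.2 h1 (by omega))
  unfold distArr
  rw [hset]
  refine ⟨hge _ (Nat.sInf_mem hne), ?_, ?_⟩
  · intro h
    obtain ⟨v, h1, h2⟩ := Nat.sInf_mem hne
    exact ⟨v, by omega, h2⟩
  · rintro ⟨v, h1, h2⟩
    refine le_antisymm (Nat.sInf_le ⟨v, by omega, h2⟩) (hge _ (Nat.sInf_mem hne))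

/-- From here on `dist` is replaced by the existence of an absent completion: the filter discards
the letters that lead into a dead end. -/
theorem mem_filteredLetters_iff {ℓ a : ℕ} (ha : a ∈ w) :
    a ∈ F.filteredLetters ℓ ↔
      if ℓ < F.k then ¬ HasAbsentAfter w (F.firstPosArch (ℓ + 1) a) (F.k - ℓ)
      else a ∈ F.rest := by
  unfold filteredLetters
  split_ifs with h
  · have := distArr_eq_iff (F := F) (ℓ := ℓ + 1) (by omega)
      (inArch_firstPosArch (by omega) (by omega) ha)
    rw [show F.k - (ℓ + 1) + 1 = F.k - ℓ by omega,
      show F.k - (ℓ + 1) + 2 = F.k - ℓ + 1 by omega] at this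
    rw [← this.2]
    simp only [Finset.mem_filter, List.mem_toFinset, ha, true_and]
    omega
  · simp

/-- The set difference is taken between sets of positions. Since a last position determines its
letter, it amounts to a difference between sets of letters. -/
theorem mem_lastSet_iff {ℓ j : ℕ} (h1 : 1 ≤ ℓ) (hk : ℓ ≤ F.k) :
    j ∈ F.lastSet ℓ ↔ ∃ a ∈ w, a ∉ F.filteredLetters ℓ ∧ F.lastPosArch ℓ a = j := by
  have hsub : ∀ a ∈ F.filteredLetters ℓ, a ∈ w := by
    intro a ha
    unfold filteredLetters at ha
    split_ifs at ha
    · exact List.mem_toFinset.1 (Finset.mem_filter.1 ha).1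
    · exact F.rest_subset (List.mem_toFinset.1 ha)
  simp only [lastSet, Finset.mem_sdiff, Finset.mem_image, List.mem_toFinset]
  constructor
  · rintro ⟨⟨a, ha, rfl⟩, h⟩
    exact ⟨a, ha, fun hc => h ⟨a, hc, rfl⟩, rfl⟩
  · rintro ⟨a, ha, hf, rfl⟩
    refine ⟨⟨a, ha, rfl⟩, ?_⟩
    rintro ⟨b, hb, he⟩
    have e1 := letterAt_lastPosArch h1 hk ha
    have e2 := letterAt_lastPosArch h1 hk (hsub b hb)
    rw [he, e1] at e2
    exact hf (e2 ▸ hb)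

theorem inArch_of_mem_lastSet {ℓ j : ℕ} (h1 : 1 ≤ ℓ) (hk : ℓ ≤ F.k) (hj : j ∈ F.lastSet ℓ) :
    F.InArch ℓ j := by
  obtain ⟨a, ha, -, rfl⟩ := (mem_lastSet_iff h1 hk).1 hj
  exact inArch_lastPosArch h1 hk ha

theorem lastPosArch_letterAt_of_mem_lastSet {ℓ j : ℕ} (h1 : 1 ≤ ℓ) (hk : ℓ ≤ F.k)
    (hj : j ∈ F.lastSet ℓ) : F.lastPosArch ℓ (letterAt w j) = j := by
  obtain ⟨a, ha, -, rfl⟩ := (mem_lastSet_iff h1 hk).1 hj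
  rw [letterAt_lastPosArch h1 hk ha]

theorem lastPosArch_mem_lastSet_iff {ℓ a : ℕ} (h1 : 1 ≤ ℓ) (hk : ℓ ≤ F.k) (ha : a ∈ w) :
    F.lastPosArch ℓ a ∈ F.lastSet ℓ ↔ a ∉ F.filteredLetters ℓ := by
  rw [mem_lastSet_iff h1 hk]
  constructor
  · rintro ⟨b, hb, hf, he⟩
    have e1 := letterAt_lastPosArch h1 hk ha
    have e2 := letterAt_lastPosArch h1 hk hb
    rw [he, e1] at e2
    exact e2 ▸ hf
  · exact fun h => ⟨a, ha, h, rfl⟩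

/-- The condition of membership in `L'_ℓ` is free when `ℓ < k`, since `v` itself is an absent
completion. For `ℓ = k` it is the condition on the rest, so that both cases of the recursion take
one form. -/
theorem absentAfter_iff_mem_lastSet {ℓ p a : ℕ} {v : List ℕ} (h1 : 1 ≤ ℓ) (hk : ℓ ≤ F.k)
    (hp : F.InArch ℓ p) (hv : v.length + ℓ = F.k) :
    AbsentAfter w p (a :: v) ↔ a ∈ w ∧ F.lastPosArch ℓ a ∈ F.lastSet ℓ ∧ F.lastPosArch ℓ a ≤ p ∧
      (ℓ < F.k → AbsentAfter w (F.firstPosArch (ℓ + 1) a) v) := by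
  by_cases ha : a ∈ w
  swap
  · simp [AbsentAfter, ha]
  rw [lastPosArch_mem_lastSet_iff h1 hk ha, mem_filteredLetters_iff ha]
  by_cases hlt : ℓ < F.k
  · simp only [absentAfter_cons_iff h1 hlt hp hv, ha, true_and, hlt, if_true, forall_const,
      not_not]
    refine ⟨fun h => ⟨⟨v, by omega, h.2⟩, h⟩, fun h => h.2⟩
  · obtain rfl : ℓ = F.k := by omega
    obtain rfl : v = [] := List.length_eq_zero_iff.1 (by omega)
    simp [absentAfter_singleton_iff hp, ha, and_comm]

/-- There are no dead ends: an element of `L'_ℓ` carries, by the filter, a letter with an absent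
completion, and this completion does not depend on `p`. -/
theorem hasAbsentAfter_iff {ℓ p : ℕ} (h1 : 1 ≤ ℓ) (hk : ℓ ≤ F.k) (hp : F.InArch ℓ p) :
    HasAbsentAfter w p (F.k - ℓ + 1) ↔ ∃ j ∈ F.lastSet ℓ, j ≤ p := by
  constructor
  · rintro ⟨v, hl, hv⟩
    cases v with
    | nil => simp at hl
    | cons a v =>
      simp only [List.length_cons] at hl
      have := (absentAfter_iff_mem_lastSet h1 hk hp (by omega)).1 hv
      exact ⟨_, this.2.1, this.2.2.1⟩
  · rintro ⟨j, hj, hle⟩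
    obtain ⟨a, ha, hf, rfl⟩ := (mem_lastSet_iff h1 hk).1 hj
    by_cases hlt : ℓ < F.k
    · have hf' := hf
      rw [mem_filteredLetters_iff ha, if_pos hlt, not_not] at hf'
      obtain ⟨v, hl, hv⟩ := hf'
      exact ⟨a :: v, by simp [hl],
        (absentAfter_iff_mem_lastSet h1 hk hp (by omega)).2 ⟨ha, hj, hle, fun _ => hv⟩⟩
    · exact ⟨[a], by simp; omega,
        (absentAfter_iff_mem_lastSet h1 hk hp (by simp; omega)).2
          ⟨ha, hj, hle, fun h => absurd h hlt⟩⟩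

end ArchFactorization

/-! ### Prefixes of sorted lists, and `argmin` -/

theorem List.filter_le_eq_take {L : List ℕ} (hL : L.Pairwise (· < ·)) (i : ℕ) :
    L.filter (· ≤ i) = L.take (L.filter (· ≤ i)).length := by
  induction L with
  | nil => simp
  | cons a L ih =>
    rw [List.pairwise_cons] at hL
    by_cases h : a ≤ i
    · simpa [h] using ih hL.2
    · have : L.filter (· ≤ i) = [] := by
        rw [List.filter_eq_nil_iff]
        intro b hb
        have := hL.1 b hb
        simp
        omega
      simp [h, this]

theorem letterAt_le_iff_of_pairwise {L : List ℕ} (hL : L.Pairwise (· < ·)) {i t : ℕ}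
    (h1 : 1 ≤ t) (h2 : t ≤ L.length) :
    letterAt L t ≤ i ↔ t ≤ (L.filter (· ≤ i)).length := by
  obtain ⟨t, rfl⟩ : ∃ s, t = s + 1 := ⟨t - 1, by omega⟩
  rw [letterAt_eq_getElem (by omega)]
  clear h1
  induction L generalizing t with
  | nil => simp at h2
  | cons a L ih =>
    rw [List.pairwise_cons] at hL
    simp only [List.length_cons] at h2
    by_cases h : a ≤ i
    · cases t with
      | zero => simp [h]
      | succ t => simpa [h] using ih hL.2 t (by omega)
    · have : L.filter (· ≤ i) = [] := by
        rw [List.filter_eq_nil_iff]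
        intro b hb
        have := hL.1 b hb
        simp
        omega
      have h3 : a ≤ (a :: L)[t] := by
        cases t with
        | zero => simp
        | succ t => exact (hL.1 _ (List.getElem_mem _)).le
      simp only [this, h, decide_false, Bool.false_eq_true, not_false_eq_true,
        List.filter_cons_of_neg, List.length_nil]
      omega

theorem List.filter_le_succ {L : List ℕ} (hL : L.Pairwise (· < ·)) (i : ℕ) :
    L.filter (· ≤ i + 1) =
      if i + 1 ∈ L then L.filter (· ≤ i) ++ [i + 1] else L.filter (· ≤ i) := by
  induction L with
  | nil => simp
  | cons a L ih =>
    rw [List.pairwise_cons] at hL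
    have ih := ih hL.2
    rcases lt_trichotomy a (i + 1) with h | rfl | h
    · have h1 : a ≤ i := by omega
      have h2 : i + 1 ≠ a := by omega
      simp only [h.le, h1, decide_true, List.filter_cons_of_pos, ih, List.mem_cons, h2, false_or]
      split_ifs <;> simp
    · have h1 : ∀ j ≤ i + 1, L.filter (· ≤ j) = [] := by
        intro j hj
        rw [List.filter_eq_nil_iff]
        intro b hb
        have := hL.1 b hb
        simp
        omega
      simp [h1]
    · have h2 : i + 1 ≠ a := by omega
      have h3 : ¬ a ≤ i := by omega
      have h4 : i + 1 ∉ L := fun hc => by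
        have := hL.1 _ hc
        omega
      simp only [h4, if_false] at ih
      simp [h4, ih, h2, h3, h]

theorem letterAt_append_left {L M : List ℕ} {t : ℕ} (h1 : 1 ≤ t) (h2 : t ≤ L.length) :
    letterAt (L ++ M) t = letterAt L t := by
  obtain ⟨t, rfl⟩ : ∃ s, t = s + 1 := ⟨t - 1, by omega⟩
  rw [letterAt_eq_getElem (by simp; omega), letterAt_eq_getElem (by omega),
    List.getElem_append_left (by omega)]

theorem letterAt_concat_length (L : List ℕ) (a : ℕ) : letterAt (L ++ [a]) (L.length + 1) = a := by
  rw [letterAt_eq_getElem (by simp)]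
  simp

theorem List.take_succ_eq_concat_letterAt {L : List ℕ} {t : ℕ} (h : t < L.length) :
    L.take (t + 1) = L.take t ++ [letterAt L (t + 1)] := by
  rw [letterAt_eq_getElem h, List.take_append_getElem h]

theorem List.drop_eq_letterAt_cons {L : List ℕ} {t : ℕ} (h : t < L.length) :
    L.drop t = letterAt L (t + 1) :: L.drop (t + 1) := by
  rw [letterAt_eq_getElem h, ← List.drop_eq_getElem_cons h]

theorem IsWordOver.toFinset_eq {σ : ℕ} {w : List ℕ} (hw : IsWordOver σ w) :
    w.toFinset = Finset.Icc 1 σ := by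
  ext a
  simp [hw a]

theorem List.nodup_flatMap_cons {ι : Type*} {L : List ι} (f : ι → ℕ) (g : ι → List (List ℕ))
    (hL : L.Pairwise (fun i j => f i ≠ f j)) (hg : ∀ i ∈ L, (g i).Nodup) :
    (L.flatMap fun i => (g i).map (f i :: ·)).Nodup := by
  rw [List.nodup_flatMap]
  refine ⟨fun i hi => (hg i hi).map (List.cons_injective), hL.imp ?_⟩
  intro i j hij
  simp only [Function.onFun, List.disjoint_left, List.mem_map]
  rintro _ ⟨v, -, rfl⟩ ⟨v', -, h⟩
  exact hij (List.cons.inj h).1.symm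

theorem List.argmin_getD_spec {L : List ℕ} (f : ℕ → ℕ) (hL : L ≠ []) :
    (L.argmin f).getD 0 ∈ L ∧ ∀ j ∈ L, f ((L.argmin f).getD 0) ≤ f j := by
  cases h : L.argmin f with
  | none => exact absurd (List.argmin_eq_none.1 h) hL
  | some m =>
    exact ⟨List.argmin_mem h, fun j hj => List.le_of_mem_argmin hj h⟩

/-- This is the update performed by the programs when an element is appended. The strict comparison
keeps the earlier element on ties, and the empty list needs a case of its own because its `argmin`
is only the default `0`. -/
theorem List.argmin_concat_getD {L : List ℕ} (f : ℕ → ℕ) (a : ℕ) :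
    ((L ++ [a]).argmin f).getD 0 =
      if L.length = 0 then a else
        if f a < f ((L.argmin f).getD 0) then a else (L.argmin f).getD 0 := by
  rw [List.argmin_concat]
  cases h : L.argmin f with
  | none => simp [List.argmin_eq_none.1 h]
  | some m =>
    have : L.length ≠ 0 := by
      rintro h0
      rw [List.length_eq_zero_iff.1 h0] at h
      simp at h
    simp only [this, if_false, Option.getD_some]
    split_ifs <;> rfl

/-! ### The rows `sortedLast`, `Leq`, `Lex` and the list `startSAS` -/

namespace ArchFactorization

variable {w : List ℕ} (F : ArchFactorization w)

/-- The elements of `L'_ℓ` up to `i`, in ascending order. -/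
noncomputable def lastUpTo (ℓ i : ℕ) : List ℕ := (F.sortedLast ℓ).filter (· ≤ i)

theorem pairwise_sortedLast (ℓ : ℕ) : (F.sortedLast ℓ).Pairwise (· < ·) :=
  (Finset.sortedLT_sort _).pairwise

theorem lastUpTo_eq_take (ℓ i : ℕ) :
    F.lastUpTo ℓ i = (F.sortedLast ℓ).take (F.lastUpTo ℓ i).length :=
  List.filter_le_eq_take (F.pairwise_sortedLast ℓ) i

theorem mem_sortedLast {ℓ j : ℕ} : j ∈ F.sortedLast ℓ ↔ j ∈ F.lastSet ℓ := by
  simp [sortedLast]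

theorem mem_lastUpTo {ℓ i j : ℕ} : j ∈ F.lastUpTo ℓ i ↔ j ∈ F.lastSet ℓ ∧ j ≤ i := by
  simp [lastUpTo, mem_sortedLast]

theorem length_lastUpTo_le (ℓ i : ℕ) : (F.lastUpTo ℓ i).length ≤ (F.sortedLast ℓ).length :=
  List.length_filter_le _ _

/-- In an ascending list the indices of the entries at most `i` form an initial segment, so the
largest index is their number. Reading `-∞` as `0` fits this count. -/
theorem leqArr_unbotD (ℓ i : ℕ) : (F.leqArr ℓ i).unbotD 0 = (F.lastUpTo ℓ i).length := by
  have hle := F.length_lastUpTo_le ℓ i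
  have hset : ((Finset.Icc 1 (F.sortedLast ℓ).length).filter
      (fun t => letterAt (F.sortedLast ℓ) t ≤ i)) = Finset.Icc 1 (F.lastUpTo ℓ i).length := by
    ext t
    simp only [Finset.mem_filter, Finset.mem_Icc]
    constructor
    · rintro ⟨⟨h1, h2⟩, h3⟩
      exact ⟨h1, (letterAt_le_iff_of_pairwise (F.pairwise_sortedLast ℓ) h1 h2).1 h3⟩
    · rintro ⟨h1, h2⟩
      exact ⟨⟨h1, by omega⟩,
        (letterAt_le_iff_of_pairwise (F.pairwise_sortedLast ℓ) h1 (by omega)).2 h2⟩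
  rw [leqArr, hset]
  generalize (F.lastUpTo ℓ i).length = c
  rcases Nat.eq_zero_or_pos c with rfl | hc
  · simp
  · have : (Finset.Icc 1 c).max = (c : WithBot ℕ) := by
      refine le_antisymm (Finset.max_le fun a ha => ?_) (Finset.le_max (by simp; omega))
      exact WithBot.coe_le_coe.2 (Finset.mem_Icc.1 ha).2
    rw [this]
    rfl

theorem lastUpTo_succ (ℓ i : ℕ) : F.lastUpTo ℓ (i + 1) =
    if i + 1 ∈ F.lastSet ℓ then F.lastUpTo ℓ i ++ [i + 1] else F.lastUpTo ℓ i := by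
  have := List.filter_le_succ (F.pairwise_sortedLast ℓ) i
  simpa only [mem_sortedLast, lastUpTo] using this

variable {F}

theorem lastUpTo_archEnd {ℓ : ℕ} (h1 : 1 ≤ ℓ) (hk : ℓ ≤ F.k) :
    F.lastUpTo ℓ (F.archEnd ℓ) = F.sortedLast ℓ := by
  rw [lastUpTo, List.filter_eq_self]
  intro j hj
  simpa using (inArch_of_mem_lastSet h1 hk (F.mem_sortedLast.1 hj)).2

theorem lastUpTo_archEnd_pred {ℓ : ℕ} (h1 : 1 ≤ ℓ) (hk : ℓ ≤ F.k) :
    F.lastUpTo ℓ (F.archEnd (ℓ - 1)) = [] := by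
  rw [lastUpTo, List.filter_eq_nil_iff]
  intro j hj
  simpa using (inArch_of_mem_lastSet h1 hk (F.mem_sortedLast.1 hj)).1

theorem hasAbsentAfter_iff_length_pos {ℓ p : ℕ} (h1 : 1 ≤ ℓ) (hk : ℓ ≤ F.k)
    (hp : F.InArch ℓ p) :
    HasAbsentAfter w p (F.k - ℓ + 1) ↔ 0 < (F.lastUpTo ℓ p).length := by
  rw [hasAbsentAfter_iff h1 hk hp, List.length_pos_iff_exists_mem]
  simp [mem_lastUpTo]

theorem lexArr_eq (ℓ i : ℕ) :
    F.lexArr ℓ (F.lastUpTo ℓ i).length = ((F.lastUpTo ℓ i).argmin (letterAt w)).getD 0 := by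
  rw [lexArr, ← lastUpTo_eq_take]

theorem length_sortedLast_le {σ : ℕ} (hw : IsWordOver σ w) (ℓ : ℕ) :
    (F.sortedLast ℓ).length ≤ σ := by
  rw [sortedLast, Finset.length_sort]
  calc _ ≤ (w.toFinset.image (F.lastPosArch ℓ)).card := Finset.card_le_card Finset.sdiff_subset
    _ ≤ w.toFinset.card := Finset.card_image_le
    _ = σ := by simp [hw.toFinset_eq]

/-- Every arch contains `σ` distinct letters. This keeps all addresses `(ℓ - 1) * σ + t` of the
tables within `n`. -/
theorem mul_le_archEnd {σ ℓ : ℕ} (hw : IsWordOver σ w) (hℓ : ℓ ≤ F.k) :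
    ℓ * σ ≤ F.archEnd ℓ := by
  induction ℓ with
  | zero => simp
  | succ ℓ ih =>
    have h1 := ih (by omega)
    have h2 : σ ≤ F.archEnd (ℓ + 1) - F.archEnd ℓ := by
      rw [← Nat.card_Ioc]
      calc σ = (Finset.Icc 1 σ).card := by simp
        _ ≤ ((Finset.Ioc (F.archEnd ℓ) (F.archEnd (ℓ + 1))).image (letterAt w)).card := by
          refine Finset.card_le_card fun a ha => ?_
          obtain ⟨j, h1, h2, h3⟩ := F.exists_inArch (ℓ := ℓ) (by omega)
            ((hw a).2 (Finset.mem_Icc.1 ha))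
          exact Finset.mem_image.2 ⟨j, Finset.mem_Ioc.2 ⟨h1, h2⟩, h3⟩
        _ ≤ _ := Finset.card_image_le
    have := F.archEnd_mono (Nat.le_succ ℓ)
    rw [Nat.add_mul]
    simp only [Nat.succ_eq_add_one] at this
    omega

theorem mul_le_length {σ ℓ : ℕ} (hw : IsWordOver σ w) (hℓ : ℓ ≤ F.k) : ℓ * σ ≤ w.length :=
  (mul_le_archEnd hw hℓ).trans (F.archEnd_le_length _)

theorem distArr_firstPosArch_one {a : ℕ} (ha : a ∈ w) :
    distArr w (F.firstPosArch 1 a) = F.k + 1 ↔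
      HasAbsentAfter w (F.firstPosArch 1 a) F.k := by
  have h := (distArr_eq_iff F.k_pos (inArch_firstPosArch le_rfl F.k_pos ha)).2
  have hk := F.k_pos
  rwa [show F.k - 1 + 2 = F.k + 1 by omega, show F.k - 1 + 1 = F.k by omega] at h

theorem mem_startSAS {i : ℕ} : i ∈ F.startSAS ↔
    ∃ a ∈ w, F.firstPosArch 1 a = i ∧ HasAbsentAfter w i F.k := by
  simp only [startSAS, List.mem_filter, List.mem_map, Finset.mem_sort, List.mem_toFinset,
    decide_eq_true_eq]
  constructor
  · rintro ⟨⟨a, ha, rfl⟩, h⟩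
    exact ⟨a, ha, rfl, (distArr_firstPosArch_one ha).1 h⟩
  · rintro ⟨a, ha, rfl, h⟩
    exact ⟨⟨a, ha, rfl⟩, (distArr_firstPosArch_one ha).2 h⟩

theorem length_startSAS_le {σ : ℕ} (hw : IsWordOver σ w) : F.startSAS.length ≤ σ := by
  refine (List.length_filter_le _ _).trans ?_
  simp [hw.toFinset_eq]

theorem exists_isSAS (F : ArchFactorization w) : ∃ u, IsSAS w u := by
  obtain ⟨v, hl, hv⟩ := exists_absentAfter_archEnd (F := F) (Nat.zero_le _)
  rw [archEnd_zero, absentAfter_zero] at hv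
  exact ⟨v, isSAS_iff.2 ⟨hl, hv⟩⟩

theorem isSAS_cons_iff {a : ℕ} {v : List ℕ} : IsSAS w (a :: v) ↔
    a ∈ w ∧ F.firstPosArch 1 a ∈ F.startSAS ∧ v.length = F.k ∧
      AbsentAfter w (F.firstPosArch 1 a) v := by
  rw [isSAS_iff (F := F), isAbsent_cons_iff (F := F), mem_startSAS]
  simp only [List.length_cons, Nat.add_right_cancel_iff]
  constructor
  · rintro ⟨h1, h2, h3⟩
    exact ⟨h2, ⟨a, h2, rfl, v, h1, h3⟩, h1, h3⟩
  · rintro ⟨h1, -, h2, h3⟩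
    exact ⟨h2, h1, h3⟩

theorem startSAS_ne_nil : F.startSAS ≠ [] := by
  obtain ⟨u, hu⟩ := F.exists_isSAS
  cases u with
  | nil => exact absurd (isSAS_iff (F := F).1 hu).1 (by simp)
  | cons a v => exact List.ne_nil_of_mem (isSAS_cons_iff.1 hu).2.1

theorem startSAS_spec {i : ℕ} (hi : i ∈ F.startSAS) :
    F.InArch 1 i ∧ F.firstPosArch 1 (letterAt w i) = i ∧ 0 < (F.lastUpTo 1 i).length := by
  obtain ⟨a, ha, rfl, h⟩ := mem_startSAS.1 hi
  have hA := inArch_firstPosArch (F := F) le_rfl F.k_pos ha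
  rw [letterAt_firstPosArch le_rfl F.k_pos ha]
  refine ⟨hA, rfl, ?_⟩
  rw [← hasAbsentAfter_iff_length_pos le_rfl F.k_pos hA]
  have := F.k_pos
  rwa [show F.k - 1 + 1 = F.k by omega]

/-- Following a position of `L'_ℓ` into the next arch leads to a position from which the absent
word can be completed. -/
theorem lastSet_next_spec {ℓ j : ℕ} (h1 : 1 ≤ ℓ) (hk : ℓ < F.k) (hj : j ∈ F.lastSet ℓ) :
    F.InArch (ℓ + 1) (F.firstPosArch (ℓ + 1) (letterAt w j)) ∧
      0 < (F.lastUpTo (ℓ + 1) (F.firstPosArch (ℓ + 1) (letterAt w j))).length := by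
  obtain ⟨a, ha, hf, rfl⟩ := (mem_lastSet_iff h1 hk.le).1 hj
  rw [letterAt_lastPosArch h1 hk.le ha]
  have hA := inArch_firstPosArch (F := F) (ℓ := ℓ + 1) (by omega) (by omega) ha
  refine ⟨hA, ?_⟩
  rw [← hasAbsentAfter_iff_length_pos (by omega) (by omega) hA]
  rw [mem_filteredLetters_iff ha, if_pos hk, not_not] at hf
  rwa [show F.k - (ℓ + 1) + 1 = F.k - ℓ by omega]

theorem letterAt_mem_of_mem_lastSet {ℓ j : ℕ} (h1 : 1 ≤ ℓ) (hk : ℓ ≤ F.k)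
    (hj : j ∈ F.lastSet ℓ) : letterAt w j ∈ w :=
  letterAt_mem (inArch_of_mem_lastSet h1 hk hj).pos (inArch_of_mem_lastSet h1 hk hj).le_length

/-- The recursion in terms of positions instead of letters; an element of `L'_ℓ` is recovered from
its letter by `lastPosArch`. In this form the absent words are the paths of a tree, used both for
the enumeration and for the minimum. -/
theorem absentAfter_iff_exists {ℓ p : ℕ} {u : List ℕ} (h1 : 1 ≤ ℓ) (hk : ℓ ≤ F.k)
    (hp : F.InArch ℓ p) (hu : u.length + ℓ = F.k + 1) :
    AbsentAfter w p u ↔ ∃ j ∈ F.lastUpTo ℓ p, ∃ v, u = letterAt w j :: v ∧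
      (ℓ < F.k → AbsentAfter w (F.firstPosArch (ℓ + 1) (letterAt w j)) v) := by
  cases u with
  | nil => simp at hu; omega
  | cons a v =>
    simp only [List.length_cons] at hu
    rw [absentAfter_iff_mem_lastSet h1 hk hp (by omega)]
    constructor
    · rintro ⟨ha, h2, h3, h4⟩
      have e := letterAt_lastPosArch h1 hk ha
      refine ⟨_, F.mem_lastUpTo.2 ⟨h2, h3⟩, v, ?_, ?_⟩
      · rw [e]
      · rwa [e]
    · rintro ⟨j, hj, v', he, h⟩
      obtain ⟨rfl, rfl⟩ := List.cons.inj he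
      obtain ⟨h2, h3⟩ := F.mem_lastUpTo.1 hj
      rw [lastPosArch_letterAt_of_mem_lastSet h1 hk h2]
      exact ⟨letterAt_mem_of_mem_lastSet h1 hk h2, h2, h3, h⟩

/-! ### The list of all shortest absent subsequences -/

variable (F)

/-- The words of length `d` that are absent after the position `p` of the arch `k + 1 - d`. -/
noncomputable def sasAfter : ℕ → ℕ → List (List ℕ)
  | 0, _ => [[]]
  | d + 1, p => (F.lastUpTo (F.k - d) p).flatMap fun j =>
      (sasAfter d (F.firstPosArch (F.k - d + 1) (letterAt w j))).map (letterAt w j :: ·)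

/-- All shortest absent subsequences. -/
noncomputable def sasList : List (List ℕ) :=
  F.startSAS.flatMap fun i => (F.sasAfter F.k i).map (letterAt w i :: ·)

variable {F}

/-- Unfolding one level of the tree is `absentAfter_iff_exists`. At the last level the next position
refers to an arch `k + 1` that does not exist, but `sasAfter 0` ignores it. -/
theorem mem_sasAfter {d p : ℕ} {v : List ℕ} (hd : d < F.k) (hp : F.InArch (F.k - d) p) :
    v ∈ F.sasAfter (d + 1) p ↔ v.length = d + 1 ∧ AbsentAfter w p v := by
  induction d generalizing p v with
  | zero =>
    have := absentAfter_iff_exists (u := v) F.k_pos le_rfl hp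
    simp only [sasAfter, List.mem_flatMap, List.map_cons, List.map_nil, List.mem_singleton,
      Nat.sub_zero]
    constructor
    · rintro ⟨j, hj, rfl⟩
      refine ⟨by simp, (this (by simp; omega)).2 ⟨j, hj, [], rfl, fun h => absurd h (by simp)⟩⟩
    · rintro ⟨hl, hv⟩
      obtain ⟨j, hj, v', rfl, -⟩ := (this (by omega)).1 hv
      refine ⟨j, hj, ?_⟩
      simpa using hl
  | succ d ih =>
    have := absentAfter_iff_exists (u := v) (by omega) (by omega) hp
    have hs : F.k - (d + 1) + 1 = F.k - d := by omega
    rw [hs] at this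
    rw [sasAfter, hs]
    simp only [List.mem_flatMap, List.mem_map]
    constructor
    · rintro ⟨j, hj, v', hv', rfl⟩
      have hN := (lastSet_next_spec (by omega) (by omega) (F.mem_lastUpTo.1 hj).1).1
      rw [hs] at hN
      obtain ⟨hl, ha⟩ := (ih (by omega) hN).1 hv'
      exact ⟨by simp [hl], (this (by simp; omega)).2 ⟨j, hj, v', rfl, fun _ => ha⟩⟩
    · rintro ⟨hl, hv⟩
      obtain ⟨j, hj, v', rfl, h⟩ := (this (by omega)).1 hv
      have hN := (lastSet_next_spec (by omega) (by omega) (F.mem_lastUpTo.1 hj).1).1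
      rw [hs] at hN
      exact ⟨j, hj, v', (ih (by omega) hN).2 ⟨by simpa using hl, h (by omega)⟩, rfl⟩

/-- Each element of `L'_ℓ` is the last position of its own letter, so equal letters mean equal
positions. Hence different branches spell different words. -/
theorem pairwise_letterAt_lastUpTo {ℓ p : ℕ} (h1 : 1 ≤ ℓ) (hk : ℓ ≤ F.k) :
    (F.lastUpTo ℓ p).Pairwise (fun i j => letterAt w i ≠ letterAt w j) := by
  have h := ((F.pairwise_sortedLast ℓ).filter (· ≤ p))
  refine h.imp_of_mem fun {i j} hi hj hij he => ?_
  have e1 := lastPosArch_letterAt_of_mem_lastSet h1 hk (F.mem_lastUpTo.1 hi).1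
  have e2 := lastPosArch_letterAt_of_mem_lastSet h1 hk (F.mem_lastUpTo.1 hj).1
  rw [he, e2] at e1
  omega

theorem nodup_sasAfter {d p : ℕ} (hd : d ≤ F.k) : (F.sasAfter d p).Nodup := by
  induction d generalizing p with
  | zero => simp [sasAfter]
  | succ d ih =>
    exact List.nodup_flatMap_cons _ _ (pairwise_letterAt_lastUpTo (by omega) (by omega))
      fun j _ => ih (by omega)

theorem mem_sasList {v : List ℕ} : v ∈ F.sasList ↔ IsSAS w v := by
  have hk := F.k_pos
  obtain ⟨d, hd⟩ : ∃ d, F.k = d + 1 := ⟨F.k - 1, by omega⟩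
  have hkd : F.k - d = 1 := by omega
  have key : ∀ i ∈ F.startSAS, ∀ u,
      u ∈ F.sasAfter F.k i ↔ u.length = F.k ∧ AbsentAfter w i u := by
    intro i hi u
    have := mem_sasAfter (v := u) (F := F) (d := d) (p := i) (by omega)
      (hkd ▸ (startSAS_spec hi).1)
    rwa [← hd] at this
  simp only [sasList, List.mem_flatMap, List.mem_map]
  constructor
  · rintro ⟨i, hi, u, hu, rfl⟩
    obtain ⟨h1, h2, -⟩ := startSAS_spec hi
    obtain ⟨h3, h4⟩ := (key i hi u).1 hu
    rw [isSAS_cons_iff (F := F), h2]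
    exact ⟨letterAt_mem h1.pos h1.le_length, hi, h3, h4⟩
  · intro h
    cases v with
    | nil => exact absurd (isSAS_iff (F := F).1 h).1 (by simp)
    | cons a v =>
      obtain ⟨h1, h2, h3⟩ := isSAS_cons_iff (F := F).1 h
      refine ⟨_, h2, v, (key _ h2 v).2 h3, ?_⟩
      rw [letterAt_firstPosArch le_rfl hk h1]

theorem nodup_startSAS : F.startSAS.Nodup := by
  refine List.Nodup.filter _ ?_
  refine List.Nodup.map_on ?_ (Finset.sort_nodup _ _)
  intro a ha b hb h
  simp only [Finset.mem_sort, List.mem_toFinset] at ha hb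
  rw [← letterAt_firstPosArch le_rfl F.k_pos ha, h, letterAt_firstPosArch le_rfl F.k_pos hb]

theorem nodup_sasList : F.sasList.Nodup := by
  refine List.nodup_flatMap_cons _ _ ?_ fun j _ => nodup_sasAfter le_rfl
  refine nodup_startSAS.imp_of_mem fun {i j} hi hj hij he => hij ?_
  rw [← (startSAS_spec hi).2.1, he, (startSAS_spec hj).2.1]

/-! ### The lexicographically smallest SAS -/

/-- The position in `L'_ℓ` up to `p` that carries the smallest letter. -/
noncomputable def lexNext (F : ArchFactorization w) (ℓ p : ℕ) : ℕ :=
  F.lexArr ℓ (F.lastUpTo ℓ p).length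

theorem lexNext_spec {ℓ p : ℕ} (h : 0 < (F.lastUpTo ℓ p).length) :
    F.lexNext ℓ p ∈ F.lastUpTo ℓ p ∧
      ∀ j ∈ F.lastUpTo ℓ p, letterAt w (F.lexNext ℓ p) ≤ letterAt w j := by
  rw [lexNext, lexArr_eq]
  exact List.argmin_getD_spec _ (List.length_pos_iff.1 h)

/-- The lexicographically smallest word of length `d` that is absent after the position `p` of the
arch `k + 1 - d`. -/
noncomputable def lexAfter (F : ArchFactorization w) : ℕ → ℕ → List ℕ
  | 0, _ => []
  | d + 1, p => letterAt w (F.lexNext (F.k - d) p) ::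
      lexAfter F d (F.firstPosArch (F.k - d + 1) (letterAt w (F.lexNext (F.k - d) p)))

theorem _root_.List.cons_le_cons_of {a b : ℕ} {u v : List ℕ} (h : a ≤ b)
    (h' : a = b → u ≤ v) : a :: u ≤ b :: v := by
  rcases h.lt_or_eq with h1 | rfl
  · exact le_of_lt (List.Lex.rel h1)
  · rcases (h' rfl).lt_or_eq with h2 | rfl
    · exact le_of_lt (List.Lex.cons h2)
    · exact le_rfl

/-- Greedy choice is correct because every choice can be completed and all competitors have the same
length. A competitor either starts with a larger letter or starts with the same one, and then its
tail competes from the same position. -/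
theorem lexAfter_spec {d p : ℕ} (hd : d < F.k) (hp : F.InArch (F.k - d) p)
    (hne : 0 < (F.lastUpTo (F.k - d) p).length) :
    (F.lexAfter (d + 1) p).length = d + 1 ∧ AbsentAfter w p (F.lexAfter (d + 1) p) ∧
      ∀ v, v.length = d + 1 → AbsentAfter w p v → F.lexAfter (d + 1) p ≤ v := by
  have hL := lexNext_spec hne
  induction d generalizing p with
  | zero =>
    have key := fun u => absentAfter_iff_exists (u := u) F.k_pos le_rfl hp
    refine ⟨by simp [lexAfter], ?_, ?_⟩
    · refine (key _ (by simp [lexAfter]; omega)).2 ⟨_, hL.1, _, rfl, fun h => absurd h (by simp)⟩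
    · intro v hl hv
      obtain ⟨j, hj, v', rfl, -⟩ := (key v (by omega)).1 hv
      obtain rfl : v' = [] := by simpa using hl
      exact List.cons_le_cons_of (hL.2 j hj) fun _ => le_rfl
  | succ d ih =>
    have key := fun u => absentAfter_iff_exists (u := u) (by omega) (by omega) hp
    have hs : F.k - (d + 1) + 1 = F.k - d := by omega
    have hN := lastSet_next_spec (by omega) (by omega) (F.mem_lastUpTo.1 hL.1).1
    rw [hs] at hN
    obtain ⟨h1, h2, h3⟩ := ih (by omega) hN.1 hN.2 (lexNext_spec hN.2)
    rw [lexAfter, hs]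
    rw [hs] at key
    refine ⟨by simp [h1], ?_, ?_⟩
    · exact (key _ (by simp [h1]; omega)).2 ⟨_, hL.1, _, rfl, fun _ => h2⟩
    · intro v hl hv
      obtain ⟨j, hj, v', rfl, h⟩ := (key v (by omega)).1 hv
      -- With equal first letters the continuation starts at the same position, as this position
      -- depends on the letter only.
      refine List.cons_le_cons_of (hL.2 j hj) fun he => h3 _ (by simpa using hl) ?_
      rw [he]
      exact h (by omega)

theorem lexMin_spec :
    IsSAS w (letterAt w F.init :: F.lexAfter F.k F.init) ∧
      ∀ v, IsSAS w v → letterAt w F.init :: F.lexAfter F.k F.init ≤ v := by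
  have hk := F.k_pos
  obtain ⟨hi, hmin⟩ := List.argmin_getD_spec (letterAt w) F.startSAS_ne_nil
  change F.init ∈ _ at hi
  change ∀ j ∈ _, letterAt w F.init ≤ _ at hmin
  obtain ⟨h1, h2, h3⟩ := startSAS_spec hi
  obtain ⟨d, hd⟩ : ∃ d, F.k = d + 1 := ⟨F.k - 1, by omega⟩
  have hkd : F.k - d = 1 := by omega
  have := lexAfter_spec (F := F) (d := d) (p := F.init) (by omega) (hkd ▸ h1) (hkd ▸ h3)
  rw [← hd] at this
  obtain ⟨h4, h5, h6⟩ := this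
  constructor
  · rw [isSAS_cons_iff (F := F), h2]
    exact ⟨letterAt_mem h1.pos h1.le_length, hi, h4, h5⟩
  · intro v hv
    cases v with
    | nil => exact absurd (isSAS_iff (F := F).1 hv).1 (by simp)
    | cons a v =>
      obtain ⟨h7, h8, h9, h10⟩ := isSAS_cons_iff (F := F).1 hv
      have e := letterAt_firstPosArch (F := F) le_rfl hk h7
      refine List.cons_le_cons_of (e ▸ hmin _ h8) fun he => h6 _ h9 ?_
      rwa [← he, h2] at h10

end ArchFactorization

/-! ### Program logic for the machine -/

/-- Started in `s`, the program `p` halts without exceeding the word bound `B`, in a state that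
satisfies `Q`. -/
def RamProg.Runs (B : ℕ) (p : RamProg) (s : RamState) (Q : RamState → Prop) : Prop :=
  ∃ s', Exec B p s s' ∧ Q s'

/-- The state after `t` idle steps. -/
abbrev RamState.tick (s : RamState) (t : ℕ) : RamState := { s with time := s.time + t }

namespace RamProg

variable {B : ℕ} {s : RamState} {Q R : RamState → Prop} {p q : RamProg} {e idx : RamExpr}

theorem Runs.mono (h : Runs B p s Q) (hQ : ∀ s', Q s' → R s') : Runs B p s R := by
  obtain ⟨s', h1, h2⟩ := h
  exact ⟨s', h1, hQ _ h2⟩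

theorem runs_skip : Runs B .skip s Q ↔ Q (s.tick 1) := by
  constructor
  · rintro ⟨_, ⟨⟩, h⟩
    exact h
  · exact fun h => ⟨_, .skip s, h⟩

theorem runs_assign {x : RegName} : Runs B (.assign x e) s Q ↔ e.Fits B s ∧
    Q { s with reg := Function.update s.reg x (e.eval s), time := s.time + e.cost + 1 } := by
  constructor
  · rintro ⟨_, ⟨⟩, h⟩
    exact ⟨‹_›, h⟩
  · exact fun h => ⟨_, .assign x e s h.1, h.2⟩

theorem runs_store {A : ArrName} : Runs B (.store A idx e) s Q ↔ idx.Fits B s ∧ e.Fits B s ∧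
    Q { s with
      arr := Function.update s.arr A (Function.update (s.arr A) (idx.eval s) (e.eval s))
      time := s.time + idx.cost + e.cost + 1 } := by
  constructor
  · rintro ⟨_, ⟨⟩, h⟩
    exact ⟨‹_›, ‹_›, h⟩
  · exact fun h => ⟨_, .store A idx e s h.1 h.2.1, h.2.2⟩

theorem runs_emit : Runs B (.emit e) s Q ↔ e.Fits B s ∧
    Q { s with cur := s.cur ++ [e.eval s], time := s.time + e.cost + 1 } := by
  constructor
  · rintro ⟨_, ⟨⟩, h⟩
    exact ⟨‹_›, h⟩
  · exact fun h => ⟨_, .emit e s h.1, h.2⟩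

theorem runs_endWord : Runs B .endWord s Q ↔
    Q { s with cur := [], out := s.out ++ [(s.cur, s.time + 1)], time := s.time + 1 } := by
  constructor
  · rintro ⟨_, ⟨⟩, h⟩
    exact h
  · exact fun h => ⟨_, .endWord s, h⟩

theorem runs_seq : Runs B (.seq p q) s Q ↔ Runs B p s fun s' => Runs B q s' Q := by
  constructor
  · rintro ⟨_, ⟨⟩, h⟩
    exact ⟨_, ‹_›, _, ‹_›, h⟩
  · rintro ⟨s₁, h1, s₂, h2, h3⟩
    exact ⟨s₂, .seq _ _ _ _ _ h1 h2, h3⟩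

theorem runs_ite : Runs B (.ite e p q) s Q ↔ e.Fits B s ∧
    (e.eval s ≠ 0 → Runs B p (s.tick (e.cost + 1)) Q) ∧
      (e.eval s = 0 → Runs B q (s.tick (e.cost + 1)) Q) := by
  constructor
  · rintro ⟨_, h, hQ⟩
    cases h with
    | ite_true _ _ _ _ _ hf he hp =>
      exact ⟨hf, fun _ => ⟨_, hp, hQ⟩, fun h => absurd h he⟩
    | ite_false _ _ _ _ _ hf he hp =>
      exact ⟨hf, fun h => absurd he h, fun _ => ⟨_, hp, hQ⟩⟩
  · rintro ⟨hf, h1, h2⟩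
    by_cases he : e.eval s = 0
    · obtain ⟨s', h3, h4⟩ := h2 he
      exact ⟨s', .ite_false _ _ _ _ _ hf he h3, h4⟩
    · obtain ⟨s', h3, h4⟩ := h1 he
      exact ⟨s', .ite_true _ _ _ _ _ hf he h3, h4⟩

/-- Loop rule for a loop that makes `m` further iterations. -/
theorem runs_while (I : ℕ → RamState → Prop)
    (hfits : ∀ m s, I m s → e.Fits B s ∧ (e.eval s = 0 ↔ m = 0))
    (hstep : ∀ m s, I (m + 1) s → Runs B p (s.tick (e.cost + 1)) (I m))
    (hend : ∀ s, I 0 s → Q (s.tick (e.cost + 1)))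
    (m : ℕ) (s : RamState) (h : I m s) : Runs B (.while e p) s Q := by
  induction m generalizing s with
  | zero =>
    obtain ⟨h1, h2⟩ := hfits _ _ h
    exact ⟨_, .while_false _ _ _ h1 (h2.2 rfl), hend _ h⟩
  | succ m ih =>
    obtain ⟨h1, h2⟩ := hfits _ _ h
    obtain ⟨s₁, h3, h4⟩ := hstep _ _ h
    obtain ⟨s₂, h5, h6⟩ := ih s₁ h4
    exact ⟨s₂, .while_true _ _ _ _ _ h1 (fun hc => absurd (h2.1 hc) (by simp)) h3 h5, h6⟩

end RamProg

-- Rewriting with these equivalences executes loop-free code symbolically. What remains are bounds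
-- on values, the cases of the branches and the postcondition.
attribute [simp] RamProg.runs_skip RamProg.runs_assign RamProg.runs_store RamProg.runs_emit
  RamProg.runs_endWord RamProg.runs_seq RamProg.runs_ite RamExpr.eval RamExpr.cost RamExpr.Fits
  BinOp.eval

infixr:60 " ;; " => RamProg.seq

open RamExpr in
/-- `x < y` as an expression. -/
abbrev RamExpr.ltE (x y : RamExpr) : RamExpr := bin .lt x y

abbrev RamExpr.eqE (x y : RamExpr) : RamExpr := bin .eq x y

abbrev RamExpr.addE (x y : RamExpr) : RamExpr := bin .add x y

abbrev RamExpr.subE (x y : RamExpr) : RamExpr := bin .sub x y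

abbrev RamExpr.mulE (x y : RamExpr) : RamExpr := bin .mul x y

/-- The address of entry `[ℓ][t]` of an array with rows of length `σ`. -/
abbrev RamExpr.cellE (ℓ t : RamExpr) : RamExpr :=
  addE (mulE (subE ℓ (const 1)) (reg .sigma)) t

/-! ### Precomputed data in memory -/

/-- The registers and arrays of the precomputed data have the same contents in `s` and `s'`. -/
structure SameData (s s' : RamState) : Prop where
  n : s'.reg .n = s.reg .n
  sigma : s'.reg .sigma = s.reg .sigma
  k : s'.reg .k = s.reg .k
  init : s'.reg .init = s.reg .init
  startLen : s'.reg .startLen = s.reg .startLen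
  arr : ∀ A, (∀ i, A ≠ .tmp i) → s'.arr A = s.arr A

theorem SameData.holdsData {σ : ℕ} {w : List ℕ} {F : ArchFactorization w} {s s' : RamState}
    (h : SameData s s') (hd : HoldsData σ w F s) : HoldsData σ w F s' where
  n := h.n.trans hd.n
  sigma := h.sigma.trans hd.sigma
  word := by rw [h.arr _ (by simp)]; exact hd.word
  k := h.k.trans hd.k
  archEnd := by rw [h.arr _ (by simp)]; exact hd.archEnd
  firstPosArch := by rw [h.arr _ (by simp)]; exact hd.firstPosArch
  lastPosArch := by rw [h.arr _ (by simp)]; exact hd.lastPosArch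
  sortedLen := by rw [h.arr _ (by simp)]; exact hd.sortedLen
  sortedLast := by rw [h.arr _ (by simp)]; exact hd.sortedLast
  leq := by rw [h.arr _ (by simp)]; exact hd.leq
  lex := by rw [h.arr _ (by simp)]; exact hd.lex
  startLen := h.startLen.trans hd.startLen
  startSAS := by rw [h.arr _ (by simp)]; exact hd.startSAS
  init := h.init.trans hd.init

theorem HoldsData.leq_length {σ : ℕ} {w : List ℕ} {F : ArchFactorization w} {s : RamState}
    (hd : HoldsData σ w F s) {ℓ p : ℕ} (h1 : 1 ≤ ℓ) (hk : ℓ ≤ F.k) (hp : F.InArch ℓ p) :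
    s.arr .leq p = (F.lastUpTo ℓ p).length := by
  rw [hd.leq ℓ p h1 hk hp, F.leqArr_unbotD]

theorem HoldsData.lex_leq {σ : ℕ} {w : List ℕ} {F : ArchFactorization w} {s : RamState}
    (hd : HoldsData σ w F s) {ℓ p : ℕ} (h1 : 1 ≤ ℓ) (hk : ℓ ≤ F.k)
    (hne : 0 < (F.lastUpTo ℓ p).length) :
    s.arr .lex (cell σ ℓ (F.lastUpTo ℓ p).length) = F.lexNext ℓ p := by
  rw [hd.lex ℓ _ h1 hk hne (F.length_lastUpTo_le ℓ p)]
  rfl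

theorem ArchFactorization.cell_le {σ : ℕ} {w : List ℕ} {F : ArchFactorization w}
    (hw : IsWordOver σ w) {ℓ t : ℕ} (h1 : 1 ≤ ℓ) (hk : ℓ ≤ F.k) (ht : t ≤ σ) :
    σ ≤ w.length ∧ (ℓ - 1) * σ ≤ w.length ∧ cell σ ℓ t ≤ w.length := by
  have := F.mul_le_length hw hk
  obtain ⟨m, rfl⟩ : ∃ m, ℓ = m + 1 := ⟨ℓ - 1, by omega⟩
  rw [Nat.add_mul] at this
  simp only [cell, Nat.add_sub_cancel]
  omega

theorem ArchFactorization.k_le_length {w : List ℕ} (F : ArchFactorization w) :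
    F.k ≤ w.length := by
  have : ∀ ℓ ≤ F.k, ℓ ≤ F.archEnd ℓ := by
    intro ℓ
    induction ℓ with
    | zero => simp
    | succ ℓ ih =>
      intro h
      have := F.archEnd_lt_succ (ℓ := ℓ) (by omega)
      have := ih (by omega)
      omega
  exact (this _ le_rfl).trans (F.archEnd_le_length _)

open RamProg RamExpr

theorem ArchFactorization.letterAt_sortedLast_mem {w : List ℕ} {F : ArchFactorization w} {ℓ t : ℕ}
    (ht : 1 ≤ t) (ht' : t ≤ (F.sortedLast ℓ).length) :
    letterAt (F.sortedLast ℓ) t ∈ F.lastSet ℓ :=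
  F.mem_sortedLast.1 (letterAt_mem ht ht')

theorem ArchFactorization.letterAt_sortedLast_le {w : List ℕ} {F : ArchFactorization w} {ℓ t : ℕ}
    (h1 : 1 ≤ ℓ) (hk : ℓ ≤ F.k) (ht : 1 ≤ t) (ht' : t ≤ (F.sortedLast ℓ).length) :
    letterAt (F.sortedLast ℓ) t ≤ w.length :=
  (F.inArch_of_mem_lastSet h1 hk (F.letterAt_sortedLast_mem ht ht')).le_length

/-- The entry of `sortedLast[ℓ]` with index `Leq[ℓ][j]` is the largest element of `L'_ℓ` up to `j`,
and it equals `j` exactly for members. This allows a membership test in constant time. -/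
theorem ArchFactorization.mem_lastSet_iff_letterAt {w : List ℕ} {F : ArchFactorization w}
    {ℓ j : ℕ} : j ∈ F.lastSet ℓ ↔ 0 < (F.lastUpTo ℓ j).length ∧
      letterAt (F.sortedLast ℓ) (F.lastUpTo ℓ j).length = j := by
  have hle := F.length_lastUpTo_le ℓ j
  constructor
  · intro h
    have hm : j ∈ F.sortedLast ℓ := F.mem_sortedLast.2 h
    obtain ⟨t, ht1, ht2, ht3⟩ := mem_iff_exists_letterAt.1 hm
    have hpw := F.pairwise_sortedLast ℓ
    have h2 := (letterAt_le_iff_of_pairwise hpw ht1 ht2 (i := j)).1 ht3.le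
    change t ≤ (F.lastUpTo ℓ j).length at h2
    have h4 := (letterAt_le_iff_of_pairwise hpw (i := j) (t := (F.lastUpTo ℓ j).length)
      (by omega) hle).2 le_rfl
    refine ⟨by omega, le_antisymm h4 ?_⟩
    have h5 := (letterAt_le_iff_of_pairwise hpw ht1 ht2
      (i := letterAt (F.sortedLast ℓ) (F.lastUpTo ℓ j).length)).2
      (h2.trans ((letterAt_le_iff_of_pairwise hpw (by omega) hle).1 le_rfl))
    rwa [ht3] at h5
  · rintro ⟨h1, h2⟩
    rw [← F.mem_sortedLast, ← h2]
    exact letterAt_mem h1 hle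

/-! ### Checking a word in time `O(k)` -/

/-- One step of the check: the next letter of the query must not occur again in the current
arch. -/
def checkBody : RamProg :=
  assign (.tmp 2) (get .query (addE (reg (.tmp 1)) (const 1))) ;;
  assign (.tmp 3) (get .lastPosArch (cellE (reg (.tmp 1)) (reg (.tmp 2)))) ;;
  ite (ltE (reg (.tmp 0)) (reg (.tmp 3))) (assign .ans (const 0)) skip ;;
  assign (.tmp 1) (addE (reg (.tmp 1)) (const 1)) ;;
  assign (.tmp 0) (get .firstPosArch (cellE (reg (.tmp 1)) (reg (.tmp 2))))

/-- The last step of the check: the last letter must occur neither in the rest of the last arch nor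
in the rest of the word. -/
def checkLast : RamProg :=
  assign (.tmp 2) (get .query (addE (reg .k) (const 1))) ;;
  assign (.tmp 3) (get .lastPosArch (cellE (reg .k) (reg (.tmp 2)))) ;;
  ite (ltE (reg (.tmp 0)) (reg (.tmp 3))) (assign .ans (const 0)) skip ;;
  assign (.tmp 4) (get .leq (reg (.tmp 3))) ;;
  ite (reg (.tmp 4))
    (ite (eqE (get .sortedLast (cellE (reg .k) (reg (.tmp 4)))) (reg (.tmp 3))) skip
      (assign .ans (const 0)))
    (assign .ans (const 0))

/-- The program that checks whether the query is a shortest absent subsequence. -/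
def checkProg : RamProg :=
  assign .ans (const 1) ;;
  assign (.tmp 1) (const 1) ;;
  assign (.tmp 0) (get .firstPosArch (get .query (const 1))) ;;
  RamProg.while (ltE (reg (.tmp 1)) (reg .k)) checkBody ;;
  checkLast

theorem SameData.refl (s : RamState) : SameData s s := ⟨rfl, rfl, rfl, rfl, rfl, fun _ _ => rfl⟩

theorem SameData.reg_congr {s₀ s s' : RamState} (h : SameData s₀ s)
    (hr : ∀ x, x = .n ∨ x = .sigma ∨ x = .k ∨ x = .init ∨ x = .startLen → s'.reg x = s.reg x)
    (ha : ∀ A, (∀ i, A ≠ .tmp i) → s'.arr A = s.arr A) : SameData s₀ s' where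
  n := (hr _ (by simp)).trans h.n
  sigma := (hr _ (by simp)).trans h.sigma
  k := (hr _ (by simp)).trans h.k
  init := (hr _ (by simp)).trans h.init
  startLen := (hr _ (by simp)).trans h.startLen
  arr A hA := (ha A hA).trans (h.arr A hA)

/-- The state of the check after the first `ℓ` letters of the query `u`. -/
structure CheckInv {w : List ℕ} (F : ArchFactorization w) (u : List ℕ) (s₀ : RamState) (ℓ : ℕ)
    (s : RamState) : Prop where
  same : SameData s₀ s
  level : s.reg (.tmp 1) = ℓ
  pos : s.reg (.tmp 0) = F.firstPosArch ℓ (letterAt u ℓ)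
  time : s.time ≤ 50 * ℓ
  ans : s.reg .ans = 1 ∧ (IsAbsent w u ↔ AbsentAfter w (F.firstPosArch ℓ (letterAt u ℓ)) (u.drop ℓ)) ∨
    s.reg .ans = 0 ∧ ¬ IsAbsent w u

/-- Below level `k` the filter plays no role: by `absentAfter_cons_iff` one comparison with
`lastPosArch` decides the step. After a failed comparison the walk simply continues, and `ans` stays
`0`. The offset `4` is the cost of the loop test. -/
theorem checkBody_runs {σ B : ℕ} {w u : List ℕ} {F : ArchFactorization w} {s₀ s : RamState} {ℓ : ℕ}
    (hw : IsWordOver σ w) (hB : 10 * w.length ≤ B) (hd₀ : HoldsData σ w F s₀)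
    (hq₀ : HoldsQuery u s₀) (hul : u.length = F.k + 1) (huw : ∀ a ∈ u, a ∈ w)
    (h1 : 1 ≤ ℓ) (hk : ℓ < F.k) (h : CheckInv F u s₀ ℓ s) :
    Runs B checkBody (s.tick 4) (CheckInv F u s₀ (ℓ + 1)) := by
  obtain ⟨hS, hlev, hpos, htime, hans⟩ := h
  have hd := hS.holdsData hd₀
  have hq : s.arr .query (ℓ + 1) = letterAt u (ℓ + 1) := by
    rw [hS.arr _ (by simp), hq₀ _ (by omega) (by omega)]
  have hp1 : F.InArch ℓ (F.firstPosArch ℓ (letterAt u ℓ)) :=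
    F.inArch_firstPosArch h1 hk.le (huw _ (letterAt_mem h1 (by omega)))
  rw [List.drop_eq_letterAt_cons (by omega)] at hans
  have ha := huw _ (letterAt_mem (w := u) (i := ℓ + 1) (by omega) (by omega))
  generalize hfa : letterAt u (ℓ + 1) = a at *
  have haσ := (hw a).1 ha
  have hlast := hd.lastPosArch ℓ a h1 hk.le haσ.1 haσ.2
  have hfirst := hd.firstPosArch (ℓ + 1) a (by omega) (by omega) haσ.1 haσ.2
  have hc1 := F.cell_le hw h1 hk.le haσ.2
  have hc2 := F.cell_le hw (ℓ := ℓ + 1) (by omega) hk haσ.2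
  have hb1 := F.lastPosArch_le_length h1 hk.le ha
  have hb2 := F.firstPosArch_le_length (ℓ := ℓ + 1) (by omega) hk ha
  have hb3 := hp1.le_length
  have hkn := F.k_le_length
  rw [F.absentAfter_cons_iff h1 hk hp1 (by simp; omega)] at hans
  simp only [cell] at *
  simp only [Nat.add_sub_cancel] at hfirst hc2
  -- The word bound also applies to the results of comparisons.
  have hite : (if F.firstPosArch ℓ (letterAt u ℓ) < F.lastPosArch ℓ a then 1 else 0) ≤ B := by
    split_ifs <;> omega
  simp [checkBody, hlev, hq, hd.sigma, hlast, hpos, hfirst, hite]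
  refine ⟨by omega, by omega, by omega, fun hlt => ⟨by omega, by omega, ?_⟩,
    fun hle => ⟨by omega, by omega, ?_⟩⟩
  · refine ⟨hS.reg_congr (by simp) (by simp), by simp, by simp [hfa], by simp; omega, Or.inr ?_⟩
    rcases hans with h | h
    · simp [h.2, hlt]
    · simp [h.2]
  · refine ⟨hS.reg_congr (by simp) (by simp), by simp, by simp [hfa], by simp; omega, ?_⟩
    simpa [hfa, ha, hle] using hans

/-- At the last level avoidance of the rest must be tested as well, and this is membership of the
last position in `L'_k`. The proof goes through all branches of the program. -/
theorem checkLast_runs {σ B : ℕ} {w u : List ℕ} {F : ArchFactorization w} {s₀ s : RamState}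
    (hw : IsWordOver σ w) (hB : 10 * w.length ≤ B) (hd₀ : HoldsData σ w F s₀)
    (hq₀ : HoldsQuery u s₀) (hul : u.length = F.k + 1) (huw : ∀ a ∈ u, a ∈ w)
    (h : CheckInv F u s₀ F.k s) :
    Runs B checkLast (s.tick 4) fun s' => SameData s₀ s' ∧ s'.time ≤ s.time + 100 ∧
      (IsAbsent w u → s'.reg .ans = 1) ∧ (¬ IsAbsent w u → s'.reg .ans = 0) := by
  obtain ⟨hS, hlev, hpos, htime, hans⟩ := h
  have hd := hS.holdsData hd₀
  have h1 := F.k_pos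
  have hq : s.arr .query (F.k + 1) = letterAt u (F.k + 1) := by
    rw [hS.arr _ (by simp), hq₀ _ (by omega) (by omega)]
  have hp1 : F.InArch F.k (F.firstPosArch F.k (letterAt u F.k)) :=
    F.inArch_firstPosArch h1 le_rfl (huw _ (letterAt_mem h1 (by omega)))
  rw [List.drop_eq_letterAt_cons (by omega), List.drop_eq_nil_of_le (by omega)] at hans
  have ha := huw _ (letterAt_mem (w := u) (i := F.k + 1) (by omega) (by omega))
  generalize letterAt u (F.k + 1) = a at *
  have haσ := (hw a).1 ha
  have hlast := hd.lastPosArch F.k a h1 le_rfl haσ.1 haσ.2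
  have hLA := F.inArch_lastPosArch h1 le_rfl ha
  have hleq := hd.leq_length h1 le_rfl hLA
  have hc1 := F.cell_le hw h1 le_rfl haσ.2
  have hb1 := hLA.le_length
  have hb3 := hp1.le_length
  have hkn := F.k_le_length
  have hlen := F.length_lastUpTo_le F.k (F.lastPosArch F.k a)
  have hlen2 := F.length_sortedLast_le hw F.k
  rw [F.absentAfter_iff_mem_lastSet h1 le_rfl hp1 (by simp)] at hans
  have hmem : F.lastPosArch F.k a ∈ F.lastSet F.k ↔
      0 < (F.lastUpTo F.k (F.lastPosArch F.k a)).length ∧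
        letterAt (F.sortedLast F.k) (F.lastUpTo F.k (F.lastPosArch F.k a)).length =
          F.lastPosArch F.k a := by
    exact F.mem_lastSet_iff_letterAt
  have hsorted := hd.sortedLast F.k (F.lastUpTo F.k (F.lastPosArch F.k a)).length h1 le_rfl
  have hc3 := F.cell_le hw h1 le_rfl (hlen.trans hlen2)
  have hbt' := fun t => F.letterAt_sortedLast_le h1 le_rfl (t := t)
  simp only [hmem, ha, true_and, lt_irrefl, IsEmpty.forall_iff, and_true] at hans
  simp only [cell] at *
  generalize (F.lastUpTo F.k (F.lastPosArch F.k a)).length = t at *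
  have hite : (if F.firstPosArch F.k (letterAt u F.k) < F.lastPosArch F.k a then 1 else 0) ≤ B := by
    split_ifs <;> omega
  -- The stored value `0` stands for `-∞`: then no element of `L'_k` is as small as the tested
  -- position, and the query is rejected.
  have hz : t = 0 ∨ 1 ≤ t := by omega
  rcases hz with rfl | ht
  · have hna : ¬ IsAbsent w u := by
      rcases hans with h | h
      · simp [h.2]
      · exact h.2
    rcases lt_or_ge (F.firstPosArch F.k (letterAt u F.k)) (F.lastPosArch F.k a) with hc | hc
    · simp [checkLast, hq, hd.k, hd.sigma, hlast, hpos, hleq, hc, hna]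
      and_intros <;> first | omega | exact hS.reg_congr (by simp) (by simp)
    · simp [checkLast, hq, hd.k, hd.sigma, hlast, hpos, hleq, hc, hc.not_gt, hna]
      and_intros <;> first | omega | exact hS.reg_congr (by simp) (by simp)
  have hsorted' := hsorted ht hlen
  have ht0 : t ≠ 0 := by omega
  have hbt : letterAt (F.sortedLast F.k) t ≤ w.length := hbt' t ht hlen
  by_cases he : letterAt (F.sortedLast F.k) t = F.lastPosArch F.k a
  · rcases lt_or_ge (F.firstPosArch F.k (letterAt u F.k)) (F.lastPosArch F.k a) with hc | hc
    · have hna : ¬ IsAbsent w u := by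
        rcases hans with h | h
        · simp [h.2, hc]
        · exact h.2
      simp [checkLast, hq, hd.k, hd.sigma, hlast, hpos, hleq, hc, hna, hsorted', he, ht0]
      and_intros <;> first | omega | exact hS.reg_congr (by simp) (by simp)
    · have hans' : (IsAbsent w u → s.reg .ans = 1) ∧ (¬ IsAbsent w u → s.reg .ans = 0) := by
        rcases hans with h | h
        · simp [h.1, h.2, hc, he, Nat.pos_of_ne_zero ht0]
        · simp [h.1, h.2]
      simp [checkLast, hq, hd.k, hd.sigma, hlast, hpos, hleq, hc, hc.not_gt, hsorted', he, ht0]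
      and_intros <;> first | omega | exact hS.reg_congr (by simp) (by simp) | exact hans'.1 |
        exact hans'.2
  · have hna : ¬ IsAbsent w u := by
      rcases hans with h | h
      · simp [h.2, he]
      · exact h.2
    rcases lt_or_ge (F.firstPosArch F.k (letterAt u F.k)) (F.lastPosArch F.k a) with hc | hc
    · simp [checkLast, hq, hd.k, hd.sigma, hlast, hpos, hleq, hc, hna, hsorted', he, ht0]
      and_intros <;> first | omega | exact hS.reg_congr (by simp) (by simp)
    · simp [checkLast, hq, hd.k, hd.sigma, hlast, hpos, hleq, hc, hc.not_gt, hna, hsorted', he, ht0]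
      and_intros <;> first | omega | exact hS.reg_congr (by simp) (by simp)

theorem checkProg_runs {σ B : ℕ} {w u : List ℕ} {F : ArchFactorization w} {s : RamState}
    (hw : IsWordOver σ w) (hB : 10 * w.length ≤ B) (hd : HoldsData σ w F s)
    (hq : HoldsQuery u s) (hul : u.length = F.k + 1) (huw : ∀ a ∈ u, a ∈ w) (hs : s.Fresh) :
    Runs B checkProg s fun s' => HoldsData σ w F s' ∧ s'.time ≤ 1000 * F.k ∧
      (IsSAS w u → s'.reg .ans = 1) ∧ (¬ IsSAS w u → s'.reg .ans = 0) := by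
  have h1 := F.k_pos
  have hkn := F.k_le_length
  have ha := huw _ (letterAt_mem (w := u) (i := 1) (by omega) (by omega))
  have haσ := (hw _).1 ha
  have hq1 := hq 1 le_rfl (by omega)
  have hF := hd.firstPosArch 1 _ le_rfl h1 haσ.1 haσ.2
  have hc := F.cell_le hw le_rfl h1 haσ.2
  have hb := F.firstPosArch_le_length (ℓ := 1) le_rfl h1 ha
  simp only [cell, Nat.sub_self, Nat.zero_mul, Nat.zero_add] at hF hc
  simp [checkProg, hq1, hF]
  refine ⟨by omega, by omega, ?_⟩
  refine runs_while (fun m s' => ∃ ℓ, 1 ≤ ℓ ∧ ℓ + m = F.k ∧ CheckInv F u s ℓ s') ?_ ?_ ?_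
    (F.k - 1) _ ⟨1, le_rfl, by omega, ?_⟩
  · rintro m s' ⟨ℓ, h2, h3, hI⟩
    have hk := (hI.same.holdsData hd).k
    have : (if ℓ < F.k then 1 else 0) ≤ B := by split_ifs <;> omega
    simp [hI.level, hk, this]
    omega
  · rintro m s' ⟨ℓ, h2, h3, hI⟩
    exact (checkBody_runs hw hB hd hq hul huw h2 (by omega) hI).mono
      fun s' h => ⟨ℓ + 1, by omega, by omega, h⟩
  · rintro s' ⟨ℓ, h2, h3, hI⟩
    obtain rfl : ℓ = F.k := by omega
    refine (checkLast_runs hw hB hd hq hul huw hI).mono fun s'' h => ?_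
    obtain ⟨h4, h5, h6⟩ := h
    have := hI.time
    -- The additive constant is absorbed since `k ≥ 1`.
    refine ⟨h4.holdsData hd, by omega, ?_⟩
    simpa [F.isSAS_iff, hul] using h6
  · refine ⟨(SameData.refl s).reg_congr (by simp) (by simp), by simp, by simp,
      by simp [hs.1], Or.inl ⟨by simp, ?_⟩⟩
    have : u = letterAt u 1 :: u.drop 1 := List.drop_eq_letterAt_cons (L := u) (t := 0) (by omega)
    conv_lhs => rw [this, F.isAbsent_cons_iff, and_iff_right ha]

/-! ### Output of the smallest SAS in time `O(k)` -/

/-- The position of the next letter of the lexicographically smallest shortest absent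
subsequence. -/
abbrev lexNextE (ℓ : RamExpr) : RamExpr :=
  get .lex (cellE ℓ (get .leq (reg (.tmp 0))))

def lexBody : RamProg :=
  assign (.tmp 2) (get .word (lexNextE (reg (.tmp 1)))) ;;
  emit (reg (.tmp 2)) ;;
  assign (.tmp 1) (addE (reg (.tmp 1)) (const 1)) ;;
  assign (.tmp 0) (get .firstPosArch (cellE (reg (.tmp 1)) (reg (.tmp 2))))

/-- The program that outputs the lexicographically smallest shortest absent subsequence. -/
def lexMinProg : RamProg :=
  assign (.tmp 0) (reg .init) ;;
  assign (.tmp 1) (const 1) ;;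
  emit (get .word (reg (.tmp 0))) ;;
  RamProg.while (ltE (reg (.tmp 1)) (reg .k)) lexBody ;;
  emit (get .word (lexNextE (reg .k))) ;;
  endWord

/-- The first `ℓ` letters of `u` are written; the last of them is matched at position `p`. -/
structure LexInv {w : List ℕ} (F : ArchFactorization w) (u : List ℕ) (s₀ : RamState) (ℓ p : ℕ)
    (s : RamState) : Prop where
  same : SameData s₀ s
  level : s.reg (.tmp 1) = ℓ
  pos : s.reg (.tmp 0) = p
  inArch : F.InArch ℓ p
  nonempty : 0 < (F.lastUpTo ℓ p).length
  time : s.time ≤ 50 * ℓ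
  out : s.out = []
  cur : s.cur ++ F.lexAfter (F.k - ℓ + 1) p = u

theorem HoldsData.lexNext_spec {σ : ℕ} {w : List ℕ} {F : ArchFactorization w} {s : RamState}
    {ℓ p : ℕ} (hw : IsWordOver σ w) (hd : HoldsData σ w F s)
    (h1 : 1 ≤ ℓ) (hk : ℓ ≤ F.k) (hp : F.InArch ℓ p) (hne : 0 < (F.lastUpTo ℓ p).length) :
    ∃ t, s.arr .leq p = t ∧ s.arr .lex ((ℓ - 1) * σ + t) = F.lexNext ℓ p ∧ t ≤ σ ∧
      (ℓ - 1) * σ + σ ≤ w.length ∧ F.lexNext ℓ p ∈ F.lastUpTo ℓ p ∧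
      1 ≤ F.lexNext ℓ p ∧ F.lexNext ℓ p ≤ w.length := by
  have hL := (F.lexNext_spec hne).1
  have hA := F.inArch_of_mem_lastSet h1 hk (F.mem_lastUpTo.1 hL).1
  exact ⟨_, hd.leq_length h1 hk hp, hd.lex_leq h1 hk hne,
    (F.length_lastUpTo_le ℓ p).trans (F.length_sortedLast_le hw ℓ),
    (F.cell_le hw h1 hk le_rfl).2.2, hL, hA.pos, hA.le_length⟩

/-- The letters written so far, followed by the greedy completion, always make up `u`; an iteration
moves one letter from the second part to the first. The `nonempty` field keeps `Leq` from being
`-∞`, so that `Lex` is read at a valid index. -/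
theorem lexBody_runs {σ B : ℕ} {w u : List ℕ} {F : ArchFactorization w} {s₀ s : RamState} {ℓ p : ℕ}
    (hw : IsWordOver σ w) (hB : 10 * w.length ≤ B) (hd₀ : HoldsData σ w F s₀)
    (h1 : 1 ≤ ℓ) (hk : ℓ < F.k) (h : LexInv F u s₀ ℓ p s) :
    Runs B lexBody (s.tick 4) fun s' => ∃ p', LexInv F u s₀ (ℓ + 1) p' s' := by
  obtain ⟨hS, hlev, hpos, hA, hne, htime, hout, hcur⟩ := h
  have hd := hS.holdsData hd₀
  have hkn := F.k_le_length
  obtain ⟨t, hleq, hlex, ht, hc, hm, hj1, hj2⟩ := hd.lexNext_spec hw h1 hk.le hA hne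
  have hpn := hA.le_length
  have hword := hd.word _ hj1 hj2
  have ha := letterAt_mem hj1 hj2
  obtain ⟨hN1, hN2⟩ := F.lastSet_next_spec h1 hk (F.mem_lastUpTo.1 hm).1
  have hlx : F.lexAfter (F.k - ℓ + 1) p = letterAt w (F.lexNext ℓ p) ::
      F.lexAfter (F.k - (ℓ + 1) + 1)
        (F.firstPosArch (ℓ + 1) (letterAt w (F.lexNext ℓ p))) := by
    rw [ArchFactorization.lexAfter, show F.k - (F.k - ℓ) = ℓ by omega,
      show F.k - (ℓ + 1) + 1 = F.k - ℓ by omega]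
  rw [hlx] at hcur
  generalize letterAt w (F.lexNext ℓ p) = a at *
  have haσ := (hw a).1 ha
  have hfirst := hd.firstPosArch (ℓ + 1) a (by omega) (by omega) haσ.1 haσ.2
  have hc2 := F.cell_le hw (ℓ := ℓ + 1) (by omega) hk haσ.2
  have hb2 := hN1.le_length
  simp only [cell, Nat.add_sub_cancel] at hfirst hc2
  simp [lexBody, hlev, hpos, hleq, hlex, hword, hd.sigma, hfirst]
  refine ⟨by omega, by omega, by omega, by omega, _, hS.reg_congr (by simp) (by simp), by simp,
    by simp, hN1, hN2, by simp; omega, by simp [hout], by simpa using hcur⟩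

theorem lexMinProg_runs {σ B : ℕ} {w : List ℕ} {F : ArchFactorization w} {s : RamState}
    (hw : IsWordOver σ w) (hB : 10 * w.length ≤ B) (hd : HoldsData σ w F s) (hs : s.Fresh) :
    Runs B lexMinProg s fun s' => HoldsData σ w F s' ∧ s'.time ≤ 1000 * F.k ∧ s'.cur = [] ∧
      ∃ t, s'.out = [(letterAt w F.init :: F.lexAfter F.k F.init, t)] := by
  have h1 := F.k_pos
  have hkn := F.k_le_length
  have hi : F.init ∈ F.startSAS := (List.argmin_getD_spec (letterAt w) F.startSAS_ne_nil).1
  obtain ⟨hA, -, hne⟩ := F.startSAS_spec hi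
  have hword := hd.word _ hA.pos hA.le_length
  have hb := hA.le_length
  have hbw := (hw _).1 (letterAt_mem hA.pos hA.le_length)
  have hc := F.cell_le hw le_rfl h1 (le_refl σ)
  simp [lexMinProg, hd.init, hword]
  refine ⟨by omega, by omega, by omega, ?_⟩
  refine runs_while (fun m s' => ∃ ℓ, 1 ≤ ℓ ∧ ℓ + m = F.k ∧
    ∃ p, LexInv F (letterAt w F.init :: F.lexAfter F.k F.init) s ℓ p s') ?_ ?_ ?_
    (F.k - 1) _ ⟨1, le_rfl, by omega, F.init, ?_⟩
  · rintro m s' ⟨ℓ, h2, h3, p, hI⟩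
    have hk := (hI.same.holdsData hd).k
    have : (if ℓ < F.k then 1 else 0) ≤ B := by split_ifs <;> omega
    simp [hI.level, hk, this]
    omega
  · rintro m s' ⟨ℓ, h2, h3, p, hI⟩
    exact (lexBody_runs hw hB hd h2 (by omega) hI).mono
      fun s' h => ⟨ℓ + 1, by omega, by omega, h⟩
  · rintro s' ⟨ℓ, h2, h3, p, hI⟩
    obtain rfl : ℓ = F.k := by omega
    obtain ⟨hS, hlev, hpos, hA', hne', htime, hout, hcur⟩ := hI
    have hd' := hS.holdsData hd
    have hpn := hA'.le_length
    obtain ⟨t, hleq, hlex, ht, hc, hm, hj1, hj2⟩ := hd'.lexNext_spec hw h1 le_rfl hA' hne'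
    have hword := hd'.word _ hj1 hj2
    have ha := (hw _).1 (letterAt_mem hj1 hj2)
    simp only [ArchFactorization.lexAfter, Nat.sub_self, Nat.sub_zero] at hcur
    simp [hd'.k, hd'.sigma, hpos, hleq, hlex, hword, hout, hcur]
    exact ⟨by omega, (hS.reg_congr (by simp) (by simp)).holdsData hd, by omega⟩
  · refine ⟨(SameData.refl s).reg_congr (by simp) (by simp), by simp, by simp, hA, hne,
      by simp [hs.1], by simp [hs.2.2], ?_⟩
    simp [hs.2.1, show F.k - 1 + 1 = F.k by omega]

/-! ### Enumeration by depth-first search -/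

/-- The stack of the enumeration: the number of the choice made at each level, the number of
choices, and the letter chosen. -/
abbrev choiceArr : ArrName := .tmp 0

abbrev choiceCount : ArrName := .tmp 1

abbrev chosenLetter : ArrName := .tmp 2

/-- Move on to the next choice at the current level. -/
def enumSelect : RamProg :=
  store choiceArr (reg (.tmp 0)) (addE (get choiceArr (reg (.tmp 0))) (const 1)) ;;
  ite (eqE (reg (.tmp 0)) (const 1))
    (assign (.tmp 1) (get .startSAS (get choiceArr (reg (.tmp 0)))))
    (assign (.tmp 1) (get .sortedLast (cellE (subE (reg (.tmp 0)) (const 1))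
      (get choiceArr (reg (.tmp 0)))))) ;;
  store chosenLetter (reg (.tmp 0)) (get .word (reg (.tmp 1)))

/-- Output the word of chosen letters. -/
def enumOutput : RamProg :=
  assign (.tmp 2) (const 0) ;;
  RamProg.while (ltE (reg (.tmp 2)) (addE (reg .k) (const 1)))
    (assign (.tmp 2) (addE (reg (.tmp 2)) (const 1)) ;;
     emit (get chosenLetter (reg (.tmp 2)))) ;;
  endWord

/-- Go to the next level. -/
def enumPush : RamProg :=
  assign (.tmp 2) (get .leq (get .firstPosArch
    (cellE (reg (.tmp 0)) (get chosenLetter (reg (.tmp 0)))))) ;;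
  assign (.tmp 0) (addE (reg (.tmp 0)) (const 1)) ;;
  store choiceCount (reg (.tmp 0)) (reg (.tmp 2)) ;;
  store choiceArr (reg (.tmp 0)) (const 0)

/-- Descent, output and backtracking share one loop. Leaving level `1` produces level `0`, on which
the loop stops. -/
def enumBody : RamProg :=
  ite (ltE (get choiceArr (reg (.tmp 0))) (get choiceCount (reg (.tmp 0))))
    (enumSelect ;; ite (ltE (reg .k) (reg (.tmp 0))) enumOutput enumPush)
    (assign (.tmp 0) (subE (reg (.tmp 0)) (const 1)))

/-- The program that outputs all shortest absent subsequences. -/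
def enumProg : RamProg :=
  assign (.tmp 0) (const 1) ;;
  store choiceCount (const 1) (reg .startLen) ;;
  store choiceArr (const 1) (const 0) ;;
  RamProg.while (reg (.tmp 0)) enumBody

/-- Some iterations of the loop `while e p` lead from one state to the other. -/
def LoopSteps (B : ℕ) (e : RamExpr) (p : RamProg) : RamState → RamState → Prop :=
  Relation.ReflTransGen fun s s' =>
    e.Fits B s ∧ e.eval s ≠ 0 ∧ Exec B p (s.tick (e.cost + 1)) s'

/-- The iterations follow the shape of the tree, so runs of the loop body are composed recursively
instead of being counted beforehand. -/
theorem LoopSteps.runs_while {B : ℕ} {e : RamExpr} {p : RamProg} {s s' : RamState}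
    {Q : RamState → Prop} (h : LoopSteps B e p s s') (hf : e.Fits B s') (he : e.eval s' = 0)
    (hQ : Q (s'.tick (e.cost + 1))) : Runs B (.while e p) s Q := by
  refine ⟨_, ?_, hQ⟩
  induction h using Relation.ReflTransGen.head_induction_on with
  | refl => exact .while_false _ _ _ hf he
  | head h _ ih => exact .while_true _ _ _ _ _ h.1 h.2.1 h.2.2 ih

/-- The times of the outputs so far differ by at most `D`, and at most `X` steps have passed since
the last output. -/
def OnTime (D X : ℕ) (s : RamState) : Prop :=
  List.IsChain (fun t t' => t' ≤ t + D) (0 :: s.out.map Prod.snd) ∧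
    ∀ t ∈ (0 :: s.out.map Prod.snd).getLast?, s.time ≤ t + X

theorem OnTime.step {D X Y : ℕ} {s s' : RamState} (h : OnTime D X s) (ho : s'.out = s.out)
    (ht : s'.time + X ≤ s.time + Y) : OnTime D Y s' := by
  refine ⟨ho ▸ h.1, fun t htm => ?_⟩
  have := h.2 t (ho ▸ htm)
  omega

/-- The waiting time `X + c` is charged to the gap that ends here. The output happens at the current
time, so any allowance `Y` holds afterwards. -/
theorem OnTime.output {D X Y c : ℕ} {s s' : RamState} {u : List ℕ} (h : OnTime D X s)
    (ho : s'.out = s.out ++ [(u, s'.time)]) (ht : s'.time ≤ s.time + c) (hD : X + c ≤ D) :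
    OnTime D Y s' := by
  have hl : (0 :: s'.out.map Prod.snd) = (0 :: s.out.map Prod.snd) ++ [s'.time] := by simp [ho]
  rw [OnTime, hl]
  constructor
  · rw [List.isChain_append]
    refine ⟨h.1, by simp, ?_⟩
    intro x hx y hy
    have := h.2 x hx
    simp only [List.head?_cons, Option.mem_def, Option.some.injEq] at hy
    omega
  · intro t ht
    simp only [List.getLast?_append, List.getLast?_singleton, Option.some_or, Option.mem_def,
      Option.some.injEq] at ht
    omega

theorem OnTime.delayAtMost {D X : ℕ} {s : RamState} (h : OnTime D X s) (hX : X ≤ D) :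
    DelayAtMost D s := by
  rw [DelayAtMost, List.isChain_append]
  refine ⟨h.1, by simp, ?_⟩
  intro x hx y hy
  have := h.2 x hx
  simp only [List.head?_cons, Option.mem_def, Option.some.injEq] at hy
  omega

namespace ArchFactorization

variable {w : List ℕ} (F : ArchFactorization w)

/-- `c` is a list of choices for the `ℓ`-th letter of a shortest absent subsequence. -/
def IsChoiceList (ℓ : ℕ) (c : List ℕ) : Prop :=
  ℓ = 1 ∧ c = F.startSAS ∨
    ∃ m p, ℓ = m + 1 ∧ 1 ≤ m ∧ m ≤ F.k ∧ F.InArch m p ∧ c = F.lastUpTo m p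

/-- The completions whose `ℓ`-th letter is at one of the positions `c`. -/
noncomputable def wordsFrom (ℓ : ℕ) (c : List ℕ) : List (List ℕ) :=
  c.flatMap fun j =>
    (F.sasAfter (F.k + 1 - ℓ) (F.firstPosArch ℓ (letterAt w j))).map (letterAt w j :: ·)

variable {F}

theorem wordsFrom_one : F.wordsFrom 1 F.startSAS = F.sasList := by
  rw [wordsFrom, sasList, Nat.add_sub_cancel]
  refine List.flatMap_congr fun i hi => ?_
  rw [(startSAS_spec hi).2.1]

theorem wordsFrom_lastUpTo {ℓ p : ℕ} (h1 : 1 ≤ ℓ) (hk : ℓ ≤ F.k) :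
    F.wordsFrom (ℓ + 1) (F.lastUpTo ℓ p) = F.sasAfter (F.k + 1 - ℓ) p := by
  rw [wordsFrom, show F.k + 1 - ℓ = (F.k - ℓ) + 1 by omega, sasAfter,
    show F.k - (F.k - ℓ) = ℓ by omega, show F.k + 1 - (ℓ + 1) = F.k - ℓ by omega]

/-- Every choice leads to a nonempty list of choices on the next level. The bound on the delay rests
on this. -/
theorem IsChoiceList.mem {ℓ j : ℕ} {c : List ℕ} (h : F.IsChoiceList ℓ c) (hj : j ∈ c) :
    (1 ≤ j ∧ j ≤ w.length) ∧
      (ℓ ≤ F.k → F.InArch ℓ (F.firstPosArch ℓ (letterAt w j)) ∧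
        0 < (F.lastUpTo ℓ (F.firstPosArch ℓ (letterAt w j))).length) := by
  rcases h with ⟨rfl, rfl⟩ | ⟨m, p, rfl, h1, hk, hp, rfl⟩
  · obtain ⟨h1, h2, h3⟩ := startSAS_spec hj
    rw [h2]
    exact ⟨⟨h1.pos, h1.le_length⟩, fun _ => ⟨h1, h3⟩⟩
  · have hm := (F.mem_lastUpTo.1 hj).1
    have hA := inArch_of_mem_lastSet h1 hk hm
    exact ⟨⟨hA.pos, hA.le_length⟩, fun h => lastSet_next_spec h1 h hm⟩

theorem IsChoiceList.length_le {σ ℓ : ℕ} {c : List ℕ} (hw : IsWordOver σ w)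
    (h : F.IsChoiceList ℓ c) : c.length ≤ σ := by
  rcases h with ⟨rfl, rfl⟩ | ⟨m, p, rfl, h1, hk, hp, rfl⟩
  · exact length_startSAS_le hw
  · exact (F.length_lastUpTo_le m p).trans (length_sortedLast_le hw m)

end ArchFactorization

/-- The enumeration is at level `ℓ`, after `i` of the choices `c`, with the letters `pre` on the
lower levels. -/
structure EnumInv {w : List ℕ} (F : ArchFactorization w) (s₀ : RamState) (ℓ : ℕ) (pre : List ℕ)
    (i : ℕ) (c : List ℕ) (s : RamState) : Prop where
  same : SameData s₀ s
  level : s.reg (.tmp 0) = ℓ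
  choice : s.arr choiceArr ℓ = i
  count : s.arr choiceCount ℓ = c.length
  letters : ∀ j, 1 ≤ j → j ≤ pre.length → s.arr chosenLetter j = letterAt pre j
  cur : s.cur = []

theorem letterAt_take {L : List ℕ} {t c : ℕ} (h1 : 1 ≤ t) (h2 : t ≤ c) :
    letterAt (L.take c) t = letterAt L t := by
  simp [letterAt, show t - 1 < c by omega]

theorem enumSelect_runs {σ B ℓ i : ℕ} {w pre c : List ℕ} {F : ArchFactorization w}
    {s₀ s : RamState} (hw : IsWordOver σ w) (hB : 10 * w.length ≤ B) (hd₀ : HoldsData σ w F s₀)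
    (h1 : 1 ≤ ℓ) (hk : ℓ ≤ F.k + 1) (hc : F.IsChoiceList ℓ c) (hi : i < c.length)
    (h : EnumInv F s₀ ℓ pre i c s) :
    Runs B enumSelect s fun s' => SameData s₀ s' ∧ s'.reg (.tmp 0) = ℓ ∧
      s'.arr choiceArr = Function.update (s.arr choiceArr) ℓ (i + 1) ∧
      s'.arr choiceCount = s.arr choiceCount ∧
      s'.arr chosenLetter =
        Function.update (s.arr chosenLetter) ℓ (letterAt w (letterAt c (i + 1))) ∧
      s'.cur = [] ∧ s'.out = s.out ∧ s'.time ≤ s.time + 40 := by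
  obtain ⟨hS, hlev, hch, hct, hlet, hcur⟩ := h
  have hd := hS.holdsData hd₀
  have hcσ := hc.length_le hw
  have hkn := F.k_le_length
  have hj : letterAt c (i + 1) ∈ c := letterAt_mem (by omega) (by omega)
  have hjn := (hc.mem hj).1
  have hword := hd.word _ hjn.1 hjn.2
  have hwσ := (hw _).1 (letterAt_mem hjn.1 hjn.2)
  have hσ := (F.cell_le hw le_rfl F.k_pos (le_refl σ)).1
  rcases hc with ⟨rfl, rfl⟩ | ⟨m, p, rfl, hm1, hmk, hp, rfl⟩
  · have hst := hd.startSAS (i + 1) (by omega) (by omega)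
    simp [enumSelect, hlev, hch, hst, hword]
    and_intros <;> first | omega | skip
    exact hS.reg_congr (by simp) (fun A hA => by simp [hA])
  · have hlen := F.length_lastUpTo_le m p
    have hst := hd.sortedLast m (i + 1) hm1 hmk (by omega) (by omega)
    -- The choices are a prefix of the row `sortedLast[m]`, so the stack stores only their number
    -- and the entries are read from the table.
    rw [← letterAt_take (c := (F.lastUpTo m p).length) (by omega) (by omega),
      ← F.lastUpTo_eq_take] at hst
    have hcell := F.cell_le hw hm1 hmk (t := i + 1) (by omega)
    have hm0 : m ≠ 0 := by omega
    simp only [cell] at hst hcell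
    simp [enumSelect, hlev, hch, hd.sigma, hst, hword, hm0]
    and_intros <;> first | omega | skip
    exact hS.reg_congr (by simp) (fun A hA => by simp [hA])

theorem enumOutput_runs {σ B : ℕ} {w v : List ℕ} {F : ArchFactorization w}
    {s : RamState} (hw : IsWordOver σ w) (hB : 10 * w.length ≤ B) (hd : HoldsData σ w F s)
    (hv : v.length = F.k + 1) (hvw : ∀ a ∈ v, a ∈ w)
    (hlet : ∀ j, 1 ≤ j → j ≤ F.k + 1 → s.arr chosenLetter j = letterAt v j) (hcur : s.cur = []) :
    Runs B enumOutput s fun s' => SameData s s' ∧ s'.reg (.tmp 0) = s.reg (.tmp 0) ∧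
      s'.arr = s.arr ∧ s'.cur = [] ∧ s'.out = s.out ++ [(v, s'.time)] ∧
      s'.time ≤ s.time + 20 * (F.k + 2) := by
  have h1 := F.k_pos
  have hkn := F.k_le_length
  simp [enumOutput]
  refine runs_while (fun m s' => ∃ j, j + m = F.k + 1 ∧ SameData s s' ∧
    s'.reg (.tmp 0) = s.reg (.tmp 0) ∧ s'.reg (.tmp 2) = j ∧ s'.arr = s.arr ∧ s'.out = s.out ∧
    s'.cur = v.take j ∧ s'.time ≤ s.time + 2 + 20 * j) ?_ ?_ ?_
    (F.k + 1) _ ⟨0, by omega, (SameData.refl s).reg_congr (by simp) (by simp), by simp, by simp,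
      rfl, rfl, by simp [hcur], by simp⟩
  · rintro m s' ⟨j, hj, hS, h2, h3, h4, h5, h6, h7⟩
    have : (if j ≤ F.k then 1 else 0) ≤ B := by split_ifs <;> omega
    simp [h3, (hS.holdsData hd).k, this]
    omega
  · rintro m s' ⟨j, hj, hS, h2, h3, h4, h5, h6, h7⟩
    have ha := (hw _).1 (hvw _ (letterAt_mem (w := v) (i := j + 1) (by omega) (by omega)))
    have hσ := (F.cell_le hw le_rfl F.k_pos (le_refl σ)).1
    simp [h3, h4, hlet (j + 1) (by omega) (by omega)]
    refine ⟨by omega, by omega, by omega, hS.reg_congr (by simp) (by simp [h4]), h2, h5, ?_,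
      by omega⟩
    rw [List.take_succ_eq_concat_letterAt (by omega), h6]
  · rintro s' ⟨j, hj, hS, h2, h3, h4, h5, h6, h7⟩
    obtain rfl : j = F.k + 1 := by omega
    rw [List.take_of_length_le (by omega)] at h6
    simp [h2, h4, h5, h6]
    exact ⟨hS.reg_congr (by simp) (by simp [h4]), by omega⟩

theorem enumPush_runs {σ B ℓ a : ℕ} {w : List ℕ} {F : ArchFactorization w}
    {s : RamState} (hw : IsWordOver σ w) (hB : 10 * w.length ≤ B) (hd : HoldsData σ w F s)
    (h1 : 1 ≤ ℓ) (hk : ℓ ≤ F.k) (hlev : s.reg (.tmp 0) = ℓ) (ha : s.arr chosenLetter ℓ = a)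
    (haw : a ∈ w) :
    Runs B enumPush s fun s' => SameData s s' ∧ s'.reg (.tmp 0) = ℓ + 1 ∧
      s'.arr choiceArr = Function.update (s.arr choiceArr) (ℓ + 1) 0 ∧
      s'.arr choiceCount = Function.update (s.arr choiceCount) (ℓ + 1)
        (F.lastUpTo ℓ (F.firstPosArch ℓ a)).length ∧
      s'.arr chosenLetter = s.arr chosenLetter ∧
      s'.cur = s.cur ∧ s'.out = s.out ∧ s'.time ≤ s.time + 40 := by
  have haσ := (hw a).1 haw
  have hF := hd.firstPosArch ℓ a h1 hk haσ.1 haσ.2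
  have hA := F.inArch_firstPosArch h1 hk haw
  have hleq := hd.leq_length h1 hk hA
  have hb := hA.le_length
  have hlen := (F.length_lastUpTo_le ℓ (F.firstPosArch ℓ a)).trans (F.length_sortedLast_le hw ℓ)
  have hcell := F.cell_le hw h1 hk haσ.2
  have hkn := F.k_le_length
  simp only [cell] at hF hcell
  simp [enumPush, hlev, ha, hd.sigma, hF, hleq]
  and_intros <;> first | omega | skip
  exact (SameData.refl s).reg_congr (by simp) (fun A hA => by simp [hA])

theorem EnumInv.tick {w pre c : List ℕ} {F : ArchFactorization w} {s₀ s : RamState} {ℓ i : ℕ}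
    (h : EnumInv F s₀ ℓ pre i c s) (t : ℕ) : EnumInv F s₀ ℓ pre i c (s.tick t) :=
  ⟨h.same.reg_congr (by simp) (by simp), h.level, h.choice, h.count, h.letters, h.cur⟩

/-- The stack of the enumeration is the same on the levels below `ℓ`. -/
def SameBelow (ℓ : ℕ) (s s' : RamState) : Prop :=
  ∀ j < ℓ, s'.arr choiceArr j = s.arr choiceArr j ∧ s'.arr choiceCount j = s.arr choiceCount j ∧
    s'.arr chosenLetter j = s.arr chosenLetter j

theorem SameBelow.trans {ℓ : ℕ} {s s' s'' : RamState} (h : SameBelow ℓ s s')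
    (h' : SameBelow ℓ s' s'') : SameBelow ℓ s s'' := fun j hj =>
  ⟨(h' j hj).1.trans (h j hj).1, (h' j hj).2.1.trans (h j hj).2.1,
    (h' j hj).2.2.trans (h j hj).2.2⟩

theorem SameBelow.mono {ℓ m : ℕ} {s s' : RamState} (h : SameBelow m s s') (hm : ℓ ≤ m) :
    SameBelow ℓ s s' := fun j hj => h j (by omega)

section

variable {σ B ℓ i : ℕ} {w pre c : List ℕ} {F : ArchFactorization w} {s₀ s : RamState}

theorem enumBody_exhausted_runs (hw : IsWordOver σ w) (hB : 10 * w.length ≤ B)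
    (hk : ℓ ≤ F.k + 1) (hc : F.IsChoiceList ℓ c) (hi : i = c.length)
    (h : EnumInv F s₀ ℓ pre i c s) :
    Runs B enumBody (s.tick 2) fun s' => SameData s₀ s' ∧ s'.reg (.tmp 0) = ℓ - 1 ∧
      s'.arr = s.arr ∧ s'.cur = [] ∧ s'.out = s.out ∧ s'.time ≤ s.time + 40 := by
  obtain ⟨hS, hlev, hch, hct, hlet, hcur⟩ := h
  have hcσ := hc.length_le hw
  have hkn := F.k_le_length
  have hk1 := F.k_pos
  have hσ := (F.cell_le hw le_rfl F.k_pos (le_refl σ)).1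
  simp [enumBody, hlev, hch, hct, hi]
  and_intros <;> first | omega | skip
  exact hS.reg_congr (by simp) (by simp)

theorem enumBody_select_runs (hw : IsWordOver σ w) (hB : 10 * w.length ≤ B)
    (hd₀ : HoldsData σ w F s₀) (h1 : 1 ≤ ℓ)
    (hk : ℓ ≤ F.k + 1) (hc : F.IsChoiceList ℓ c) (hi : i < c.length)
    (h : EnumInv F s₀ ℓ pre i c s) {Q : RamState → Prop}
    (hQ : ∀ s₁, SameData s₀ s₁ → s₁.reg (.tmp 0) = ℓ →
      s₁.arr choiceArr = Function.update (s.arr choiceArr) ℓ (i + 1) →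
      s₁.arr choiceCount = s.arr choiceCount →
      s₁.arr chosenLetter =
        Function.update (s.arr chosenLetter) ℓ (letterAt w (letterAt c (i + 1))) →
      s₁.cur = [] → s₁.out = s.out → s₁.time ≤ s.time + 60 →
      Runs B (if F.k < ℓ then enumOutput else enumPush) s₁ Q) :
    Runs B enumBody (s.tick 2) Q := by
  have hcσ := hc.length_le hw
  have hkn := F.k_le_length
  have hk1 := F.k_pos
  have hσ := (F.cell_le hw le_rfl F.k_pos (le_refl σ)).1
  simp only [enumBody, runs_ite, runs_seq, RamExpr.cost]
  refine ⟨?_, fun _ => ?_, fun hf => ?_⟩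
  · simp [h.level, h.choice, h.count, hi]
    omega
  · refine (enumSelect_runs hw hB hd₀ h1 hk hc hi ((h.tick 2).tick 6)).mono ?_
    rintro s₁ ⟨g1, g2, g3, g4, g5, g6, g7, g8⟩
    have hk' := (g1.holdsData hd₀).k
    have hg := fun hS' => hQ (s₁.tick 4) (g1.reg_congr (by simp) (by simp)) g2 g3 g4 g5 g6 g7 hS'
    have hg := hg (by simp at g8 ⊢; omega)
    by_cases hlt : F.k < ℓ
    · simp only [hlt, if_true] at hg
      simp [hk', g2, hlt]
      exact ⟨by omega, hg⟩
    · simp only [hlt, if_false] at hg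
      simp [hk', g2, hlt]
      exact ⟨by omega, hg⟩
  · simp [h.level, h.choice, h.count, hi] at hf

theorem exists_loopStep {e : RamExpr} {p : RamProg} {Q : RamState → Prop} (hf : e.Fits B s)
    (he : e.eval s ≠ 0) (h : Runs B p (s.tick (e.cost + 1)) Q) :
    ∃ s', LoopSteps B e p s s' ∧ Q s' := by
  obtain ⟨s', h1, h2⟩ := h
  exact ⟨s', .single ⟨hf, he, h1⟩, h2⟩

theorem letterAt_append_singleton {pre : List ℕ} {a j : ℕ} (h1 : 1 ≤ j)
    (h2 : j ≤ pre.length + 1) :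
    letterAt (pre ++ [a]) j = if j ≤ pre.length then letterAt pre j else a := by
  split_ifs with h
  · exact letterAt_append_left h1 h
  · obtain rfl : j = pre.length + 1 := by omega
    exact letterAt_concat_length _ _

/-- The number of steps between two outputs of the enumeration. -/
abbrev enumDelay (n : ℕ) : ℕ := 1000 * n + 1000

/-- The enumeration treats the next choice at level `ℓ`. -/
def EnumNext (B : ℕ) {w : List ℕ} (F : ArchFactorization w) (s₀ : RamState) (ℓ : ℕ) (pre : List ℕ)
    (i : ℕ) (c : List ℕ) (s : RamState) : Prop :=
  ∃ s', LoopSteps B (reg (.tmp 0)) enumBody s s' ∧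
    EnumInv F s₀ ℓ pre (i + 1) c s' ∧ SameBelow ℓ s s' ∧
    s'.out.map Prod.fst = s.out.map Prod.fst ++
      (F.wordsFrom ℓ [letterAt c (i + 1)]).map (pre ++ ·) ∧
    OnTime (enumDelay w.length) (100 * (F.k + 2 - ℓ)) s'

/-- The enumeration treats all remaining choices at level `ℓ`. -/
def EnumLevel (B : ℕ) {w : List ℕ} (F : ArchFactorization w) (s₀ : RamState) (ℓ : ℕ)
    (pre : List ℕ) (i : ℕ) (c : List ℕ) (s : RamState) : Prop :=
  ∃ s', LoopSteps B (reg (.tmp 0)) enumBody s s' ∧ SameData s₀ s' ∧ s'.reg (.tmp 0) = ℓ - 1 ∧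
    s'.cur = [] ∧ SameBelow ℓ s s' ∧
    s'.out.map Prod.fst = s.out.map Prod.fst ++ (F.wordsFrom ℓ (c.drop i)).map (pre ++ ·) ∧
    OnTime (enumDelay w.length) (100 * (F.k + 3 - ℓ)) s'

/-- The allowances form a potential of `100` per level. Before the first output below a node they
grow by `100` with each push, up to `100 * (k + 2 + ℓ)`; after an output they grow with each pop,
which gives `100 * (k + 2 - ℓ)` on return to level `ℓ`. -/
theorem enumLevel_of_enumNext (hw : IsWordOver σ w) (hB : 10 * w.length ≤ B)
    (h1 : 1 ≤ ℓ) (hk : ℓ ≤ F.k + 1) (hc : F.IsChoiceList ℓ c) (hne : 0 < c.length)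
    (hnext : ∀ i s, i < c.length → EnumInv F s₀ ℓ pre i c s →
      OnTime (enumDelay w.length) (100 * (F.k + 2 + ℓ)) s → EnumNext B F s₀ ℓ pre i c s)
    (hi : i ≤ c.length) (h : EnumInv F s₀ ℓ pre i c s)
    (ht : OnTime (enumDelay w.length)
      (if i = 0 then 100 * (F.k + 2 + ℓ) else 100 * (F.k + 2 - ℓ)) s) :
    EnumLevel B F s₀ ℓ pre i c s := by
  have hkn := F.k_le_length
  have hk1 := F.k_pos
  induction hr : c.length - i generalizing i s with
  | zero =>
    obtain rfl : i = c.length := by omega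
    obtain ⟨s', g0, g1, g2, g3, g4, g5, g6⟩ :=
      exists_loopStep (e := reg (.tmp 0)) (by simp [h.level]; omega) (by simp [h.level]; omega)
        (enumBody_exhausted_runs hw hB hk hc rfl h)
    refine ⟨s', g0, g1, g2, g4, fun j _ => by simp [g3], by simp [g5, ArchFactorization.wordsFrom],
      ?_⟩
    -- The list of choices is nonempty, so an exhausted level has already produced output and the
    -- smaller allowance applies.
    rw [if_neg (by omega)] at ht
    exact ht.step g5 (by omega)
  | succ r ihr =>
    have hX : (if i = 0 then 100 * (F.k + 2 + ℓ) else 100 * (F.k + 2 - ℓ)) ≤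
        100 * (F.k + 2 + ℓ) := by split_ifs <;> omega
    obtain ⟨s₂, g1, g2, g3, g4, g5⟩ := hnext i s (by omega) h (ht.step rfl (by omega))
    obtain ⟨s', k1, k2, k3, k4, k5, k6, k7⟩ := ihr (by omega) g2 (by simpa using g5) (by omega)
    refine ⟨s', g1.trans k1, k2, k3, k4, g3.trans k5, ?_, k7⟩
    rw [k6, g4, List.drop_eq_letterAt_cons (by omega : i < c.length)]
    simp [ArchFactorization.wordsFrom]

theorem enumNext_last (hw : IsWordOver σ w) (hB : 10 * w.length ≤ B)
    (hd₀ : HoldsData σ w F s₀) (hc : F.IsChoiceList (F.k + 1) c) (hpre : pre.length = F.k)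
    (hprew : ∀ a ∈ pre, a ∈ w) (hi : i < c.length) (h : EnumInv F s₀ (F.k + 1) pre i c s)
    (ht : OnTime (enumDelay w.length) (100 * (F.k + 2 + (F.k + 1))) s) :
    EnumNext B F s₀ (F.k + 1) pre i c s := by
  have hkn := F.k_le_length
  have hk1 := F.k_pos
  have hj : letterAt c (i + 1) ∈ c := letterAt_mem (by omega) (by omega)
  obtain ⟨hjn, -⟩ := hc.mem hj
  have haw := letterAt_mem hjn.1 hjn.2
  have hwf : F.wordsFrom (F.k + 1) [letterAt c (i + 1)] = [[letterAt w (letterAt c (i + 1))]] := by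
    simp [ArchFactorization.wordsFrom, ArchFactorization.sasAfter]
  rw [EnumNext, hwf]
  have hrun : Runs B enumBody (s.tick 2) fun s' => EnumInv F s₀ (F.k + 1) pre (i + 1) c s' ∧
      SameBelow (F.k + 1) s s' ∧
      s'.out = s.out ++ [(pre ++ [letterAt w (letterAt c (i + 1))], s'.time)] ∧
      s'.time ≤ s.time + (100 + 20 * F.k) := by
    refine enumBody_select_runs hw hB hd₀ (by omega) le_rfl hc hi h ?_
    intro s₁ g1 g2 g3 g4 g5 g6 g7 g8
    rw [if_pos (by omega)]
    refine (enumOutput_runs (v := pre ++ [letterAt w (letterAt c (i + 1))]) hw hB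
      (g1.holdsData hd₀) (by simp [hpre]) ?_ ?_ g6).mono ?_
    · intro a ha
      rcases List.mem_append.1 ha with ha | ha
      · exact hprew a ha
      · rw [List.mem_singleton.1 ha]
        exact haw
    · intro j hj1 hj2
      rw [letterAt_append_singleton hj1 (by omega), g5]
      split_ifs with hjp
      · rw [Function.update_of_ne (by omega), h.letters j hj1 hjp]
      · obtain rfl : j = F.k + 1 := by omega
        simp
    · rintro s' ⟨k1, k2, k3, k4, k5, k6⟩
      refine ⟨⟨?_, k2.trans g2, by simp [k3, g3], by rw [k3, g4, h.count], ?_, k4⟩, ?_,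
        by rw [k5, g7], by omega⟩
      · exact ⟨k1.n.trans g1.n, k1.sigma.trans g1.sigma, k1.k.trans g1.k, k1.init.trans g1.init,
          k1.startLen.trans g1.startLen, fun A hA => (k1.arr A hA).trans (g1.arr A hA)⟩
      · intro j hj1 hj2
        rw [k3, g5, Function.update_of_ne (by omega), h.letters j hj1 hj2]
      · intro j hj
        rw [k3, g3, g4, g5, Function.update_of_ne (by omega), Function.update_of_ne (by omega)]
        exact ⟨rfl, rfl, rfl⟩
  obtain ⟨s', g0, g1, g2, g3, g4⟩ := exists_loopStep (e := reg (.tmp 0))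
    (by simp [h.level]; omega) (by simp [h.level]) hrun
  exact ⟨s', g0, g1, g2, by simp [g3], ht.output g3 g4 (by simp only [enumDelay]; omega)⟩

/-- One choice on level `ℓ` is a push, then all of level `ℓ + 1`, whose final pop returns to `ℓ`.
Since the deeper levels leave the stack below them alone, the search resumes with the counters of
level `ℓ` intact. -/
theorem enumNext_of_enumLevel (hw : IsWordOver σ w) (hB : 10 * w.length ≤ B)
    (hd₀ : HoldsData σ w F s₀) (h1 : 1 ≤ ℓ) (hk : ℓ ≤ F.k) (hc : F.IsChoiceList ℓ c)
    (hpre : pre.length + 1 = ℓ) (hi : i < c.length) (h : EnumInv F s₀ ℓ pre i c s)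
    (ht : OnTime (enumDelay w.length) (100 * (F.k + 2 + ℓ)) s)
    (hlevel : ∀ a c' s', a ∈ w → F.IsChoiceList (ℓ + 1) c' → 0 < c'.length →
      EnumInv F s₀ (ℓ + 1) (pre ++ [a]) 0 c' s' →
      OnTime (enumDelay w.length) (100 * (F.k + 2 + (ℓ + 1))) s' →
      EnumLevel B F s₀ (ℓ + 1) (pre ++ [a]) 0 c' s') :
    EnumNext B F s₀ ℓ pre i c s := by
  have hkn := F.k_le_length
  have hj : letterAt c (i + 1) ∈ c := letterAt_mem (by omega) (by omega)
  obtain ⟨hjn, hjk⟩ := hc.mem hj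
  obtain ⟨hA, hne⟩ := hjk hk
  have haw := letterAt_mem hjn.1 hjn.2
  have hwf : F.wordsFrom ℓ [letterAt c (i + 1)] = (F.wordsFrom (ℓ + 1) (F.lastUpTo ℓ
      (F.firstPosArch ℓ (letterAt w (letterAt c (i + 1)))))).map
        (letterAt w (letterAt c (i + 1)) :: ·) := by
    rw [F.wordsFrom_lastUpTo h1 hk]
    simp [ArchFactorization.wordsFrom]
  rw [EnumNext, hwf]
  generalize ha : letterAt w (letterAt c (i + 1)) = a at *
  have hrun : Runs B enumBody (s.tick 2) fun s' => EnumInv F s₀ (ℓ + 1) (pre ++ [a]) 0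
      (F.lastUpTo ℓ (F.firstPosArch ℓ a)) s' ∧ SameBelow ℓ s s' ∧
      s'.arr choiceArr ℓ = i + 1 ∧ s'.arr choiceCount ℓ = c.length ∧
      s'.out = s.out ∧ s'.time ≤ s.time + 100 := by
    refine enumBody_select_runs hw hB hd₀ h1 (by omega) hc hi h ?_
    intro s₁ g1 g2 g3 g4 g5 g6 g7 g8
    rw [ha] at g5
    rw [if_neg (by omega)]
    refine (enumPush_runs hw hB (g1.holdsData hd₀) h1 hk g2 (by simp [g5]) haw).mono ?_
    rintro s' ⟨k1, k2, k3, k4, k5, k6, k7, k8⟩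
    refine ⟨⟨?_, k2, by simp [k3], by simp [k4], ?_, k6.trans g6⟩, ?_, by simp [k3, g3],
      by simp [k4, g4, h.count], k7.trans g7, by omega⟩
    · exact ⟨k1.n.trans g1.n, k1.sigma.trans g1.sigma, k1.k.trans g1.k, k1.init.trans g1.init,
        k1.startLen.trans g1.startLen, fun A hA => (k1.arr A hA).trans (g1.arr A hA)⟩
    · intro j hj1 hj2
      simp only [List.length_append, List.length_singleton] at hj2
      rw [letterAt_append_singleton hj1 hj2, k5, g5]
      split_ifs with hjp
      · rw [Function.update_of_ne (by omega), h.letters j hj1 hjp]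
      · obtain rfl : j = ℓ := by omega
        simp
    · intro j hj
      rw [k3, k4, k5, g3, g4, g5, Function.update_of_ne (by omega), Function.update_of_ne (by omega),
        Function.update_of_ne (by omega), Function.update_of_ne (by omega)]
      exact ⟨rfl, rfl, rfl⟩
  obtain ⟨s₁, g0, g1, g2, g3, g4, g5, g6⟩ := exists_loopStep (e := reg (.tmp 0))
    (by simp [h.level]; omega) (by simp [h.level]; omega) hrun
  obtain ⟨s', k1, k2, k3, k4, k5, k6, k7⟩ := hlevel a _ s₁ haw
    (Or.inr ⟨ℓ, _, rfl, h1, hk, hA, rfl⟩) hne g1 (ht.step g5 (by omega))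
  have hb := g2.trans (k5.mono (Nat.le_succ ℓ))
  refine ⟨s', g0.trans k1, ⟨k2, k3, ?_, ?_, ?_, k4⟩, hb, ?_, ?_⟩
  · rw [(k5 ℓ (by omega)).1, g3]
  · rw [(k5 ℓ (by omega)).2.1, g4]
  · intro j hj1 hj2
    rw [(hb j (by omega)).2.2, h.letters j hj1 hj2]
  · rw [k6, g5]
    simp
  · rwa [show F.k + 3 - (ℓ + 1) = F.k + 2 - ℓ by omega] at k7

/-- Induction from the leaves upwards, on the number of levels below `ℓ`; the siblings on one level
are handled by the inner induction of `enumLevel_of_enumNext`. -/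
theorem enumLevel_zero (hw : IsWordOver σ w) (hB : 10 * w.length ≤ B)
    (hd₀ : HoldsData σ w F s₀) (h1 : 1 ≤ ℓ) (hk : ℓ ≤ F.k + 1) (hc : F.IsChoiceList ℓ c)
    (hne : 0 < c.length) (hpre : pre.length + 1 = ℓ) (hprew : ∀ a ∈ pre, a ∈ w)
    (h : EnumInv F s₀ ℓ pre 0 c s)
    (ht : OnTime (enumDelay w.length) (100 * (F.k + 2 + ℓ)) s) :
    EnumLevel B F s₀ ℓ pre 0 c s := by
  induction hd : F.k + 1 - ℓ generalizing ℓ pre c s with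
  | zero =>
    obtain rfl : ℓ = F.k + 1 := by omega
    exact enumLevel_of_enumNext hw hB h1 hk hc hne
      (fun i s hi h ht => enumNext_last hw hB hd₀ hc (by omega) hprew hi h ht)
      (Nat.zero_le _) h (by simpa using ht)
  | succ d ih =>
    refine enumLevel_of_enumNext hw hB h1 hk hc hne (fun i s hi h ht =>
      enumNext_of_enumLevel hw hB hd₀ h1 (by omega) hc hpre hi h ht ?_)
      (Nat.zero_le _) h (by simpa using ht)
    intro a c' s' ha hc' hne' h' ht'
    refine ih (by omega) (by omega) hc' hne' (by simp; omega) ?_ h' ht' (by omega)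
    intro b hb
    rcases List.mem_append.1 hb with hb | hb
    · exact hprew b hb
    · rwa [List.mem_singleton.1 hb]

theorem enumProg_runs (hw : IsWordOver σ w) (hB : 10 * w.length ≤ B) (hd : HoldsData σ w F s)
    (hs : s.Fresh) :
    Runs B enumProg s fun s' => HoldsData σ w F s' ∧ s'.cur = [] ∧
      s'.out.map Prod.fst = F.sasList ∧ DelayAtMost (enumDelay w.length) s' := by
  have hk1 := F.k_pos
  have hkn := F.k_le_length
  have hlen := F.length_startSAS_le hw
  have hσ := (F.cell_le hw le_rfl F.k_pos (le_refl σ)).1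
  simp [enumProg, hd.startLen]
  refine ⟨by omega, by omega, by omega, ?_⟩
  obtain ⟨s', g0, g1, g2, g3, g4, g5, g6⟩ := enumLevel_zero (B := B) (ℓ := 1) (pre := [])
    (c := F.startSAS) (F := F) (s₀ := s) (σ := σ) (s := {
      reg := Function.update s.reg (.tmp 0) 1
      arr := Function.update (Function.update s.arr choiceCount
        (Function.update (s.arr choiceCount) 1 F.startSAS.length)) choiceArr
        (Function.update (s.arr choiceArr) 1 0)
      time := s.time + 1 + 1 + 1 + 1 + 1 + 1 + 1 + 1
      cur := s.cur
      out := s.out }) hw hB hd le_rfl (by omega) (Or.inl ⟨rfl, rfl⟩)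
    (List.length_pos_iff.2 F.startSAS_ne_nil) rfl (by simp)
    ⟨(SameData.refl s).reg_congr (by simp) (fun A hA => by simp [hA]), by simp, by simp, by simp,
      by simp; omega, hs.2.1⟩
    (by simp [OnTime, hs.1, hs.2.2]; omega)
  refine g0.runs_while (by simp [g2]) (by simp [g2]) ⟨?_, g3, ?_, ?_⟩
  · exact (g1.reg_congr (by simp) (by simp)).holdsData hd
  · simp [g5, hs.2.2, F.wordsFrom_one]
  -- After the last output there are the pops down to level `0` and the final loop test, which costs
  -- `2`.
  · exact (g6.step (s' := s'.tick 2) (Y := 100 * (F.k + 2) + 2) rfl (by simp; omega)).delayAtMost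
      (by simp only [enumDelay]; omega)

end

/-! ### Preprocessing: scanning the arches -/

/-- The array that holds, for each letter, the number of the last arch in which it was seen. -/
abbrev seenArr : ArrName := .tmp 0

/-- The initial memory is arbitrary, so the marks have to be cleared. Once is enough, because marks
are arch numbers and older ones expire when the next arch begins. -/
def clearSeen : RamProg :=
  assign (.tmp 0) (const 0) ;;
  RamProg.while (ltE (reg (.tmp 0)) (reg .sigma))
    (assign (.tmp 0) (addE (reg (.tmp 0)) (const 1)) ;;
     store seenArr (reg (.tmp 0)) (const 0))

/-- Record the next position as an occurrence of its letter in the current arch. -/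
def scanRecord : RamProg :=
  assign (.tmp 0) (addE (reg (.tmp 0)) (const 1)) ;;
  assign (.tmp 2) (get .word (reg (.tmp 0))) ;;
  assign (.tmp 3) (addE (mulE (reg .k) (reg .sigma)) (reg (.tmp 2))) ;;
  store .lastPosArch (reg (.tmp 3)) (reg (.tmp 0)) ;;
  ite (eqE (get seenArr (reg (.tmp 2))) (addE (reg .k) (const 1))) skip
    (store seenArr (reg (.tmp 2)) (addE (reg .k) (const 1)) ;;
     store .firstPosArch (reg (.tmp 3)) (reg (.tmp 0)) ;;
     assign (.tmp 1) (addE (reg (.tmp 1)) (const 1)))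

/-- Close the current arch when all letters have been seen in it. -/
def scanClose : RamProg :=
  ite (eqE (reg (.tmp 1)) (reg .sigma))
    (assign .k (addE (reg .k) (const 1)) ;;
     assign (.tmp 1) (const 0) ;;
     store .archEnd (reg .k) (reg (.tmp 0)))
    skip

def scanProg : RamProg :=
  assign (.tmp 0) (const 0) ;;
  assign .k (const 0) ;;
  assign (.tmp 1) (const 0) ;;
  store .archEnd (const 0) (const 0) ;;
  RamProg.while (ltE (reg (.tmp 0)) (reg .n)) (scanRecord ;; scanClose)

theorem HoldsInput.congr {σ : ℕ} {w : List ℕ} {s s' : RamState} (h : HoldsInput σ w s)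
    (h1 : s'.reg .n = s.reg .n) (h2 : s'.reg .sigma = s.reg .sigma)
    (h3 : s'.arr .word = s.arr .word) : HoldsInput σ w s' :=
  ⟨h1.trans h.n, h2.trans h.sigma, by rw [h3]; exact h.word⟩

theorem IsWordOver.card_le_length {σ : ℕ} {w : List ℕ} (hw : IsWordOver σ w) : σ ≤ w.length := by
  have h1 : w.toFinset.card = σ := by simp [hw.toFinset_eq]
  rw [← h1]
  exact List.toFinset_card_le w

theorem clearSeen_runs {σ B : ℕ} {w : List ℕ} {s : RamState} (hw : IsWordOver σ w) (hσ : 1 ≤ σ)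
    (hB : 10 * w.length ≤ B) (hi : HoldsInput σ w s) :
    Runs B clearSeen s fun s' => HoldsInput σ w s' ∧
      (∀ a, 1 ≤ a → a ≤ σ → s'.arr seenArr a = 0) ∧ s'.time ≤ s.time + 20 * (σ + 1) := by
  have hσn := hw.card_le_length
  simp [clearSeen]
  refine runs_while (fun m s' => ∃ j, j + m = σ ∧ HoldsInput σ w s' ∧ s'.reg (.tmp 0) = j ∧
    (∀ a, 1 ≤ a → a ≤ j → s'.arr seenArr a = 0) ∧ s'.time ≤ s.time + 2 + 20 * j) ?_ ?_ ?_
    σ _ ⟨0, by omega, hi.congr rfl rfl rfl, by simp, by omega, by simp⟩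
  · rintro m s' ⟨j, hj, h1, h2, h3, h4⟩
    have : (if j < σ then 1 else 0) ≤ B := by split_ifs <;> omega
    simp [h2, h1.sigma, this]
    omega
  · rintro m s' ⟨j, hj, h1, h2, h3, h4⟩
    simp [h2]
    refine ⟨by omega, by omega, by omega, h1.congr (by simp) (by simp) (by simp), ?_, by omega⟩
    intro a ha1 ha2
    rw [Function.update_apply]
    split_ifs
    · rfl
    · exact h3 a ha1 (by omega)
  · rintro s' ⟨j, hj, h1, h2, h3, h4⟩
    obtain rfl : j = σ := by omega
    exact ⟨h1.congr rfl rfl rfl, h3, by simp; omega⟩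

/-- The positions up to `i` have been scanned, and `ℓ` arches have been closed. -/
structure ScanInv (σ : ℕ) {w : List ℕ} (F : ArchFactorization w) (ℓ i : ℕ) (s : RamState) :
    Prop where
  input : HoldsInput σ w s
  pos : s.reg (.tmp 0) = i
  level : s.reg .k = ℓ
  level_le : ℓ ≤ F.k
  le : F.archEnd ℓ ≤ i
  le_succ : ℓ < F.k → i ≤ F.archEnd (ℓ + 1)
  le_length : i ≤ w.length
  count : s.reg (.tmp 1) = ((Finset.Ioc (F.archEnd ℓ) i).image (letterAt w)).card
  seen_le : ∀ a, 1 ≤ a → a ≤ σ → s.arr seenArr a ≤ ℓ + 1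
  seen : ∀ a, 1 ≤ a → a ≤ σ → (s.arr seenArr a = ℓ + 1 ↔
    ∃ j, F.archEnd ℓ < j ∧ j ≤ i ∧ letterAt w j = a)
  ends : ∀ m ≤ ℓ, s.arr .archEnd m = F.archEnd m
  first : ∀ m a, 1 ≤ m → m ≤ ℓ → 1 ≤ a → a ≤ σ →
    s.arr .firstPosArch (cell σ m a) = F.firstPosArch m a
  last : ∀ m a, 1 ≤ m → m ≤ ℓ → 1 ≤ a → a ≤ σ →
    s.arr .lastPosArch (cell σ m a) = F.lastPosArch m a
  first_cur : ∀ j, F.archEnd ℓ < j → j ≤ i →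
    IsLeast {j' | F.archEnd ℓ < j' ∧ j' ≤ i ∧ letterAt w j' = letterAt w j}
      (s.arr .firstPosArch (ℓ * σ + letterAt w j))
  last_cur : ∀ j, F.archEnd ℓ < j → j ≤ i →
    IsGreatest {j' | F.archEnd ℓ < j' ∧ j' ≤ i ∧ letterAt w j' = letterAt w j}
      (s.arr .lastPosArch (ℓ * σ + letterAt w j))

theorem cell_le_mul {σ m ℓ a : ℕ} (h1 : 1 ≤ m) (hm : m ≤ ℓ) (ha : a ≤ σ) :
    cell σ m a ≤ ℓ * σ := by
  obtain ⟨m, rfl⟩ : ∃ m', m = m' + 1 := ⟨m - 1, by omega⟩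
  have := Nat.mul_le_mul_right σ hm
  rw [Nat.add_mul] at this
  simp only [cell, Nat.add_sub_cancel]
  omega

section

variable {σ B ℓ i : ℕ} {w : List ℕ} {F : ArchFactorization w} {s : RamState}

/-- The rest is scanned like an unfinished arch: its entries go into row `k + 1`, which no
specification reads. -/
theorem scanRecord_runs (hw : IsWordOver σ w) (hB : 10 * w.length ≤ B)
    (h : ScanInv σ F ℓ i s) (hlt : ℓ < F.k → i < F.archEnd (ℓ + 1)) (hi : i < w.length) :
    Runs B scanRecord (s.tick 4) fun s' => ScanInv σ F ℓ (i + 1) s' ∧ s'.time ≤ s.time + 40 := by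
  obtain ⟨hin, hpos, hlev, hlk, hle, hls, hln, hcnt, hsle, hseen, hends, hfirst, hlast, hfc, hlc⟩ := h
  have hword := hin.word (i + 1) (by omega) (by omega)
  have haw : letterAt w (i + 1) ∈ w := letterAt_mem (by omega) (by omega)
  have haσ := (hw _).1 haw
  have hσn := hw.card_le_length
  have hml := F.mul_le_length hw hlk
  have hkn := F.k_le_length
  -- Closed rows end at address `ℓ * σ`, and letters are at least `1`, so the current row does not
  -- overwrite them.
  have hcl : ∀ m b, 1 ≤ m → m ≤ ℓ → 1 ≤ b → b ≤ σ → cell σ m b ≠ ℓ * σ + letterAt w (i + 1) := by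
    intro m b h1 h2 h3 h4
    have := cell_le_mul h1 h2 h4
    omega
  have hcard : ((Finset.Ioc (F.archEnd ℓ) i).image (letterAt w)).card ≤ w.length := by
    refine Finset.card_image_le.trans ?_
    rw [Nat.card_Ioc]
    omega
  have hs1 := hsle _ haσ.1 haσ.2
  have hIoc : Finset.Ioc (F.archEnd ℓ) (i + 1) = insert (i + 1) (Finset.Ioc (F.archEnd ℓ) i) := by
    ext j
    simp only [Finset.mem_Ioc, Finset.mem_insert]
    omega
  have hmem : letterAt w (i + 1) ∈ (Finset.Ioc (F.archEnd ℓ) i).image (letterAt w) ↔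
      ∃ j, F.archEnd ℓ < j ∧ j ≤ i ∧ letterAt w j = letterAt w (i + 1) := by
    simp [Finset.mem_image, and_assoc]
  have hcur_last : ∀ f : ℕ → ℕ, (∀ j, F.archEnd ℓ < j → j ≤ i →
      IsGreatest {j' | F.archEnd ℓ < j' ∧ j' ≤ i ∧ letterAt w j' = letterAt w j}
        (f (ℓ * σ + letterAt w j))) → ∀ j, F.archEnd ℓ < j → j ≤ i + 1 →
      IsGreatest {j' | F.archEnd ℓ < j' ∧ j' ≤ i + 1 ∧ letterAt w j' = letterAt w j}
        (Function.update f (ℓ * σ + letterAt w (i + 1)) (i + 1) (ℓ * σ + letterAt w j)) := by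
    intro f hf j hj1 hj2
    by_cases he : letterAt w j = letterAt w (i + 1)
    · rw [he, Function.update_self]
      exact ⟨⟨by omega, le_rfl, rfl⟩, fun x hx => hx.2.1⟩
    · rw [Function.update_of_ne (by omega)]
      have hj3 : j ≤ i := by
        by_contra hc
        exact he (by rw [show j = i + 1 by omega])
      obtain ⟨⟨g1, g2, g3⟩, g4⟩ := hf j hj1 hj3
      refine ⟨⟨g1, by omega, g3⟩, fun x hx => g4 ⟨hx.1, ?_, hx.2.2⟩⟩
      by_contra hc
      exact he (by rw [← hx.2.2, show x = i + 1 by have := hx.2.1; omega])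
  by_cases hsn : s.arr seenArr (letterAt w (i + 1)) = ℓ + 1
  · have hex := (hseen _ haσ.1 haσ.2).1 hsn
    simp [scanRecord, hpos, hword, hlev, hin.sigma, hsn]
    and_intros <;> first | omega | skip
    refine ⟨hin.congr (by simp) (by simp) (by simp), by simp, by simp [hlev], hlk, by omega,
      by omega, by omega, ?_, by simpa using hsle, ?_, by simpa using hends, by simpa using hfirst, ?_,
      ?_, ?_⟩
    · simp [hIoc, Finset.image_insert, Finset.insert_eq_of_mem (hmem.2 hex), hcnt]
    · intro a ha1 ha2
      simp only [ne_eq, reduceCtorEq, not_false_eq_true, Function.update_of_ne]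
      rw [hseen a ha1 ha2]
      constructor
      · rintro ⟨j, g1, g2, g3⟩
        exact ⟨j, g1, by omega, g3⟩
      · rintro ⟨j, g1, g2, g3⟩
        rcases Nat.lt_or_ge i j with hc | hc
        · obtain ⟨j', k1, k2, k3⟩ := hex
          exact ⟨j', k1, k2, by rw [k3, ← g3, show j = i + 1 by omega]⟩
        · exact ⟨j, g1, hc, g3⟩
    · intro m b h1 h2 h3 h4
      simp [Function.update_of_ne (hcl m b h1 h2 h3 h4), hlast m b h1 h2 h3 h4]
    · intro j hj1 hj2
      simp only [ne_eq, reduceCtorEq, not_false_eq_true, Function.update_of_ne]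
      obtain ⟨j', hj'1, hj'2, hj'3⟩ : ∃ j', F.archEnd ℓ < j' ∧ j' ≤ i ∧
          letterAt w j' = letterAt w j := by
        rcases Nat.lt_or_ge i j with hc | hc
        · obtain rfl : j = i + 1 := by omega
          exact hex
        · exact ⟨j, hj1, hc, rfl⟩
      have := hfc j' hj'1 hj'2
      rw [hj'3] at this
      obtain ⟨⟨g1, g2, g3⟩, g4⟩ := this
      refine ⟨⟨g1, by omega, g3⟩, fun x hx => ?_⟩
      rcases Nat.lt_or_ge i x with hc | hc
      · omega
      · exact g4 ⟨hx.1, hc, hx.2.2⟩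
    · simpa using hcur_last _ hlc
  · have hex : ¬ ∃ j, F.archEnd ℓ < j ∧ j ≤ i ∧ letterAt w j = letterAt w (i + 1) :=
      fun hc => hsn ((hseen _ haσ.1 haσ.2).2 hc)
    simp [scanRecord, hpos, hword, hlev, hin.sigma, hsn, hcnt]
    and_intros <;> first | omega | skip
    refine ⟨hin.congr (by simp) (by simp) (by simp), by simp, by simp [hlev], hlk, by omega,
      by omega, by omega, ?_, ?_, ?_, by simpa using hends, ?_, ?_, ?_, ?_⟩
    · rw [hIoc, Finset.image_insert, Finset.card_insert_of_notMem (fun hc => hex (hmem.1 hc))]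
      simp
    · intro a ha1 ha2
      simp [Function.update_apply]
      split_ifs
      · omega
      · exact hsle a ha1 ha2
    · intro a ha1 ha2
      simp only [ne_eq, reduceCtorEq, not_false_eq_true, Function.update_of_ne,
        Function.update_self]
      by_cases he : a = letterAt w (i + 1)
      · subst he
        simp only [Function.update_self, true_iff]
        exact ⟨i + 1, by omega, le_rfl, rfl⟩
      · rw [Function.update_of_ne he, hseen a ha1 ha2]
        constructor
        · rintro ⟨j, g1, g2, g3⟩
          exact ⟨j, g1, by omega, g3⟩
        · rintro ⟨j, g1, g2, g3⟩
          refine ⟨j, g1, ?_, g3⟩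
          by_contra hc
          exact he (by rw [← g3, show j = i + 1 by omega])
    · intro m b h1 h2 h3 h4
      simp [Function.update_of_ne (hcl m b h1 h2 h3 h4), hfirst m b h1 h2 h3 h4]
    · intro m b h1 h2 h3 h4
      simp [Function.update_of_ne (hcl m b h1 h2 h3 h4), hlast m b h1 h2 h3 h4]
    · intro j hj1 hj2
      simp only [Function.update_self]
      by_cases he : letterAt w j = letterAt w (i + 1)
      · rw [he, Function.update_self]
        refine ⟨⟨by omega, le_rfl, rfl⟩, fun x hx => ?_⟩
        by_contra hc
        exact hex ⟨x, hx.1, by omega, hx.2.2⟩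
      · rw [Function.update_of_ne (by omega)]
        have hj3 : j ≤ i := by
          by_contra hc
          exact he (by rw [show j = i + 1 by omega])
        obtain ⟨⟨g1, g2, g3⟩, g4⟩ := hfc j hj1 hj3
        refine ⟨⟨g1, by omega, g3⟩, fun x hx => g4 ⟨hx.1, ?_, hx.2.2⟩⟩
        by_contra hc
        exact he (by rw [← hx.2.2, show x = i + 1 by have := hx.2.1; omega])
    · simpa using hcur_last _ hlc

/-- The letters seen form a subset of `{1, …, σ}`, so their number is `σ` only if all have been
seen, and `forall_letter_iff` applies. -/
theorem ScanInv.count_eq_iff (hw : IsWordOver σ w) (h : ScanInv σ F ℓ i s) :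
    s.reg (.tmp 1) = σ ↔ ℓ < F.k ∧ F.archEnd (ℓ + 1) ≤ i := by
  have hin := h.le_length
  have hsub : (Finset.Ioc (F.archEnd ℓ) i).image (letterAt w) ⊆ Finset.Icc 1 σ := by
    intro a ha
    obtain ⟨j, hj, rfl⟩ := Finset.mem_image.1 ha
    rw [Finset.mem_Ioc] at hj
    exact Finset.mem_Icc.2 ((hw _).1 (letterAt_mem (by omega) (by omega)))
  rw [← F.forall_letter_iff h.level_le hin, h.count]
  have hcard : (Finset.Icc 1 σ).card = σ := by simp
  constructor
  · intro hc a ha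
    have he := Finset.eq_of_subset_of_card_le hsub (by omega)
    have : a ∈ Finset.Icc 1 σ := Finset.mem_Icc.2 ((hw a).1 ha)
    rw [← he, Finset.mem_image] at this
    obtain ⟨j, hj, hja⟩ := this
    rw [Finset.mem_Ioc] at hj
    exact ⟨j, hj.1, hj.2, hja⟩
  · intro hall
    have he : (Finset.Ioc (F.archEnd ℓ) i).image (letterAt w) = Finset.Icc 1 σ := by
      refine Finset.Subset.antisymm hsub fun a ha => ?_
      obtain ⟨j, h1, h2, h3⟩ := hall a ((hw a).2 (Finset.mem_Icc.1 ha))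
      exact Finset.mem_image.2 ⟨j, Finset.mem_Ioc.2 ⟨h1, h2⟩, h3⟩
    rw [he, hcard]

theorem scanClose_runs (hw : IsWordOver σ w) (hσ : 1 ≤ σ) (hB : 10 * w.length ≤ B)
    (h : ScanInv σ F ℓ i s) :
    Runs B scanClose s fun s' => ∃ m, ScanInv σ F m i s' ∧ (m < F.k → i < F.archEnd (m + 1)) ∧
      s'.time ≤ s.time + 20 := by
  have hiff := h.count_eq_iff hw
  obtain ⟨hin, hpos, hlev, hlk, hle, hls, hln, hcnt, hsle, hseen, hends, hfirst, hlast, hfc,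
    hlc⟩ := h
  have hσn := hw.card_le_length
  have hkn := F.k_le_length
  have hcard : ((Finset.Ioc (F.archEnd ℓ) i).image (letterAt w)).card ≤ w.length := by
    refine Finset.card_image_le.trans ?_
    rw [Nat.card_Ioc]
    omega
  rw [← hcnt] at hcard
  by_cases hc : s.reg (.tmp 1) = σ
  · obtain ⟨hlt, hge⟩ := hiff.1 hc
    obtain rfl : i = F.archEnd (ℓ + 1) := le_antisymm (hls hlt) hge
    simp [scanClose, hc, hlev, hin.sigma, hpos]
    refine ⟨by omega, by omega, by omega, by omega, ℓ + 1, ?_,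
      fun h => F.archEnd_lt_succ (by omega)⟩
    refine ⟨hin.congr (by simp) (by simp) (by simp), by simp [hpos], by simp, by omega, le_rfl,
      fun h => (F.archEnd_lt_succ (by omega)).le, hln, by simp, ?_, ?_, ?_, ?_, ?_, ?_, ?_⟩
    · intro a ha1 ha2
      have := hsle a ha1 ha2
      simp
      omega
    -- All marks are at most `ℓ + 1`, so none equals the new mark `ℓ + 2`: they count as cleared
    -- without being touched.
    · intro a ha1 ha2
      have := hsle a ha1 ha2
      simp
      omega
    · intro m hm
      by_cases he : m = ℓ + 1
      · simp [he]
      · simp [he, hends m (by omega)]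
    · intro m a hm1 hm2 ha1 ha2
      by_cases he : m = ℓ + 1
      · subst he
        have haw := (hw a).2 ⟨ha1, ha2⟩
        have hL := F.isLeast_firstPosArch hm1 (by omega) haw
        obtain ⟨⟨j1, j2⟩, j3⟩ := hL.1
        have := hfc _ j1 j2
        rw [j3] at this
        simp only [cell, Nat.add_sub_cancel, ne_eq, reduceCtorEq, not_false_eq_true,
          Function.update_of_ne]
        refine this.unique ?_
        simpa [ArchFactorization.InArch, and_assoc] using hL
      · simp [hfirst m a hm1 (by omega) ha1 ha2]
    · intro m a hm1 hm2 ha1 ha2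
      by_cases he : m = ℓ + 1
      · subst he
        have haw := (hw a).2 ⟨ha1, ha2⟩
        have hL := F.isGreatest_lastPosArch hm1 (by omega) haw
        obtain ⟨⟨j1, j2⟩, j3⟩ := hL.1
        have := hlc _ j1 j2
        rw [j3] at this
        simp only [cell, Nat.add_sub_cancel, ne_eq, reduceCtorEq, not_false_eq_true,
          Function.update_of_ne]
        refine this.unique ?_
        simpa [ArchFactorization.InArch, and_assoc] using hL
      · simp [hlast m a hm1 (by omega) ha1 ha2]
    · intro j h1 h2
      omega
    · intro j h1 h2
      omega
  · simp [scanClose, hc, hin.sigma]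
    refine ⟨by omega, ℓ, ⟨hin.congr rfl rfl rfl, hpos, hlev, hlk, hle, hls, hln, hcnt, hsle, hseen,
      hends, hfirst, hlast, hfc, hlc⟩, fun hlt => ?_⟩
    by_contra hge
    exact hc (hiff.2 ⟨hlt, by omega⟩)

/-- The arches and the first and last positions in them are known, and the letters of the rest are
marked. -/
structure HoldsArches (σ : ℕ) (w : List ℕ) (F : ArchFactorization w) (s : RamState) : Prop where
  input : HoldsInput σ w s
  k : s.reg .k = F.k
  ends : ∀ m ≤ F.k, s.arr .archEnd m = F.archEnd m
  first : ∀ m a, 1 ≤ m → m ≤ F.k → 1 ≤ a → a ≤ σ →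
    s.arr .firstPosArch (cell σ m a) = F.firstPosArch m a
  last : ∀ m a, 1 ≤ m → m ≤ F.k → 1 ≤ a → a ≤ σ →
    s.arr .lastPosArch (cell σ m a) = F.lastPosArch m a
  seen_le : ∀ a, 1 ≤ a → a ≤ σ → s.arr seenArr a ≤ F.k + 1
  seen : ∀ a, 1 ≤ a → a ≤ σ → (s.arr seenArr a = F.k + 1 ↔ a ∈ F.rest)

theorem scanProg_runs (hw : IsWordOver σ w) (hσ : 1 ≤ σ) (hB : 10 * w.length ≤ B)
    (hin : HoldsInput σ w s) (hseen : ∀ a, 1 ≤ a → a ≤ σ → s.arr seenArr a = 0) :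
    Runs B scanProg s fun s' => HoldsArches σ w F s' ∧ s'.time ≤ s.time + 100 * w.length := by
  have hσn := hw.card_le_length
  have hkn := F.k_le_length
  simp [scanProg]
  refine runs_while (fun m s' => ∃ i ℓ, i + m = w.length ∧ ScanInv σ F ℓ i s' ∧
    (ℓ < F.k → i < F.archEnd (ℓ + 1)) ∧ s'.time ≤ s.time + 10 + 60 * i) ?_ ?_ ?_
    w.length _ ⟨0, 0, by omega, ?_, ?_, ?_⟩
  · rintro m s' ⟨i, ℓ, hi, hI, hlt, ht⟩
    have : (if i < w.length then 1 else 0) ≤ B := by split_ifs <;> omega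
    simp [hI.pos, hI.input.n, this]
    omega
  · rintro m s' ⟨i, ℓ, hi, hI, hlt, ht⟩
    rw [runs_seq]
    refine (scanRecord_runs hw hB hI hlt (by omega)).mono fun s₁ h1 => ?_
    refine (scanClose_runs hw hσ hB h1.1).mono fun s₂ h2 => ?_
    obtain ⟨ℓ', g1, g2, g3⟩ := h2
    exact ⟨i + 1, ℓ', by omega, g1, g2, by omega⟩
  · rintro s' ⟨i, ℓ, hi, hI, hlt, ht⟩
    obtain rfl : i = w.length := by omega
    -- If an arch were still open, the scan would have stopped before its end, which is at most `n`.
    have hl : ℓ = F.k := by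
      by_contra hc
      have h1 := hlt (lt_of_le_of_ne hI.level_le hc)
      have h2 := F.archEnd_le_length (ℓ + 1)
      omega
    subst hl
    refine ⟨⟨hI.input.congr rfl rfl rfl, hI.level, hI.ends, hI.first, hI.last, hI.seen_le, ?_⟩,
      by simp; omega⟩
    intro a ha1 ha2
    rw [F.mem_rest_iff]
    exact hI.seen a ha1 ha2
  · refine ⟨hin.congr (by simp) (by simp) (by simp), by simp, by simp, by simp,
      by simp [F.archEnd_zero], by simp, by simp, by simp, ?_, ?_, ?_, by omega, by omega, ?_, ?_⟩
    · intro a ha1 ha2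
      simp [hseen a ha1 ha2]
    · intro a ha1 ha2
      simp [hseen a ha1 ha2]
    · intro m hm
      obtain rfl : m = 0 := by omega
      simp [F.archEnd_zero]
    · intro j h1 h2
      omega
    · intro j h1 h2
      omega
  · intro h
    have := F.archEnd_lt_succ h
    omega
  · simp

end

/-! ### Preprocessing: the rows of `sortedLast`, `Leq` and `Lex` -/

/-- Go to the next position of the arch and test whether its letter is filtered out. -/
def rowTest : RamProg :=
  assign (.tmp 0) (addE (reg (.tmp 0)) (const 1)) ;;
  assign (.tmp 2) (get .word (reg (.tmp 0))) ;;
  ite (ltE (reg (.tmp 4)) (reg .k))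
    (assign (.tmp 5) (eqE (get .leq (get .firstPosArch
      (addE (addE (reg (.tmp 3)) (reg .sigma)) (reg (.tmp 2))))) (const 0)))
    (assign (.tmp 5) (eqE (get seenArr (reg (.tmp 2))) (addE (reg .k) (const 1))))

/-- Update the position that carries the smallest letter. -/
def updateBest : RamProg :=
  ite (eqE (reg (.tmp 1)) (const 1)) (assign (.tmp 6) (reg (.tmp 0)))
    (ite (ltE (reg (.tmp 2)) (get .word (reg (.tmp 6)))) (assign (.tmp 6) (reg (.tmp 0))) skip)

/-- Record the position if it is the last one of its letter in the arch and is not filtered out. -/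
def rowRecord : RamProg :=
  ite (ltE (reg (.tmp 5)) (eqE (get .lastPosArch (addE (reg (.tmp 3)) (reg (.tmp 2))))
      (reg (.tmp 0))))
    (assign (.tmp 1) (addE (reg (.tmp 1)) (const 1)) ;;
     store .sortedLast (addE (reg (.tmp 3)) (reg (.tmp 1))) (reg (.tmp 0)) ;;
     updateBest ;;
     store .lex (addE (reg (.tmp 3)) (reg (.tmp 1))) (reg (.tmp 6)))
    skip ;;
  store .leq (reg (.tmp 0)) (reg (.tmp 1))

def rowProg : RamProg :=
  assign (.tmp 3) (mulE (subE (reg (.tmp 4)) (const 1)) (reg .sigma)) ;;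
  assign (.tmp 0) (get .archEnd (subE (reg (.tmp 4)) (const 1))) ;;
  assign (.tmp 1) (const 0) ;;
  assign (.tmp 6) (const 0) ;;
  RamProg.while (ltE (reg (.tmp 0)) (get .archEnd (reg (.tmp 4)))) (rowTest ;; rowRecord) ;;
  store .sortedLen (reg (.tmp 4)) (reg (.tmp 1)) ;;
  assign (.tmp 4) (subE (reg (.tmp 4)) (const 1))

/-- The arrays `sortedLast`, `Leq` and `Lex`, for all arches from the last to the first. -/
def rowsProg : RamProg :=
  assign (.tmp 4) (reg .k) ;;
  RamProg.while (reg (.tmp 4)) rowProg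

/-- The rows after the `ℓ`-th of the arrays `sortedLast`, `Leq` and `Lex` are known. -/
structure HoldsRows (σ : ℕ) (w : List ℕ) (F : ArchFactorization w) (ℓ : ℕ) (s : RamState) :
    Prop where
  arches : HoldsArches σ w F s
  len : ∀ m, ℓ < m → m ≤ F.k → s.arr .sortedLen m = (F.sortedLast m).length
  sorted : ∀ m t, ℓ < m → m ≤ F.k → 1 ≤ t → t ≤ (F.sortedLast m).length →
    s.arr .sortedLast (cell σ m t) = letterAt (F.sortedLast m) t
  leq : ∀ m i, ℓ < m → m ≤ F.k → F.InArch m i → s.arr .leq i = (F.lastUpTo m i).length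
  lex : ∀ m t, ℓ < m → m ≤ F.k → 1 ≤ t → t ≤ (F.sortedLast m).length →
    s.arr .lex (cell σ m t) = F.lexArr m t

section

variable {σ B ℓ i : ℕ} {w : List ℕ} {F : ArchFactorization w} {s s' : RamState}

theorem HoldsArches.congr (h : HoldsArches σ w F s)
    (hr : ∀ x, x = .n ∨ x = .sigma ∨ x = .k → s'.reg x = s.reg x)
    (ha : ∀ A, A = .word ∨ A = .archEnd ∨ A = .firstPosArch ∨ A = .lastPosArch ∨ A = seenArr →
      s'.arr A = s.arr A) : HoldsArches σ w F s' where
  input := h.input.congr (hr _ (by simp)) (hr _ (by simp)) (ha _ (by simp))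
  k := (hr _ (by simp)).trans h.k
  ends := by rw [ha _ (by simp)]; exact h.ends
  first := by rw [ha _ (by simp)]; exact h.first
  last := by rw [ha _ (by simp)]; exact h.last
  seen_le := by rw [ha _ (by simp)]; exact h.seen_le
  seen := by rw [ha _ (by simp)]; exact h.seen

theorem mul_lt_cell {m t : ℕ} (hm : ℓ < m) (ht : 1 ≤ t) : ℓ * σ < cell σ m t := by
  have := Nat.mul_le_mul_right σ (show ℓ ≤ m - 1 by omega)
  simp only [cell]
  omega

/-- Later rows occupy the addresses beyond `ℓ * σ`, and their `Leq` values the positions beyond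
`archEnd ℓ`, so they survive the filling of row `ℓ`. -/
theorem HoldsRows.congr (h : HoldsRows σ w F ℓ s)
    (hr : ∀ x, x = .n ∨ x = .sigma ∨ x = .k → s'.reg x = s.reg x)
    (ha : ∀ A, A = .word ∨ A = .archEnd ∨ A = .firstPosArch ∨ A = .lastPosArch ∨ A = seenArr →
      s'.arr A = s.arr A)
    (hlen : ∀ x, ℓ < x → s'.arr .sortedLen x = s.arr .sortedLen x)
    (hsorted : ∀ x, ℓ * σ < x → s'.arr .sortedLast x = s.arr .sortedLast x)
    (hleq : ∀ x, F.archEnd ℓ < x → s'.arr .leq x = s.arr .leq x)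
    (hlex : ∀ x, ℓ * σ < x → s'.arr .lex x = s.arr .lex x) : HoldsRows σ w F ℓ s' where
  arches := h.arches.congr hr ha
  len m h1 h2 := by rw [hlen m h1, h.len m h1 h2]
  sorted m t h1 h2 h3 h4 := by rw [hsorted _ (mul_lt_cell h1 h3), h.sorted m t h1 h2 h3 h4]
  leq m i h1 h2 h3 := by
    have h4 := h3.1
    have := F.archEnd_mono (show ℓ ≤ m - 1 by omega)
    rw [hleq i (by omega), h.leq m i h1 h2 h3]
  lex m t h1 h2 h3 h4 := by rw [hlex _ (mul_lt_cell h1 h3), h.lex m t h1 h2 h3 h4]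

/-- The `ℓ`-th row is known up to the position `i`. -/
structure RowInv (σ : ℕ) (w : List ℕ) (F : ArchFactorization w) (ℓ i : ℕ) (s : RamState) :
    Prop where
  rows : HoldsRows σ w F ℓ s
  level : s.reg (.tmp 4) = ℓ
  base : s.reg (.tmp 3) = (ℓ - 1) * σ
  pos : s.reg (.tmp 0) = i
  ge : F.archEnd (ℓ - 1) ≤ i
  le : i ≤ F.archEnd ℓ
  count : s.reg (.tmp 1) = (F.lastUpTo ℓ i).length
  best : s.reg (.tmp 6) = ((F.lastUpTo ℓ i).argmin (letterAt w)).getD 0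
  sorted : ∀ t, 1 ≤ t → t ≤ (F.lastUpTo ℓ i).length →
    s.arr .sortedLast ((ℓ - 1) * σ + t) = letterAt (F.lastUpTo ℓ i) t
  lex : ∀ t, 1 ≤ t → t ≤ (F.lastUpTo ℓ i).length →
    s.arr .lex ((ℓ - 1) * σ + t) = (((F.lastUpTo ℓ i).take t).argmin (letterAt w)).getD 0
  leq : ∀ j, F.archEnd (ℓ - 1) < j → j ≤ i → s.arr .leq j = (F.lastUpTo ℓ j).length

theorem sub_one_mul_add (h1 : 1 ≤ ℓ) : (ℓ - 1) * σ + σ = ℓ * σ := by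
  obtain ⟨m, rfl⟩ : ∃ m, ℓ = m + 1 := ⟨ℓ - 1, by omega⟩
  rw [Nat.add_sub_cancel, Nat.add_mul, Nat.one_mul]

-- For `ℓ < k` a letter is filtered out when its first position in arch `ℓ + 1` has no element of
-- `L'_(ℓ+1)` up to it, that is, when the stored `Leq` is `0`; that row is already known. For `ℓ =
-- k` the marks left by the scan tell which letters occur in the rest.
open Classical in
theorem rowTest_runs (hw : IsWordOver σ w) (hB : 10 * w.length ≤ B) (h1 : 1 ≤ ℓ) (hk : ℓ ≤ F.k)
    (h : RowInv σ w F ℓ i s) (hi : i < F.archEnd ℓ) (t : ℕ) :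
    Runs B rowTest (s.tick t) fun s' =>
      s'.reg = Function.update (Function.update (Function.update s.reg (.tmp 0) (i + 1)) (.tmp 2)
        (letterAt w (i + 1))) (.tmp 5)
          (if letterAt w (i + 1) ∈ F.filteredLetters ℓ then 1 else 0) ∧
      s'.arr = s.arr ∧ s'.time ≤ s.time + t + 40 := by
  have hA := h.rows.arches
  have hen := F.archEnd_le_length ℓ
  have hword := hA.input.word (i + 1) (by omega) (by omega)
  have haw : letterAt w (i + 1) ∈ w := letterAt_mem (by omega) (by omega)
  have haσ := (hw _).1 haw
  have hσn := hw.card_le_length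
  have hkn := F.k_le_length
  have hfl := F.mem_filteredLetters_iff (ℓ := ℓ) haw
  generalize letterAt w (i + 1) = a at *
  by_cases hlt : ℓ < F.k
  · have hfirst := hA.first (ℓ + 1) a (by omega) (by omega) haσ.1 haσ.2
    have hFA := F.inArch_firstPosArch (ℓ := ℓ + 1) (by omega) hlt haw
    have hleq := h.rows.leq (ℓ + 1) _ (by omega) hlt hFA
    have hpos := F.hasAbsentAfter_iff_length_pos (by omega) hlt hFA
    rw [show F.k - (ℓ + 1) + 1 = F.k - ℓ by omega] at hpos
    rw [if_pos hlt, hpos] at hfl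
    have hc := F.cell_le hw (ℓ := ℓ + 1) (by omega) hlt haσ.2
    have hb := hFA.le_length
    have hl := (F.length_lastUpTo_le (ℓ + 1) (F.firstPosArch (ℓ + 1) a)).trans
      (F.length_sortedLast_le hw (ℓ + 1))
    have hmul := sub_one_mul_add (σ := σ) h1
    simp only [cell, Nat.add_sub_cancel] at hfirst hc
    have hite : (if F.lastUpTo (ℓ + 1) (F.firstPosArch (ℓ + 1) a) = [] then 1 else 0) ≤ B := by
      split_ifs <;> omega
    have hz : a ∈ F.filteredLetters ℓ ↔ F.lastUpTo (ℓ + 1) (F.firstPosArch (ℓ + 1) a) = [] := by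
      rw [hfl, List.length_pos_iff, not_not]
    simp [rowTest, h.pos, hword, h.level, hA.k, hlt, h.base, hA.input.sigma, hmul, hfirst, hleq,
      hite, hz]
    omega
  · have hs := hA.seen a haσ.1 haσ.2
    have hsl := hA.seen_le a haσ.1 haσ.2
    rw [if_neg hlt, ← hs] at hfl
    have hite : (if s.arr seenArr a = F.k + 1 then 1 else 0) ≤ B := by split_ifs <;> omega
    simp [rowTest, h.pos, hword, h.level, hA.k, hlt, hite, hfl]
    omega

/-- Here `c` counts the new element as well. For `c = 1` the old value `b` is a mere default and is
not looked up, so `hw` may assume `c ≠ 1`. -/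
theorem updateBest_runs {p a b c : ℕ} (hB : 10 * w.length ≤ B) (hpw : p ≤ w.length)
    (haw : a ≤ w.length) (hcw : c ≤ w.length) (hn : 1 ≤ w.length)
    (hp : s.reg (.tmp 0) = p) (ha : s.reg (.tmp 2) = a)
    (hc : s.reg (.tmp 1) = c) (hb : s.reg (.tmp 6) = b)
    (hw : c ≠ 1 → b ≤ w.length ∧ s.arr .word b = letterAt w b ∧ letterAt w b ≤ w.length) :
    Runs B updateBest s fun s' =>
      s'.reg = Function.update s.reg (.tmp 6)
        (if c = 1 then p else if a < letterAt w b then p else b) ∧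
      s'.arr = s.arr ∧ s'.time ≤ s.time + 40 := by
  by_cases h1 : c = 1
  · simp [updateBest, hp, hc, h1]
    omega
  · obtain ⟨h2, h3, h4⟩ := hw h1
    by_cases h5 : a < letterAt w b
    · simp [updateBest, hp, ha, hc, hb, h1, h3, h5]
      omega
    · subst hb
      simp [updateBest, ha, hc, h1, h3, h5]
      omega

theorem succ_mem_lastSet_iff (h1 : 1 ≤ ℓ) (hk : ℓ ≤ F.k)
    (hi : i < F.archEnd ℓ) :
    i + 1 ∈ F.lastSet ℓ ↔ letterAt w (i + 1) ∉ F.filteredLetters ℓ ∧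
      F.lastPosArch ℓ (letterAt w (i + 1)) = i + 1 := by
  have hen := F.archEnd_le_length ℓ
  have haw : letterAt w (i + 1) ∈ w := letterAt_mem (by omega) (by omega)
  constructor
  · intro hm
    have he := F.lastPosArch_letterAt_of_mem_lastSet h1 hk hm
    refine ⟨?_, he⟩
    rwa [← F.lastPosArch_mem_lastSet_iff h1 hk haw, he]
  · rintro ⟨hf, he⟩
    rwa [← F.lastPosArch_mem_lastSet_iff h1 hk haw, he] at hf

open Classical in
theorem rowRecord_runs (hw : IsWordOver σ w) (hB : 10 * w.length ≤ B) (h1 : 1 ≤ ℓ)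
    (hk : ℓ ≤ F.k) (h : RowInv σ w F ℓ i s) (hi : i < F.archEnd ℓ)
    (hr : s'.reg = Function.update (Function.update (Function.update s.reg (.tmp 0) (i + 1))
      (.tmp 2) (letterAt w (i + 1))) (.tmp 5)
        (if letterAt w (i + 1) ∈ F.filteredLetters ℓ then 1 else 0))
    (ha : s'.arr = s.arr) :
    Runs B rowRecord s' fun s'' => RowInv σ w F ℓ (i + 1) s'' ∧ s''.time ≤ s'.time + 100 := by
  have hmemiff := succ_mem_lastSet_iff (F := F) h1 hk hi
  have hA := h.rows.arches
  have hen := F.archEnd_le_length ℓ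
  have haw : letterAt w (i + 1) ∈ w := letterAt_mem (by omega) (by omega)
  have haσ := (hw _).1 haw
  have hσn := hw.card_le_length
  have hlast := hA.last ℓ _ h1 hk haσ.1 haσ.2
  have hlb := F.lastPosArch_le_length h1 hk haw
  have hc := F.cell_le hw h1 hk haσ.2
  have hmul := sub_one_mul_add (σ := σ) h1
  have hmn := F.mul_le_length hw hk
  have hlen : ∀ j, (F.lastUpTo ℓ j).length ≤ σ := fun j =>
    (F.length_lastUpTo_le ℓ j).trans (F.length_sortedLast_le hw ℓ)
  have hsucc := F.lastUpTo_succ ℓ i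
  have hleni := hlen i
  obtain ⟨hrows, hlev, hbase, hpos, hge, hle, hcnt, hbest, hsorted, hlex, hleq⟩ := h
  simp only [cell] at hlast hc
  by_cases hm : i + 1 ∈ F.lastSet ℓ
  · obtain ⟨hf, he⟩ := hmemiff.1 hm
    rw [if_pos hm] at hsucc
    rw [if_neg hf] at hr
    have hlen1 := hlen (i + 1)
    rw [hsucc, List.length_append, List.length_singleton] at hlen1
    simp only [rowRecord, runs_seq, runs_ite, runs_assign, runs_store, runs_skip]
    simp [hr, ha, hbase, hlast, he, hcnt]
    refine ⟨by omega, by omega, by omega, by omega, ?_⟩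
    have hL : F.lastUpTo ℓ i ≠ [] → ((F.lastUpTo ℓ i).argmin (letterAt w)).getD 0 ≤ w.length ∧
        1 ≤ ((F.lastUpTo ℓ i).argmin (letterAt w)).getD 0 := by
      intro hne
      have := (List.argmin_getD_spec (letterAt w) hne).1
      have hin := F.inArch_of_mem_lastSet h1 hk (F.mem_lastUpTo.1 this).1
      exact ⟨hin.le_length, hin.pos⟩
    refine (updateBest_runs (w := w) (p := i + 1) (a := letterAt w (i + 1))
      (b := ((F.lastUpTo ℓ i).argmin (letterAt w)).getD 0) (c := (F.lastUpTo ℓ i).length + 1) hB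
      (by omega) (by omega) (by omega) (by omega) ?_ ?_ ?_ ?_ ?_).mono ?_
    · simp
    · simp
    · simp
    · simp [hbest]
    · intro hne
      have hL := hL (by simpa using hne)
      have hwd := hA.input.word _ hL.2 hL.1
      have := (hw _).1 (letterAt_mem hL.2 hL.1)
      exact ⟨hL.1, by simp [hwd], by omega⟩
    · rintro s₂ ⟨g1, g2, g3⟩
      have hbest' := List.argmin_concat_getD (L := F.lastUpTo ℓ i) (letterAt w) (i + 1)
      rw [← hsucc] at hbest'
      simp only [Nat.add_eq_right] at g1
      rw [← hbest'] at g1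
      have hbn := (List.argmin_getD_spec (L := F.lastUpTo ℓ (i + 1)) (letterAt w)
        (by simp [hsucc])).1
      have hbn := (F.inArch_of_mem_lastSet h1 hk (F.mem_lastUpTo.1 hbn).1).le_length
      simp [g1, g2, hbase]
      refine ⟨by omega, by omega, by omega, by omega, ?_, by simp at g3; omega⟩
      refine ⟨hrows.congr (by simp) (by simp) (by simp) ?_ ?_ ?_, by simp [hlev],
        by simp [hbase], by simp, by omega, by omega, by simp [hsucc],
        by simp, ?_, ?_, ?_⟩
      · intro x hx
        simp
        rw [Function.update_of_ne (by omega)]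
      · intro x hx
        simp
        rw [Function.update_of_ne (by omega)]
      · intro x hx
        simp
        rw [Function.update_of_ne (by omega)]
      · intro t ht1 ht2
        rw [hsucc] at ht2 ⊢
        simp at ht2
        rw [letterAt_append_singleton ht1 ht2]
        split_ifs with htl
        · rw [← hsorted t ht1 htl]
          simp
          rw [Function.update_of_ne (by omega)]
        · obtain rfl : t = (F.lastUpTo ℓ i).length + 1 := by omega
          simp
      · intro t ht1 ht2
        by_cases htl : t ≤ (F.lastUpTo ℓ i).length
        · rw [hsucc, List.take_append_of_le_length htl, ← hlex t ht1 htl]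
          simp
          rw [Function.update_of_ne (by omega)]
        · have hl : (F.lastUpTo ℓ (i + 1)).length = (F.lastUpTo ℓ i).length + 1 := by simp [hsucc]
          obtain rfl : t = (F.lastUpTo ℓ i).length + 1 := by omega
          rw [List.take_of_length_le (by omega)]
          simp
      · intro j hj1 hj2
        by_cases hj : j = i + 1
        · simp [hj, hsucc]
        · simp [hj, hleq j hj1 (by omega)]
  · rw [if_neg hm] at hsucc
    -- The strict comparison of the two indicator values encodes the conjunction "not filtered out,
    -- and last in the arch".
    have hcond : ¬ (if letterAt w (i + 1) ∈ F.filteredLetters ℓ then 1 else 0) <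
        if F.lastPosArch ℓ (letterAt w (i + 1)) = i + 1 then 1 else 0 := by
      intro hc
      apply hm
      rw [hmemiff]
      split_ifs at hc <;> first | omega | exact ⟨‹_›, ‹_›⟩
    have hb1 : (if letterAt w (i + 1) ∈ F.filteredLetters ℓ then 1 else 0) ≤ B := by
      split_ifs <;> omega
    have hb2 : (if F.lastPosArch ℓ (letterAt w (i + 1)) = i + 1 then 1 else 0) ≤ B := by
      split_ifs <;> omega
    simp only [rowRecord, runs_seq, runs_ite, runs_assign, runs_store, runs_skip, RamExpr.eval,
      BinOp.eval, RamExpr.Fits, hr, ha]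
    simp [hbase, hlast, hcnt, hcond, hb1, hb2]
    refine ⟨by omega, by omega, by omega, ?_⟩
    refine ⟨hrows.congr (by simp) (by simp) (by simp) (by simp) ?_
      (by simp), by simp [hlev],
      by simp [hbase], by simp, by omega, by omega, by simp [hsucc, hcnt],
      by simp [hsucc, hbest], ?_, ?_, ?_⟩
    · intro x hx
      simp
      rw [Function.update_of_ne (by omega)]
    · rw [hsucc]
      simpa [ha] using hsorted
    · rw [hsucc]
      simpa [ha] using hlex
    · intro j hj1 hj2
      by_cases hj : j = i + 1
      · simp [hj, hsucc]
      · simp [hj, hleq j hj1 (by omega)]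

theorem RowInv.holdsRows_pred (h1 : 1 ≤ ℓ) (hk : ℓ ≤ F.k)
    (h : RowInv σ w F ℓ (F.archEnd ℓ) s) (hlen : s.arr .sortedLen ℓ = (F.sortedLast ℓ).length) :
    HoldsRows σ w F (ℓ - 1) s := by
  have hL := F.lastUpTo_archEnd h1 hk
  refine ⟨h.rows.arches, ?_, ?_, ?_, ?_⟩
  · intro m h2 h3
    rcases (show ℓ = m ∨ ℓ < m by omega) with rfl | h4
    · exact hlen
    · exact h.rows.len m h4 h3
  · intro m t h2 h3 ht1 ht2
    rcases (show ℓ = m ∨ ℓ < m by omega) with rfl | h4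
    · have := h.sorted t ht1 (by rwa [hL])
      rwa [hL] at this
    · exact h.rows.sorted m t h4 h3 ht1 ht2
  · intro m i h2 h3 hi
    rcases (show ℓ = m ∨ ℓ < m by omega) with rfl | h4
    · exact h.leq i hi.1 hi.2
    · exact h.rows.leq m i h4 h3 hi
  · intro m t h2 h3 ht1 ht2
    rcases (show ℓ = m ∨ ℓ < m by omega) with rfl | h4
    · have := h.lex t ht1 (by rwa [hL])
      rwa [hL] at this
    · exact h.rows.lex m t h4 h3 ht1 ht2

theorem RowInv.congr (h : RowInv σ w F ℓ i s) (hr : s'.reg = s.reg)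
    (ha : ∀ A, A ≠ .sortedLen → s'.arr A = s.arr A)
    (hlen : ∀ x, ℓ < x → s'.arr .sortedLen x = s.arr .sortedLen x) : RowInv σ w F ℓ i s' where
  rows := h.rows.congr (by simp [hr]) (fun A hA => ha A (by aesop)) hlen (by simp [ha])
    (by simp [ha]) (by simp [ha])
  level := by rw [hr, h.level]
  base := by rw [hr, h.base]
  pos := by rw [hr, h.pos]
  ge := h.ge
  le := h.le
  count := by rw [hr, h.count]
  best := by rw [hr, h.best]
  sorted := by rw [ha _ (by simp)]; exact h.sorted
  lex := by rw [ha _ (by simp)]; exact h.lex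
  leq := by rw [ha _ (by simp)]; exact h.leq

/-- The cost is charged to the positions of the arch, with `archEnd` as potential. Summed over all
arches it telescopes to a linear bound. -/
theorem rowProg_runs (hw : IsWordOver σ w) (hB : 10 * w.length ≤ B) (h1 : 1 ≤ ℓ) (hk : ℓ ≤ F.k)
    (h : HoldsRows σ w F ℓ s) (hlev : s.reg (.tmp 4) = ℓ) :
    Runs B rowProg s fun s' => HoldsRows σ w F (ℓ - 1) s' ∧ s'.reg (.tmp 4) = ℓ - 1 ∧
      s'.time + 300 * F.archEnd (ℓ - 1) ≤ s.time + 100 + 300 * F.archEnd ℓ := by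
  have hA := h.arches
  have hσn := hw.card_le_length
  have hkn := F.k_le_length
  have hc := F.cell_le hw h1 hk le_rfl
  have hen := F.archEnd_le_length ℓ
  have hen' := F.archEnd_le_length (ℓ - 1)
  have hmono := F.archEnd_mono (show ℓ - 1 ≤ ℓ by omega)
  have he1 := hA.ends ℓ hk
  have he2 := hA.ends (ℓ - 1) (by omega)
  have hnil := F.lastUpTo_archEnd_pred h1 hk
  simp [rowProg, hlev, he2, hA.input.sigma]
  refine ⟨by omega, by omega, ?_⟩
  refine runs_while (fun m s' => ∃ i, i + m = F.archEnd ℓ ∧ RowInv σ w F ℓ i s' ∧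
    s'.time + 300 * F.archEnd (ℓ - 1) ≤ s.time + 50 + 300 * i) ?_ ?_ ?_
    (F.archEnd ℓ - F.archEnd (ℓ - 1)) _ ⟨F.archEnd (ℓ - 1), by omega, ?_, ?_⟩
  · rintro m s' ⟨i, hi, hI, ht⟩
    have hite : (if i < F.archEnd ℓ then 1 else 0) ≤ B := by split_ifs <;> omega
    have := hI.rows.arches.ends ℓ hk
    simp [hI.pos, hI.level, this, hite]
    omega
  · rintro m s' ⟨i, hi, hI, ht⟩
    rw [runs_seq]
    refine (rowTest_runs hw hB h1 hk hI (by omega) _).mono ?_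
    rintro s₁ ⟨g1, g2, g3⟩
    refine (rowRecord_runs hw hB h1 hk hI (by omega) g1 g2).mono ?_
    rintro s₂ ⟨g4, g5⟩
    simp at g3
    exact ⟨i + 1, by omega, g4, by omega⟩
  · rintro s' ⟨i, hi, hI, ht⟩
    obtain rfl : i = F.archEnd ℓ := by omega
    have hlen := (F.length_lastUpTo_le ℓ (F.archEnd ℓ)).trans (F.length_sortedLast_le hw ℓ)
    have hcnt := hI.count
    have hlev' := hI.level
    simp [hlev', hcnt]
    refine ⟨by omega, by omega, by omega, ?_, by omega⟩
    have := (hI.congr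
      (s' := ⟨s'.reg, Function.update s'.arr .sortedLen (Function.update (s'.arr .sortedLen) ℓ
        (F.lastUpTo ℓ (F.archEnd ℓ)).length), s'.time, s'.cur, s'.out⟩) rfl
      (fun A hA => by simp [hA])
      (fun x hx => by simp [Function.update_of_ne (show x ≠ ℓ by omega)])).holdsRows_pred h1 hk
      (by simp [F.lastUpTo_archEnd h1 hk])
    exact this.congr (by simp) (by simp) (by simp) (by simp) (by simp) (by simp)
  · refine ⟨h.congr (by simp) (by simp) (by simp) (by simp) (by simp) (by simp), by simp [hlev],
      by simp, by simp, le_rfl, hmono, by simp [hnil], by simp [hnil],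
      fun t ht1 ht2 => ?_, fun t ht1 ht2 => ?_, by omega⟩
    all_goals
      rw [hnil, List.length_nil] at ht2
      omega
  · simp

theorem rowsProg_runs (hw : IsWordOver σ w) (hB : 10 * w.length ≤ B) (h : HoldsArches σ w F s) :
    Runs B rowsProg s fun s' => HoldsRows σ w F 0 s' ∧ s'.time ≤ s.time + 500 * w.length := by
  have hkn := F.k_le_length
  have hk := F.k_pos
  have hen := F.archEnd_le_length F.k
  simp [rowsProg, h.k]
  refine ⟨by omega, ?_⟩
  refine runs_while (fun m s' => m ≤ F.k ∧ HoldsRows σ w F m s' ∧ s'.reg (.tmp 4) = m ∧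
    s'.time + 300 * F.archEnd m + 110 * m ≤ s.time + 10 + 300 * F.archEnd F.k + 110 * F.k)
    ?_ ?_ ?_ F.k _ ⟨le_rfl, ?_, by simp, by simp⟩
  · rintro m s' ⟨hm, hI, h4, ht⟩
    simp [h4]
    omega
  · rintro m s' ⟨hm, hI, h4, ht⟩
    have hI' : HoldsRows σ w F (m + 1) (s'.tick ((reg (.tmp 4)).cost + 1)) :=
      hI.congr (by simp) (by simp) (by simp) (by simp) (by simp) (by simp)
    refine (rowProg_runs hw hB (by omega) hm hI' h4).mono ?_
    rintro s₁ ⟨g1, g2, g3⟩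
    simp at g1 g2 g3
    exact ⟨by omega, g1, g2, by omega⟩
  · rintro s' ⟨hm, hI, h4, ht⟩
    refine ⟨hI.congr (by simp) (by simp) (by simp) (by simp) (by simp) (by simp), ?_⟩
    simp [F.archEnd_zero] at ht ⊢
    omega
  · exact ⟨h.congr (by simp) (by simp), by omega, by omega, by omega, by omega⟩

end

/-! ### Preprocessing: `startSAS` and `init` -/

/-- Test the first position of the next letter in the first arch. -/
def startBody : RamProg :=
  assign (.tmp 2) (addE (reg (.tmp 2)) (const 1)) ;;
  assign (.tmp 0) (get .firstPosArch (reg (.tmp 2))) ;;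
  ite (get .leq (reg (.tmp 0)))
    (assign (.tmp 1) (addE (reg (.tmp 1)) (const 1)) ;;
     store .startSAS (reg (.tmp 1)) (reg (.tmp 0)) ;;
     updateBest)
    skip

/-- The list `startSAS` and the position `init`. -/
def startProg : RamProg :=
  assign (.tmp 1) (const 0) ;;
  assign (.tmp 6) (const 0) ;;
  assign (.tmp 2) (const 0) ;;
  RamProg.while (ltE (reg (.tmp 2)) (reg .sigma)) startBody ;;
  assign .startLen (reg (.tmp 1)) ;;
  assign .init (reg (.tmp 6))

def preprocessProg : RamProg := clearSeen ;; scanProg ;; rowsProg ;; startProg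

/-- The part of `startSAS` that stems from the letters up to `a`. -/
noncomputable def ArchFactorization.startUpTo {w : List ℕ} (F : ArchFactorization w) (a : ℕ) :
    List ℕ :=
  ((List.range' 1 a).map (F.firstPosArch 1)).filter (fun i => distArr w i = F.k + 1)

theorem List.sort_Icc_one (m : ℕ) : (Finset.Icc 1 m).sort (· ≤ ·) = List.range' 1 m := by
  refine List.Perm.eq_of_pairwise' ?_ ?_ ?_
    (r := (· ≤ ·))
  · exact Finset.pairwise_sort _ _
  · exact (List.pairwise_lt_range').imp le_of_lt
  · rw [List.perm_ext_iff_of_nodup (Finset.sort_nodup _ _) (List.nodup_range')]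
    intro a
    simp
    omega

section

variable {σ B a : ℕ} {w : List ℕ} {F : ArchFactorization w} {s : RamState}

theorem IsWordOver.startUpTo_eq (hw : IsWordOver σ w) : F.startUpTo σ = F.startSAS := by
  rw [ArchFactorization.startSAS, hw.toFinset_eq, List.sort_Icc_one, ArchFactorization.startUpTo]

/-- Again the condition on `dist` is decided by `Leq`: the minimum `k + 1` is attained exactly when
some element of `L'_1` lies at or before the first position of the letter. -/
theorem ArchFactorization.startUpTo_succ (ha : a + 1 ∈ w) : F.startUpTo (a + 1) =
    if 0 < (F.lastUpTo 1 (F.firstPosArch 1 (a + 1))).length then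
      F.startUpTo a ++ [F.firstPosArch 1 (a + 1)] else F.startUpTo a := by
  have hk := F.k_pos
  have h := F.hasAbsentAfter_iff_length_pos le_rfl hk (F.inArch_firstPosArch le_rfl hk ha)
  rw [show F.k - 1 + 1 = F.k by omega, ← F.distArr_firstPosArch_one ha] at h
  simp only [← h, startUpTo, List.range'_1_concat, List.map_append, List.filter_append,
    List.map_cons, List.map_nil, Nat.add_comm 1 a]
  split_ifs with hc <;> simp [hc]

/-- The letters up to `a` have been processed. -/
structure StartInv (σ : ℕ) (w : List ℕ) (F : ArchFactorization w) (a : ℕ) (s : RamState) :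
    Prop where
  rows : HoldsRows σ w F 0 s
  letter : s.reg (.tmp 2) = a
  count : s.reg (.tmp 1) = (F.startUpTo a).length
  best : s.reg (.tmp 6) = ((F.startUpTo a).argmin (letterAt w)).getD 0
  start : ∀ j, 1 ≤ j → j ≤ (F.startUpTo a).length →
    s.arr .startSAS j = letterAt (F.startUpTo a) j

theorem ArchFactorization.mem_startUpTo (hw : IsWordOver σ w) (ha : a ≤ σ) {i : ℕ}
    (hi : i ∈ F.startUpTo a) : F.InArch 1 i := by
  simp only [startUpTo, List.mem_filter, List.mem_map, List.mem_range'_1] at hi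
  obtain ⟨⟨b, hb, rfl⟩, -⟩ := hi
  exact F.inArch_firstPosArch le_rfl F.k_pos ((hw b).2 ⟨hb.1, by omega⟩)

theorem ArchFactorization.length_startUpTo_le : (F.startUpTo a).length ≤ a := by
  refine (List.length_filter_le _ _).trans ?_
  simp

theorem startBody_runs (hw : IsWordOver σ w) (hB : 10 * w.length ≤ B) (h : StartInv σ w F a s)
    (ha : a < σ) :
    Runs B startBody (s.tick 4) fun s' => StartInv σ w F (a + 1) s' ∧
      s'.time ≤ s.time + 80 := by
  have hk := F.k_pos
  have hσn := hw.card_le_length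
  have haw : a + 1 ∈ w := (hw _).2 ⟨by omega, by omega⟩
  obtain ⟨hrows, hlet, hcnt, hbest, hstart⟩ := h
  have hA := hrows.arches
  have hin := F.inArch_firstPosArch le_rfl hk haw
  have hfirst := hA.first 1 (a + 1) le_rfl hk (by omega) (by omega)
  have hleq := hrows.leq 1 _ (by omega) hk hin
  have hpn := hin.le_length
  have hla := F.letterAt_firstPosArch le_rfl hk haw
  have hlen : (F.lastUpTo 1 (F.firstPosArch 1 (a + 1))).length ≤ σ :=
    (F.length_lastUpTo_le 1 _).trans (F.length_sortedLast_le hw 1)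
  have hsucc := F.startUpTo_succ haw
  have hsl := F.length_startUpTo_le (a := a)
  simp only [cell, Nat.sub_self, Nat.zero_mul, Nat.zero_add] at hfirst
  by_cases hpos : 0 < (F.lastUpTo 1 (F.firstPosArch 1 (a + 1))).length
  · rw [if_pos hpos] at hsucc
    have hne := List.length_pos_iff.1 hpos
    simp [startBody, hlet, hfirst, hleq, hne, hcnt]
    refine ⟨by omega, by omega, by omega, by omega, by omega, by omega, ?_⟩
    refine (updateBest_runs (w := w) (p := F.firstPosArch 1 (a + 1)) (a := a + 1)
      (b := ((F.startUpTo a).argmin (letterAt w)).getD 0) (c := (F.startUpTo a).length + 1) hB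
      hpn (by omega) (by omega) (by omega) ?_ ?_ ?_ ?_ ?_).mono ?_
    · simp
    · simp
    · simp
    · simp [hbest]
    · intro hne
      have hm := F.mem_startUpTo hw ha.le
        (List.argmin_getD_spec (L := F.startUpTo a) (letterAt w) (by simpa using hne)).1
      have hwd := hA.input.word _ hm.pos hm.le_length
      have := (hw _).1 (letterAt_mem hm.pos hm.le_length)
      exact ⟨hm.le_length, by simp [hwd], by omega⟩
    · rintro s₂ ⟨g1, g2, g3⟩
      have hbest' := List.argmin_concat_getD (L := F.startUpTo a) (letterAt w)
        (F.firstPosArch 1 (a + 1))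
      rw [← hsucc, hla] at hbest'
      simp only [Nat.add_eq_right] at g1
      rw [← hbest'] at g1
      refine ⟨⟨hrows.congr (by simp [g1]) (by simp [g2]) (by simp [g2]) (by simp [g2])
        (by simp [g2]) (by simp [g2]), by simp [g1], by simp [g1, hsucc], by simp [g1], ?_⟩, ?_⟩
      · intro j hj1 hj2
        rw [hsucc, List.length_append, List.length_singleton] at hj2
        rw [hsucc, letterAt_append_singleton hj1 hj2, g2]
        split_ifs with hj
        · rw [← hstart j hj1 hj]
          simp [Function.update_of_ne (show j ≠ (F.startUpTo a).length + 1 by omega)]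
        · obtain rfl : j = (F.startUpTo a).length + 1 := by omega
          simp
      · simp at g3
        omega
  · rw [if_neg hpos] at hsucc
    have hne : F.lastUpTo 1 (F.firstPosArch 1 (a + 1)) = [] := by simpa using hpos
    simp [startBody, hlet, hfirst, hleq, hne]
    refine ⟨by omega, by omega, by omega, hrows.congr (by simp) (by simp) (by simp) (by simp)
      (by simp) (by simp), by simp, by simp [hcnt, hsucc], by simp [hbest, hsucc], ?_⟩
    rw [hsucc]
    exact hstart

theorem startProg_runs (hw : IsWordOver σ w) (hσ : 1 ≤ σ) (hB : 10 * w.length ≤ B)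
    (h : HoldsRows σ w F 0 s) :
    Runs B startProg s fun s' => HoldsData σ w F s' ∧ s'.time ≤ s.time + 200 * w.length := by
  have hσn := hw.card_le_length
  have hz : F.startUpTo 0 = [] := by simp [ArchFactorization.startUpTo]
  simp [startProg]
  refine runs_while (fun m s' => ∃ a, a + m = σ ∧ StartInv σ w F a s' ∧
    s'.time ≤ s.time + 10 + 100 * a) ?_ ?_ ?_ σ _ ⟨0, by omega, ?_, by simp⟩
  · rintro m s' ⟨a, ha, hI, ht⟩
    have hite : (if a < σ then 1 else 0) ≤ B := by split_ifs <;> omega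
    simp [hI.letter, hI.rows.arches.input.sigma, hite]
    omega
  · rintro m s' ⟨a, ha, hI, ht⟩
    refine (startBody_runs hw hB hI (by omega)).mono ?_
    rintro s₁ ⟨g1, g2⟩
    exact ⟨a + 1, by omega, g1, by omega⟩
  · rintro s' ⟨a, ha, hI, ht⟩
    obtain rfl : a = σ := by omega
    obtain ⟨hrows, hlet, hcnt, hbest, hstart⟩ := hI
    rw [hw.startUpTo_eq] at hcnt hbest hstart
    have hbn := (F.startSAS_spec (List.argmin_getD_spec (letterAt w) F.startSAS_ne_nil).1).1
    have hbl := hbn.le_length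
    have hsl := F.length_startSAS_le hw
    have hA := hrows.arches
    simp [hcnt, hbest]
    refine ⟨by omega, by omega, ?_, by omega⟩
    refine ⟨hA.input.congr (by simp) (by simp) rfl, by simp [hA.k], hA.ends, hA.first, hA.last,
      fun ℓ h1 h2 => hrows.len ℓ h1 h2, fun ℓ t h1 h2 => hrows.sorted ℓ t h1 h2, ?_,
      fun ℓ t h1 h2 => hrows.lex ℓ t h1 h2, by simp, hstart, by simp [ArchFactorization.init]⟩
    intro ℓ i h1 h2 hi
    rw [F.leqArr_unbotD]
    exact hrows.leq ℓ i h1 h2 hi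
  · exact ⟨h.congr (by simp) (by simp) (by simp) (by simp) (by simp) (by simp), by simp,
      by simp [hz], by simp [hz], fun j h1 h2 => by rw [hz, List.length_nil] at h2; omega⟩

theorem preprocessProg_runs (hw : IsWordOver σ w) (hσ : 1 ≤ σ) (hB : 10 * w.length ≤ B)
    (hin : HoldsInput σ w s) (hs : s.Fresh) :
    Runs B preprocessProg s fun s' => HoldsData σ w F s' ∧ s'.time ≤ 1000 * w.length := by
  have hσn := hw.card_le_length
  have h0 := hs.1
  simp only [preprocessProg, runs_seq]
  refine (clearSeen_runs hw hσ hB hin).mono ?_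
  rintro s₁ ⟨h1, h2, h3⟩
  refine (scanProg_runs (F := F) hw hσ hB h1 h2).mono ?_
  rintro s₂ ⟨h4, h5⟩
  refine (rowsProg_runs hw hB h4).mono ?_
  rintro s₃ ⟨h6, h7⟩
  refine (startProg_runs hw hσ hB h6).mono ?_
  rintro s₄ ⟨h8, h9⟩
  exact ⟨h8, by omega⟩

end

/-! ### Assembly -/

theorem mainTheorem5 :
    ∃ (preprocess check lexMin enumerate : RamProg) (c C : ℕ) (delay : Polynomial ℕ),
      ∀ (σ : ℕ) (w : List ℕ) (F : ArchFactorization w), 1 ≤ σ → IsWordOver σ w →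
        -- linear-time preprocessing
        (∀ s, s.Fresh → HoldsInput σ w s →
          ∃ s', Exec (c * w.length) preprocess s s' ∧ HoldsData σ w F s' ∧
            s'.time ≤ C * w.length) ∧
        -- checking a word of length `k + 1` in time `O(k)`
        (∀ (u : List ℕ), u.length = F.k + 1 → (∀ a ∈ u, a ∈ w) →
          ∀ s, s.Fresh → HoldsData σ w F s → HoldsQuery u s →
            ∃ s', Exec (c * w.length) check s s' ∧ HoldsData σ w F s' ∧
              s'.time ≤ C * F.k ∧
              (IsSAS w u → s'.reg .ans = 1) ∧ (¬ IsSAS w u → s'.reg .ans = 0)) ∧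
        -- the lexicographically smallest SAS in time `O(k)`
        (∀ s, s.Fresh → HoldsData σ w F s →
          ∃ s', Exec (c * w.length) lexMin s s' ∧ HoldsData σ w F s' ∧
            s'.time ≤ C * F.k ∧ s'.cur = [] ∧
            ∃ (u : List ℕ) (t : ℕ), s'.out = [(u, t)] ∧ IsSAS w u ∧
              ∀ v, IsSAS w v → u ≤ v) ∧
        -- enumeration of all SAS, each exactly once, with polynomial delay
        (∀ s, s.Fresh → HoldsData σ w F s →
          ∃ s', Exec (c * w.length) enumerate s s' ∧ HoldsData σ w F s' ∧
            s'.cur = [] ∧ (s'.out.map Prod.fst).Nodup ∧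
            (∀ v, v ∈ s'.out.map Prod.fst ↔ IsSAS w v) ∧
            DelayAtMost (delay.eval w.length) s') := by
  -- The constants `10` and `1000` are generous; the polynomial is `enumDelay`.
  refine ⟨preprocessProg, checkProg, lexMinProg, enumProg, 10, 1000,
    Polynomial.C 1000 * Polynomial.X + Polynomial.C 1000, fun σ w F hσ hw => ⟨?_, ?_, ?_, ?_⟩⟩
  · exact fun s hs hin => preprocessProg_runs hw hσ le_rfl hin hs
  · exact fun u hul huw s hs hd hq => checkProg_runs hw le_rfl hd hq hul huw hs
  · intro s hs hd
    obtain ⟨s', h1, h2, h3, h4, t, h5⟩ := lexMinProg_runs hw le_rfl hd hs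
    exact ⟨s', h1, h2, h3, h4, _, t, h5, F.lexMin_spec⟩
  · intro s hs hd
    obtain ⟨s', h1, h2, h3, h4, h5⟩ := enumProg_runs hw le_rfl hd hs
    refine ⟨s', h1, h2, h3, h4 ▸ F.nodup_sasList, fun v => h4 ▸ F.mem_sasList, ?_⟩
    simpa using h5
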